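/- Theorem 1. For $t>0$ let $N(t)$ denote the number of zeros of the Riemann zeta-function $\zeta$, counted with multiplicity, whose ordinates (imaginary parts) lie in $(0,t]$. For $t>0$ which is not the ordinate of a zero, let $S(t)=\frac1\pi\arg\zeta(\frac12+it)$, where the argument is obtained by continuous variation along the straight line segments joining $2$, $2+it$ and $\frac12+it$, starting with the value $0$; if $t>0$ is the ordinate of a zero, let $S(t)=\frac12\lim_{\epsilon\to0^+}\{S(t+\epsilon)+S(t-\epsilon)\}$. Assume the Riemann Hypothesis. Then, for all sufficiently large $t$ and all $h$ with $0<h\le\sqrt t$, $$\Big|N(t+h)-N(t)-\frac{h}{2\pi}\log\frac{t}{2\pi}\Big|\le\Big(\frac12+o(1)\Big)\frac{\log t}{\log\log t}$$ and, equivalently, $$\big|S(t+h)-S(t)\big|\le\Big(\frac12+o(1)\Big)\frac{\log t}{\log\log t},$$ where in each estimate $o(1)$ denotes a quantity depending only on $t$ that tends to $0$ as $t\to\infty$ (so the estimates are uniform in $h$). -/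

import Mathlib

open Filter Topology

/-- `N(t)`: the number of zeros of the Riemann zeta-function, counted with multiplicity, whose
ordinate (imaginary part) lies in `(0, t]`. -/
noncomputable def zetaZeroCount (t : ℝ) : ℕ :=
  ∑ᶠ ρ ∈ {ρ : ℂ | riemannZeta ρ = 0 ∧ 0 < ρ.im ∧ ρ.im ≤ t}, analyticOrderNatAt riemannZeta ρ

/-- `t` is the ordinate of a zero of the Riemann zeta-function. -/
def IsZetaOrdinate (t : ℝ) : Prop :=
  ∃ ρ : ℂ, riemannZeta ρ = 0 ∧ ρ.im = t

/-- `a` is the value at `1/2 + it` (for `t > 0`) of the argument of `ζ` obtained by continuous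
variation along the straight line segments joining `2`, `2 + it` and `1/2 + it`, starting with the
value `0`. Here `α y` is the argument at `2 + iy` and `β σ` the argument at `σ + it`. -/
def IsZetaArg (t a : ℝ) : Prop :=
  ∃ α β : ℝ → ℝ,
    ContinuousOn α (Set.Icc 0 t) ∧
    (∀ y ∈ Set.Icc 0 t, riemannZeta (2 + y * Complex.I) =
      ‖riemannZeta (2 + y * Complex.I)‖ * Complex.exp (α y * Complex.I)) ∧
    ContinuousOn β (Set.Icc (1 / 2) 2) ∧
    (∀ σ ∈ Set.Icc (1 / 2 : ℝ) 2, riemannZeta (σ + t * Complex.I) =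
      ‖riemannZeta (σ + t * Complex.I)‖ * Complex.exp (β σ * Complex.I)) ∧
    α 0 = 0 ∧ β 2 = α t ∧ β (1 / 2) = a

open Classical in
/-- The argument of `ζ(1/2 + it)` by continuous variation, for `t > 0` not the ordinate of a zero
(there is then exactly one `a` with `IsZetaArg t a`). -/
noncomputable def zetaArg (t : ℝ) : ℝ :=
  if h : ∃ a, IsZetaArg t a then h.choose else 0

open Classical in
/-- `S(t)`: equal to `(1/π) arg ζ(1/2 + it)` if `t` is not the ordinate of a zero, and to
`(1/2) lim_{ε → 0+} (S(t + ε) + S(t - ε))` if it is (the ordinates being isolated, `t ± ε` are not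
ordinates for small `ε > 0`). -/
noncomputable def zetaS (t : ℝ) : ℝ :=
  if IsZetaOrdinate t then
    (1 / 2) * limUnder (𝓝[>] (0 : ℝ)) fun ε : ℝ =>
      zetaArg (t + ε) / Real.pi + zetaArg (t - ε) / Real.pi
  else
    zetaArg t / Real.pi

/-! Beurling's entire function `beurling`, of exponential type `2π`, lies above the sign function on
the real line with total excess at most `1`. Rescaling by `D ≥ 1` and taking half-sums gives an
entire majorant of the indicator of `(t, t + h]`, and the reflection `z ↦ -beurling (-z)` gives a
minorant. Their integrals differ from `h` by at most `1 / D` in the relevant direction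
(`integral_majorant_le`, `le_integral_minorant`). The number of zeros is thus trapped between two
sums of `F(γ)`, with `F` entire of type `2πD`.

Such a sum is read off from the integral of `F · ζ'/ζ` round a rectangle whose left side lies on the
critical line (`im_sideIntegral_mul_logDeriv`). Under RH every zero in the window lies on that side
and contributes half a residue, `π F(γ)`; elsewhere on it the functional equation gives `Re ζ'/ζ =
-θ'`. Hence `π ∑ F(γ) - ∫ F θ'` equals the imaginary part of the integral along the other three
sides. The right side is `Re s = σ` with `σ` slightly above `1`. There `ζ'/ζ` and its primitive `log
ζ` are bounded, and `F` is the indicator plus `O(e^{2πD(σ - 1/2)})` times an integrable function, so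
this side costs `O(e^{2πD(σ - 1/2)})`, uniformly in `h`. The horizontal sides are placed near
heights `t/2` and `3t`, where `ζ'/ζ` is at most linear in the height (Jensen to find heights far
from zeros, then Borel–Carathéodory), while `F` decays quadratically. No sum over primes has to be
evaluated.

By Stirling, `θ'(y)` may be replaced by `(1/2) log (t / 2π)` with bounded total error, which uses `h
= O(√t)`. So the count differs from its main term by at most `log t / (2πD) + O(e^{2πD(σ - 1/2)})`
(`exists_abs_zetaZeroCount_sub_le`). With `D` just below `(1/π) log log t` and `σ` near `1` the
exponential is a power of `log t` below `1`, and the first term is `(1/2 + ε) log t / log log t`.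

For `S`, the same rectangle identity with weight `1` is the Riemann–von Mangoldt formula
(`zetaArg_sub_zetaArg`). It expresses `S(t + h) - S(t)` through the mean of the counts at `t` and
just below `t`, minus `(1/π) ∫ θ'`, so the bound for `N` transfers (`exists_zetaS_eq`,
`eventually_abs_zetaS_sub_le`). -/

/-! ### A linear bound for `ζ` to the right of `Re s = 1/4` -/

open Complex in
/-- The `n`-th term of the series for `ζ(s) - 1/(s-1)` converging on `Re s > 0`. -/
noncomputable def zetaTerm (n : ℕ) (s : ℂ) : ℂ :=
  1 / ((n : ℂ) + 1) ^ s
    - (1 / ((n : ℂ) + 1) ^ (s - 1) - 1 / ((n : ℂ) + 2) ^ (s - 1)) / (s - 1)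

-- The term is the integral of `(n+1)^{-s} - x^{-s}` over `[n+1, n+2]`, and the mean value
-- inequality bounds the integrand. The gain of one power of `n` is what gives convergence on all of
-- `Re s > 0`.
open Complex in
lemma norm_zetaTerm_le (n : ℕ) {s : ℂ} (hs : 0 < s.re) (h1 : s ≠ 1) :
    ‖zetaTerm n s‖ ≤ ‖s‖ * ((n : ℝ) + 1) ^ (-s.re - 1) := by
  have hn : (0 : ℝ) < n + 1 := by positivity
  have hs0 : s ≠ 0 := by rintro rfl; simp at hs
  have key : zetaTerm n s = ∫ x in ((n : ℝ) + 1)..(n + 2),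
      (((n : ℂ) + 1) ^ (-s) - (x : ℂ) ^ (-s)) := by
    rw [intervalIntegral.integral_sub (by simp)]
    · rw [intervalIntegral.integral_const, integral_cpow]
      · rw [zetaTerm]
        have e1 : -s + 1 = -(s - 1) := by ring
        rw [e1, cpow_neg, cpow_neg, cpow_neg]
        push_cast
        have : s - 1 ≠ 0 := sub_ne_zero.mpr h1
        simp only [show ((n : ℝ) + 2 - (n + 1)) = 1 by ring, one_smul, one_div]
        rw [div_neg, ← neg_div, neg_sub]
      · right
        refine ⟨fun h => h1 ?_, ?_⟩
        · linear_combination -h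
        · rw [Set.uIcc_of_le (by linarith)]
          intro h; linarith [h.1]
    · refine ContinuousOn.intervalIntegrable fun x hx => ?_
      rw [Set.uIcc_of_le (by linarith)] at hx
      exact (continuousAt_ofReal_cpow_const _ _ (Or.inr (by linarith [hx.1]))).continuousWithinAt
  rw [key]
  have := intervalIntegral.norm_integral_le_of_norm_le_const (a := (n : ℝ) + 1) (b := n + 2)
    (f := fun x : ℝ => ((n : ℂ) + 1) ^ (-s) - (x : ℂ) ^ (-s))
    (C := ‖s‖ * ((n : ℝ) + 1) ^ (-s.re - 1)) ?_
  · simpa [show ((n : ℝ) + 2 - (n + 1)) = 1 by ring] using this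
  intro x hx
  rw [Set.uIoc_of_le (by linarith)] at hx
  have hderiv : ∀ u ∈ Set.Icc ((n : ℝ) + 1) (n + 2),
      HasDerivWithinAt (fun u : ℝ => (u : ℂ) ^ (-s)) (-s * (u : ℂ) ^ (-s - 1))
        (Set.Icc ((n : ℝ) + 1) (n + 2)) u := by
    intro u hu
    have hu0 : 0 < u := by linarith [hu.1]
    have := (hasDerivAt_id (u : ℂ)).cpow_const (c := -s) (by simp [hu0])
    have := this.comp_ofReal
    simpa using this.hasDerivWithinAt
  have hb : ∀ u ∈ Set.Icc ((n : ℝ) + 1) (n + 2),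
      ‖-s * (u : ℂ) ^ (-s - 1)‖ ≤ ‖s‖ * ((n : ℝ) + 1) ^ (-s.re - 1) := by
    intro u hu
    have hu0 : 0 < u := by linarith [hu.1]
    rw [norm_mul, norm_neg, norm_cpow_eq_rpow_re_of_pos hu0]
    gcongr
    simp only [sub_re, neg_re, one_re]
    exact Real.rpow_le_rpow_of_nonpos hn hu.1 (by linarith)
  have := (convex_Icc ((n : ℝ) + 1) (n + 2)).norm_image_sub_le_of_norm_hasDerivWithin_le hderiv hb
    (x := x) (y := (n : ℝ) + 1) ⟨hx.1.le, hx.2⟩ ⟨le_rfl, by linarith⟩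
  push_cast at this
  refine this.trans ?_
  have : ‖(n : ℝ) + 1 - x‖ ≤ 1 := by
    rw [Real.norm_eq_abs, abs_le]; constructor <;> linarith [hx.1, hx.2]
  exact mul_le_of_le_one_right (by positivity) this

lemma summable_succ_rpow {p : ℝ} (hp : p < -1) : Summable fun n : ℕ => ((n : ℝ) + 1) ^ p := by
  have := (summable_nat_add_iff 1).mpr (Real.summable_nat_rpow.mpr hp)
  simpa using this

-- The subtracted differences telescope to `1`, which produces the polar part `1 / (s - 1)`.
open Complex in
lemma hasSum_zetaTerm {s : ℂ} (hs : 1 < s.re) :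
    HasSum (fun n => zetaTerm n s) (riemannZeta s - 1 / (s - 1)) := by
  have h1 : s ≠ 1 := by rintro rfl; simp at hs
  have hz : HasSum (fun n : ℕ => 1 / ((n : ℂ) + 1) ^ s) (riemannZeta s) := by
    rw [zeta_eq_tsum_one_div_nat_add_one_cpow hs]
    refine Summable.hasSum ?_
    have := (summable_nat_add_iff 1).mpr (Complex.summable_one_div_nat_cpow.mpr hs)
    simpa using this
  have ht : HasSum (fun n : ℕ => (1 / ((n : ℂ) + 1) ^ (s - 1) - 1 / ((n : ℂ) + 2) ^ (s - 1)))
      1 := by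
    have hsum : Summable (fun n : ℕ => (1 / ((n : ℂ) + 1) ^ (s - 1) - 1 / ((n : ℂ) + 2) ^ (s - 1))) := by
      have h2 : Summable fun n => zetaTerm n s := by
        refine Summable.of_norm_bounded (g := fun n : ℕ => ‖s‖ * ((n : ℝ) + 1) ^ (-s.re - 1)) ?_
          (fun n => norm_zetaTerm_le n (by linarith) h1)
        exact (summable_succ_rpow (by linarith)).mul_left _
      have h3 := (hz.summable.sub h2).mul_left (s - 1)
      refine h3.congr fun n => ?_
      have : s - 1 ≠ 0 := sub_ne_zero.mpr h1
      rw [zetaTerm]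
      field_simp
      ring
    rw [hsum.hasSum_iff_tendsto_nat]
    have e : ∀ N : ℕ, ∑ i ∈ Finset.range N,
        (1 / ((i : ℂ) + 1) ^ (s - 1) - 1 / ((i : ℂ) + 2) ^ (s - 1)) =
        1 - 1 / ((N : ℂ) + 1) ^ (s - 1) := by
      intro N
      have := Finset.sum_range_sub' (fun i : ℕ => 1 / ((i : ℂ) + 1) ^ (s - 1)) N
      simp only [Nat.cast_zero, zero_add, one_cpow, div_one] at this
      rw [← this]
      refine Finset.sum_congr rfl fun i _ => ?_
      push_cast
      ring_nf
    simp_rw [e]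
    have : Tendsto (fun N : ℕ => 1 / ((N : ℂ) + 1) ^ (s - 1)) atTop (𝓝 0) := by
      rw [tendsto_zero_iff_norm_tendsto_zero]
      have e2 : ∀ N : ℕ, ‖1 / ((N : ℂ) + 1) ^ (s - 1)‖ = ((N : ℝ) + 1) ^ (-(s.re - 1)) := by
        intro N
        have : ((N : ℂ) + 1) = (((N : ℝ) + 1 : ℝ) : ℂ) := by push_cast; rfl
        rw [norm_div, norm_one, this, norm_cpow_eq_rpow_re_of_pos (by positivity),
          Real.rpow_neg (by positivity)]
        simp
      simp_rw [e2]
      have := (tendsto_rpow_neg_atTop (y := s.re - 1) (by linarith)).comp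
        (tendsto_atTop_add_const_right atTop (1 : ℝ) tendsto_natCast_atTop_atTop)
      exact this
    simpa using this.const_sub 1
  simpa [zetaTerm] using hz.sub (ht.div_const (s - 1))

-- Identity theorem: both sides are holomorphic on the quadrant `Re s > 0`, `Im s > 0`, which is
-- convex and avoids the pole, and they agree near `2 + i`.
open Complex in
lemma riemannZeta_eq_tsum_zetaTerm {s : ℂ} (hs : 0 < s.re) (him : 0 < s.im) :
    riemannZeta s = 1 / (s - 1) + ∑' n, zetaTerm n s := by
  set U : Set ℂ := {z | 0 < z.re ∧ 0 < z.im} with hU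
  have hUo : IsOpen U := (isOpen_lt continuous_const continuous_re).inter
    (isOpen_lt continuous_const continuous_im)
  have hne : ∀ z ∈ U, z ≠ 1 := by rintro z ⟨_, h⟩ rfl; simp at h
  have hd : DifferentiableOn ℂ (fun s => ∑' n, zetaTerm n s) U := by
    intro z hz
    have hz' : z ∈ U ∩ Metric.ball 0 (‖z‖ + 1) ∩ {w | z.re / 2 < w.re} := by
      refine ⟨⟨hz, by simp⟩, ?_⟩
      have := hz.1
      show z.re / 2 < z.re
      linarith
    have hVo : IsOpen (U ∩ Metric.ball 0 (‖z‖ + 1) ∩ {w : ℂ | z.re / 2 < w.re}) :=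
      (hUo.inter Metric.isOpen_ball).inter (isOpen_lt continuous_const continuous_re)
    have hz1 := hz.1
    refine (((differentiableOn_tsum_of_summable_norm
      (u := fun n : ℕ => (‖z‖ + 1) * ((n : ℝ) + 1) ^ (-(z.re / 2) - 1)) ?_ ?_ hVo ?_) z
        hz').differentiableAt (hVo.mem_nhds hz')).differentiableWithinAt
    · exact (summable_succ_rpow (by linarith)).mul_left _
    · intro n w hw
      have hw1 : w - 1 ≠ 0 := sub_ne_zero.mpr (hne w hw.1.1)
      have a1 : ((n : ℂ) + 1) ≠ 0 := by exact_mod_cast Nat.succ_ne_zero n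
      have a2 : ((n : ℂ) + 2) ≠ 0 := by exact_mod_cast Nat.succ_ne_zero (n + 1)
      unfold zetaTerm
      refine DifferentiableAt.differentiableWithinAt ?_
      refine DifferentiableAt.sub ?_ (DifferentiableAt.div (DifferentiableAt.sub ?_ ?_) ?_ hw1)
      · refine DifferentiableAt.div (differentiableAt_const _) ?_ ((cpow_ne_zero_iff_of_exponent_ne_zero ?_).mpr a1)
        · exact (differentiableAt_id).const_cpow (Or.inl a1)
        · rintro rfl; simpa using hw.1.1.1
      · refine DifferentiableAt.div (differentiableAt_const _) ?_ ((cpow_ne_zero_iff_of_exponent_ne_zero hw1).mpr a1)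
        exact (differentiableAt_id.sub_const 1).const_cpow (Or.inl a1)
      · refine DifferentiableAt.div (differentiableAt_const _) ?_ ((cpow_ne_zero_iff_of_exponent_ne_zero hw1).mpr a2)
        exact (differentiableAt_id.sub_const 1).const_cpow (Or.inl a2)
      · fun_prop
    · intro n w hw
      refine (norm_zetaTerm_le n hw.1.1.1 (hne w hw.1.1)).trans ?_
      have : ‖w‖ ≤ ‖z‖ + 1 := by
        have := hw.1.2; rw [mem_ball_zero_iff] at this; exact this.le
      have h2 : z.re / 2 < w.re := hw.2
      gcongr
      · linarith [(Nat.cast_nonneg n : (0 : ℝ) ≤ n)]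
  have hf : AnalyticOnNhd ℂ riemannZeta U := by
    refine DifferentiableOn.analyticOnNhd (fun z hz => ?_) hUo
    exact (differentiableAt_riemannZeta (hne z hz)).differentiableWithinAt
  have hg : AnalyticOnNhd ℂ (fun s => 1 / (s - 1) + ∑' n, zetaTerm n s) U := by
    refine DifferentiableOn.analyticOnNhd (DifferentiableOn.add ?_ hd) hUo
    intro z hz
    have hz1 : z - 1 ≠ 0 := sub_ne_zero.mpr (hne z hz)
    refine DifferentiableAt.differentiableWithinAt ?_
    fun_prop (disch := assumption)
  have hconv : Convex ℝ U := (convex_halfSpace_re_gt 0).inter (convex_halfSpace_im_gt 0)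
  have h2 : (2 + I : ℂ) ∈ U := by simp [hU]
  refine hf.eqOn_of_preconnected_of_eventuallyEq hg hconv.isPreconnected h2 ?_ ⟨hs, him⟩
  have : {z : ℂ | 1 < z.re} ∈ 𝓝 (2 + I : ℂ) :=
    (isOpen_lt continuous_const continuous_re).mem_nhds (by simp)
  filter_upwards [this] with z hz
  rw [(hasSum_zetaTerm hz).tsum_eq]
  ring

/-- The margin to the left of the critical line is needed because the discs used below reach past
it. Only the logarithm of this bound matters later, so no convexity estimate is required. -/
lemma exists_norm_riemannZeta_le :
    ∃ C : ℝ, 1 ≤ C ∧ ∀ s : ℂ, 1 / 4 ≤ s.re → 1 ≤ s.im → ‖riemannZeta s‖ ≤ C * ‖s‖ := by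
  have hsum := summable_succ_rpow (p := -(1 / 4) - 1) (by norm_num)
  have hpos : 0 ≤ ∑' n : ℕ, ((n : ℝ) + 1) ^ (-(1 / 4 : ℝ) - 1) := tsum_nonneg fun n => by positivity
  refine ⟨1 + ∑' n : ℕ, ((n : ℝ) + 1) ^ (-(1 / 4 : ℝ) - 1), by linarith, fun s h1 h2 => ?_⟩
  have hs1 : s ≠ 1 := by rintro rfl; norm_num at h2
  rw [riemannZeta_eq_tsum_zetaTerm (by linarith) (by linarith), add_mul, one_mul]
  have him : ∀ z : ℂ, z.im = s.im → 1 ≤ ‖z‖ := fun z hz =>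
    (h2.trans (hz ▸ le_abs_self _)).trans (Complex.abs_im_le_norm z)
  refine (norm_add_le _ _).trans (add_le_add ?_ ?_)
  · rw [norm_div, norm_one]
    have a := him (s - 1) (by simp)
    exact (div_le_one_of_le₀ a (by positivity)).trans (him s rfl)
  · rw [mul_comm, ← tsum_mul_left]
    refine tsum_of_norm_bounded (hsum.mul_left _).hasSum fun n => ?_
    refine (norm_zetaTerm_le n (by linarith) hs1).trans ?_
    gcongr
    linarith [(Nat.cast_nonneg n : (0 : ℝ) ≤ n)]

/-! ### Logarithms of nonvanishing functions and elementary bounds for `ζ` -/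

open Metric in
/-- A nonvanishing holomorphic function on a disc has a logarithm normalised at the centre. -/
lemma exists_log_of_ne_zero {f : ℂ → ℂ} {c : ℂ} {R : ℝ} (hR : 0 < R)
    (hf : DifferentiableOn ℂ f (ball c R)) (h0 : ∀ z ∈ ball c R, f z ≠ 0) :
    ∃ g : ℂ → ℂ, DifferentiableOn ℂ g (ball c R) ∧ g c = 0 ∧
      (∀ z ∈ ball c R, f z = f c * Complex.exp (g z)) ∧
      (∀ z ∈ ball c R, deriv g z = logDeriv f z) := by
  have hd : DifferentiableOn ℂ (logDeriv f) (ball c R) :=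
    (hf.deriv isOpen_ball).div hf h0
  obtain ⟨g, hgc, hg⟩ := hd.isExactOn_ball.with_val_at c 0
  have hgd : DifferentiableOn ℂ g (ball c R) := fun z hz =>
    (hg z hz).differentiableAt.differentiableWithinAt
  have hcR : c ∈ ball c R := mem_ball_self hR
  refine ⟨g, hgd, hgc, fun z hz => ?_, fun z hz => (hg z hz).deriv⟩
  have hder : ∀ w ∈ ball c R, HasDerivAt (fun w => f w * Complex.exp (-g w)) 0 w := by
    intro w hw
    have h1 := (hf.differentiableAt (isOpen_ball.mem_nhds hw)).hasDerivAt
    have h2 := (hg w hw).neg.cexp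
    have h3 : HasDerivAt (fun w => f w * Complex.exp (-g w)) _ w := h1.mul h2
    refine h3.congr_deriv ?_
    have := h0 w hw
    simp only [Pi.neg_apply, logDeriv_apply]
    field_simp
    ring
  have hconst := (convex_ball c R).is_const_of_fderivWithin_eq_zero (𝕜 := ℂ)
    (f := fun w => f w * Complex.exp (-g w))
    (fun w hw => (hder w hw).differentiableAt.differentiableWithinAt)
    (fun w hw => by
      rw [fderivWithin_of_isOpen isOpen_ball hw]
      have := (hder w hw).hasFDerivAt.fderiv
      rw [this]; ext; simp) hz hcR
  simp only [hgc, neg_zero, Complex.exp_zero, mul_one] at hconst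
  rw [← hconst, mul_assoc, ← Complex.exp_add]
  simp

open Metric in
/-- Borel–Carathéodory bounds for the logarithm of a nonvanishing function and its derivative. -/
lemma log_bounds_of_ne_zero {f : ℂ → ℂ} {c : ℂ} {R r K : ℝ} (hr : 0 < r) (hrR : r < R)
    (hK : 0 < K) (hf : DifferentiableOn ℂ f (ball c R)) (h0 : ∀ z ∈ ball c R, f z ≠ 0)
    (hM : ∀ z ∈ ball c R, ‖f z‖ ≤ ‖f c‖ * Real.exp K) {z : ℂ} (hz : z ∈ closedBall c r) :
    ‖f c‖ * Real.exp (-(2 * K * R / (R - r))) ≤ ‖f z‖ ∧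
      ‖logDeriv f z‖ ≤ 8 * K * R / (R - r) ^ 2 := by
  have hR : 0 < R := hr.trans hrR
  obtain ⟨g, hg, hgc, hexp, hder⟩ := exists_log_of_ne_zero hR hf h0
  have hcR : c ∈ ball c R := mem_ball_self hR
  have hfc : 0 < ‖f c‖ := norm_pos_iff.mpr (h0 c hcR)
  have hre : ∀ z ∈ ball c R, (g z).re ≤ K := by
    intro z hz
    have := hM z hz
    rw [hexp z hz, norm_mul, Complex.norm_exp] at this
    exact Real.exp_le_exp.mp (le_of_mul_le_mul_left this hfc)
  have hbc : ∀ w : ℂ, ‖w - c‖ < R → ‖g w‖ ≤ 2 * K * R / (R - ‖w - c‖) := by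
    intro w hw
    have h1 := Complex.borelCaratheodory_zero (f := fun w => g (c + w)) (z := w - c) (M := K) (R := R) hK
      ?_ ?_ hR (by simpa using hw) (by simpa using hgc)
    · simp only [add_sub_cancel] at h1
      refine h1.trans ?_
      have : 0 < R - ‖w - c‖ := by linarith
      gcongr
    · refine hg.comp (by fun_prop) ?_
      intro x hx
      simpa [dist_eq_norm] using hx
    · intro x hx
      exact hre _ (by simpa [dist_eq_norm] using hx)
  have hzr : ‖z - c‖ ≤ r := by simpa [dist_eq_norm] using hz
  have hzR : z ∈ ball c R := by rw [mem_ball, dist_eq_norm]; linarith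
  have hRr : 0 < R - r := by linarith
  constructor
  · rw [hexp z hzR, norm_mul, Complex.norm_exp]
    gcongr
    have h1 := hbc z (by linarith)
    have h2 : 2 * K * R / (R - ‖z - c‖) ≤ 2 * K * R / (R - r) := by gcongr
    have h3 := (abs_le.mp (Complex.abs_re_le_norm (g z))).1
    linarith
  · rw [← hder z hzR]
    -- The derivative of the logarithm comes from Cauchy's estimate on a circle reaching half-way to
    -- the boundary of the big disc, where Borel–Carathéodory still controls it.
    have hsub : closedBall z ((R - r) / 2) ⊆ ball c R := by
      intro w hw
      rw [mem_closedBall, dist_eq_norm] at hw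
      rw [mem_ball, dist_eq_norm]
      have := norm_sub_le_norm_sub_add_norm_sub w z c
      linarith
    have h1 := Complex.norm_deriv_le_of_forall_mem_sphere_norm_le (c := z) (R := (R - r) / 2)
      (C := 2 * K * R / ((R - r) / 2)) (f := g) (by linarith)
      (DifferentiableOn.diffContOnCl (hg.mono ?_)) ?_
    · refine h1.trans (le_of_eq ?_)
      field_simp
      ring
    · rw [closure_ball _ (by linarith)]; exact hsub
    · intro w hw
      rw [mem_sphere, dist_eq_norm] at hw
      have h3 := norm_sub_le_norm_sub_add_norm_sub w z c
      refine (hbc w (by linarith)).trans ?_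
      gcongr
      linarith

lemma RiemannHypothesis.re_eq_half (hRH : RiemannHypothesis) {ρ : ℂ} (h : riemannZeta ρ = 0)
    (him : 0 < ρ.im) : ρ.re = 1 / 2 := by
  refine hRH ρ h ?_ ?_
  · rintro ⟨n, rfl⟩
    simp at him
  · rintro rfl
    simp at him

lemma RiemannHypothesis.riemannZeta_ne_zero (hRH : RiemannHypothesis) {s : ℂ} (h : 1 / 2 < s.re)
    (him : 0 < s.im) : riemannZeta s ≠ 0 := fun h0 => by
  have := hRH.re_eq_half h0 him
  linarith

lemma differentiableAt_riemannZeta_of_im_pos {s : ℂ} (h : 0 < s.im) :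
    DifferentiableAt ℂ riemannZeta s :=
  differentiableAt_riemannZeta (by rintro rfl; simp at h)

lemma analyticAt_riemannZeta_of_im_pos {s : ℂ} (h : 0 < s.im) :
    AnalyticAt ℂ riemannZeta s :=
  analyticOn_riemannZeta s (by rintro rfl; simp at h)

/-- Termwise comparison with `ζ(2) - 1 = π²/6 - 1`. It keeps `ζ` away from `0` at the centres of the
discs used below. -/
lemma norm_riemannZeta_two_add_sub_one_le (y : ℝ) :
    ‖riemannZeta (2 + y * Complex.I) - 1‖ ≤ 3 / 4 := by
  have hs : (1 : ℝ) < (2 + y * Complex.I : ℂ).re := by simp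
  have h1 : HasSum (fun n : ℕ => 1 / ((n : ℂ) + 1) ^ (2 + y * Complex.I : ℂ))
      (riemannZeta (2 + y * Complex.I)) := by
    rw [zeta_eq_tsum_one_div_nat_add_one_cpow hs]
    refine Summable.hasSum ?_
    have := (summable_nat_add_iff 1).mpr (Complex.summable_one_div_nat_cpow.mpr hs)
    simpa using this
  have h2 := (hasSum_nat_add_iff 1).mpr (by simpa using h1 :
    HasSum (fun n : ℕ => (((n : ℂ) + 1) ^ (2 + y * Complex.I : ℂ))⁻¹)
      (riemannZeta (2 + y * Complex.I) - 1 + ∑ i ∈ Finset.range 1,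
        (((i : ℂ) + 1) ^ (2 + y * Complex.I : ℂ))⁻¹))
  have h3 := (hasSum_nat_add_iff' 2).mpr hasSum_zeta_two
  rw [← h2.tsum_eq]
  refine (tsum_of_norm_bounded h3 fun n => ?_).trans ?_
  · have : (((n + 1 : ℕ) : ℂ) + 1) = (((n : ℝ) + 2 : ℝ) : ℂ) := by push_cast; ring
    rw [this, norm_inv, Complex.norm_cpow_eq_rpow_re_of_pos (by positivity)]
    simp
  · have := Real.pi_lt_d2
    have := Real.pi_pos
    simp [Finset.sum_range_succ]
    nlinarith

lemma quarter_le_norm_riemannZeta (y : ℝ) : 1 / 4 ≤ ‖riemannZeta (2 + y * Complex.I)‖ := by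
  have h1 := norm_riemannZeta_two_add_sub_one_le y
  have h2 := norm_sub_norm_le (1 : ℂ) (1 - riemannZeta (2 + y * Complex.I))
  rw [norm_sub_rev 1] at h2
  simp at h2
  linarith

lemma exists_log_mul_add_le {C : ℝ} (hC : 1 ≤ C) :
    ∃ C' : ℝ, 1 ≤ C' ∧ ∀ T : ℝ, 3 ≤ T → Real.log (4 * (C * (T + 5))) ≤ C' * Real.log T := by
  refine ⟨Real.log (12 * C) + 1, ?_, fun T hT => ?_⟩
  · have := Real.log_nonneg (show 1 ≤ 12 * C by linarith)
    linarith
  · have h1 : 1 ≤ Real.log T := by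
      rw [Real.le_log_iff_exp_le (by linarith)]
      linarith [Real.exp_one_lt_d9]
    have h0 := Real.log_nonneg (show 1 ≤ 12 * C by linarith)
    calc Real.log (4 * (C * (T + 5))) ≤ Real.log (12 * C * T) := by
          refine Real.log_le_log (by positivity) ?_
          nlinarith
      _ = Real.log (12 * C) + Real.log T := Real.log_mul (by positivity) (by positivity)
      _ ≤ _ := by nlinarith

/-! ### Zeros near a given height and `ζ'/ζ` on horizontal lines -/

-- Jensen's inequality for the disc of radius `1.7` about `2 + i(T + 1/2)`, which stays in `Re s ≥
-- 1/4`. Radius `1.65` suffices to catch the zeros because RH puts them at horizontal distance `3/2`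
-- and `1.5² + 0.6² < 1.65²`.
open Metric in
lemma exists_card_zeros_le (hRH : RiemannHypothesis) :
    ∃ C : ℝ, 0 < C ∧ ∀ T : ℝ, 3 ≤ T → ∀ S : Finset ℂ,
      (∀ ρ ∈ S, riemannZeta ρ = 0 ∧ T - 1 / 10 ≤ ρ.im ∧ ρ.im ≤ T + 11 / 10) →
      (S.card : ℝ) ≤ C * Real.log T := by
  obtain ⟨C, hC, hζ⟩ := exists_norm_riemannZeta_le
  obtain ⟨C', hC', hlog⟩ := exists_log_mul_add_le hC
  have hL : 0 < Real.log (1.7 / 1.65) := Real.log_pos (by norm_num)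
  refine ⟨C' / Real.log (1.7 / 1.65), by positivity, fun T hT S hS => ?_⟩
  set c : ℂ := 2 + ((T + 1 / 2 : ℝ) : ℂ) * Complex.I with hc
  have hcre : c.re = 2 := by simp [hc]
  have hcim : c.im = T + 1 / 2 := by simp [hc]
  have hball : ∀ z ∈ closedBall c |1.7|, 1 / 4 ≤ z.re ∧ 1 ≤ z.im ∧ ‖z‖ ≤ T + 5 := by
    intro z hz
    rw [mem_closedBall, dist_eq_norm, abs_of_pos (by norm_num)] at hz
    have h1 := (Complex.abs_re_le_norm (z - c)).trans hz
    have h2 := (Complex.abs_im_le_norm (z - c)).trans hz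
    rw [Complex.sub_re, hcre, abs_le] at h1
    rw [Complex.sub_im, hcim, abs_le] at h2
    refine ⟨by linarith [h1.1], by linarith [h2.1], ?_⟩
    have hcn : ‖c‖ ≤ 2 + (T + 1 / 2) := by
      refine (norm_add_le _ _).trans ?_
      rw [norm_mul, Complex.norm_I, Complex.norm_real, Real.norm_eq_abs, abs_of_pos (by linarith)]
      simp
    have := norm_le_norm_add_norm_sub' z c
    linarith
  have han : AnalyticOnNhd ℂ riemannZeta (closedBall c |1.7|) := fun z hz =>
    analyticAt_riemannZeta_of_im_pos (by linarith [(hball z hz).2.1])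
  have hq : 1 / 4 ≤ ‖riemannZeta c‖ := quarter_le_norm_riemannZeta _
  have hc0 : riemannZeta c ≠ 0 := norm_pos_iff.mp (by linarith)
  have hjen := AnalyticOnNhd.sum_divisor_le (c := c) (r := 1.65) (R := 1.7)
    (M := C * (T + 5)) (by norm_num) (by rw [abs_of_pos, abs_of_pos] <;> norm_num) (by nlinarith)
    han hc0 (fun z hz => by
      have h := hball z (sphere_subset_closedBall hz)
      refine (hζ z h.1 h.2.1).trans ?_
      gcongr
      exact h.2.2)
  have hsub : closedBall c |1.65| ⊆ closedBall c |1.7| :=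
    closedBall_subset_closedBall (by rw [abs_of_pos, abs_of_pos] <;> norm_num)
  have han' := han.mono hsub
  set D := MeromorphicOn.divisor riemannZeta (closedBall c |1.65|) with hD
  have hDnn : ∀ z, 0 ≤ D z := fun z => MeromorphicOn.AnalyticOnNhd.divisor_nonneg han' z
  have hfin : D.support.Finite := D.finiteSupport (isCompact_closedBall ..)
  have hcard : (S.card : ℤ) ≤ ∑ᶠ u, D u := by
    have hone : ∀ ρ ∈ S, 1 ≤ D ρ := by
      intro ρ hρ
      obtain ⟨h0, h1, h2⟩ := hS ρ hρ
      have hre := hRH.re_eq_half h0 (by linarith)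
      have hmem : ρ ∈ closedBall c |1.65| := by
        rw [mem_closedBall, dist_eq_norm, abs_of_pos (by norm_num)]
        rw [← abs_of_nonneg (norm_nonneg _), ← abs_of_pos (show (0 : ℝ) < 1.65 by norm_num),
          ← sq_le_sq, ← Complex.normSq_eq_norm_sq, Complex.normSq_apply, Complex.sub_re,
          Complex.sub_im, hcre, hcim, hre]
        nlinarith
      have hρan := han' ρ hmem
      rw [hD, MeromorphicOn.AnalyticOnNhd.divisor_apply han' hmem]
      have hne0 : analyticOrderAt riemannZeta ρ ≠ 0 := hρan.analyticOrderAt_ne_zero.mpr h0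
      have hnet : analyticOrderAt riemannZeta ρ ≠ ⊤ := by
        intro htop
        have hconn := han.eqOn_zero_of_preconnected_of_eventuallyEq_zero
          (convex_closedBall c |1.7|).isPreconnected (hsub hmem) (analyticOrderAt_eq_top.mp htop)
        exact hc0 (hconn (mem_closedBall_self (abs_nonneg _)))
      obtain ⟨n, hn⟩ := ENat.ne_top_iff_exists.mp hnet
      rw [← hn] at hne0 ⊢
      have : n ≠ 0 := by rintro rfl; simp at hne0
      simp
      omega
    rw [finsum_eq_sum_of_support_subset (s := hfin.toFinset ∪ S) _ (by
      intro x hx; simp only [Finset.coe_union, Set.Finite.coe_toFinset]; exact Or.inl hx)]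
    calc (S.card : ℤ) = ∑ ρ ∈ S, 1 := by simp
      _ ≤ ∑ ρ ∈ S, D ρ := Finset.sum_le_sum hone
      _ ≤ _ := Finset.sum_le_sum_of_subset_of_nonneg Finset.subset_union_right fun i _ _ => hDnn i
  have hfinal : (S.card : ℝ) ≤ Real.log (C * (T + 5) / ‖riemannZeta c‖) / Real.log (1.7 / 1.65) :=
    le_trans (by exact_mod_cast hcard) hjen
  refine hfinal.trans ?_
  rw [div_mul_eq_mul_div]
  gcongr
  refine le_trans ?_ (hlog T hT)
  refine Real.log_le_log (by positivity) ?_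
  rw [div_le_iff₀ (by linarith)]
  have : 0 ≤ C * (T + 5) := by positivity
  nlinarith

/-- Every interval `[T, T + 1]` contains a height which is far from all ordinates of zeros. -/
lemma exists_height_far_from_zeros (hRH : RiemannHypothesis) :
    ∃ c : ℝ, 0 < c ∧ c ≤ 1 / 10 ∧ ∀ T : ℝ, 3 ≤ T → ∃ A ∈ Set.Icc T (T + 1),
      ∀ ρ : ℂ, riemannZeta ρ = 0 → c / Real.log T ≤ |ρ.im - A| := by
  obtain ⟨C, hC, hcard⟩ := exists_card_zeros_le hRH
  -- With `1 / (4C)` the intervals of radius `c / log T` about the ordinates have total length at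
  -- most `1/2`, so they cannot cover `[T, T + 1]`. The cap `1/10` ensures that only zeros in the
  -- counted window matter.
  refine ⟨min (1 / 10) (1 / (4 * C)), by positivity, min_le_left _ _, fun T hT => ?_⟩
  set c := min (1 / 10) (1 / (4 * C)) with hc
  have hc0 : 0 < c := by positivity
  have hlog : 1 ≤ Real.log T := by
    rw [Real.le_log_iff_exp_le (by linarith)]
    linarith [Real.exp_one_lt_d9]
  set d := c / Real.log T with hd
  have hd0 : 0 < d := by positivity
  have hd1 : d ≤ 1 / 10 := (div_le_self hc0.le hlog).trans (min_le_left _ _)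
  have hfin : {ρ : ℂ | riemannZeta ρ = 0 ∧ T - 1 / 10 ≤ ρ.im ∧ ρ.im ≤ T + 11 / 10}.Finite := by
    have hcomp : IsCompact (Set.Icc (1 / 2 : ℝ) (1 / 2) ×ℂ Set.Icc (T - 1 / 10) (T + 11 / 10)) :=
      isCompact_Icc.reProdIm isCompact_Icc
    refine hcomp.inter_riemannZetaZeros_finite.subset fun ρ hρ => ⟨?_, hρ.1⟩
    have hre := hRH.re_eq_half hρ.1 (by linarith [hρ.2.1])
    exact ⟨⟨hre.ge, hre.le⟩, hρ.2⟩
  by_contra! hcon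
  set S := hfin.toFinset with hS
  have hcov : Set.Icc T (T + 1) ⊆ ⋃ ρ ∈ S, Set.Ioo (ρ.im - d) (ρ.im + d) := by
    intro A hA
    obtain ⟨ρ, h0, h1⟩ := hcon A hA
    rw [abs_lt] at h1
    simp only [Set.mem_iUnion]
    refine ⟨ρ, ?_, by linarith [h1.2], by linarith [h1.1]⟩
    rw [hS, Set.Finite.mem_toFinset]
    exact ⟨h0, by linarith [hA.1], by linarith [hA.2]⟩
  have hmeas := (MeasureTheory.measure_mono (μ := MeasureTheory.volume) hcov).trans
    (MeasureTheory.measure_biUnion_finset_le S _)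
  simp only [Real.volume_Icc, Real.volume_Ioo] at hmeas
  rw [← ENNReal.ofReal_sum_of_nonneg (fun ρ _ => by linarith), ENNReal.ofReal_le_ofReal_iff
    (Finset.sum_nonneg fun ρ _ => by linarith)] at hmeas
  have h1 : ∑ ρ ∈ S, (ρ.im + d - (ρ.im - d)) = S.card * (2 * d) := by
    rw [← nsmul_eq_mul, ← Finset.sum_const]
    exact Finset.sum_congr rfl fun ρ _ => by ring
  rw [h1] at hmeas
  have h2 := hcard T hT S (fun ρ hρ => by rw [hS, Set.Finite.mem_toFinset] at hρ; exact hρ)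
  have h3 : (S.card : ℝ) * (2 * d) ≤ C * Real.log T * (2 * d) := by gcongr
  have h4 : C * Real.log T * (2 * d) = 2 * C * c := by rw [hd]; field_simp
  have h5 : C * c ≤ 1 / 4 := by
    calc C * c ≤ C * (1 / (4 * C)) := by gcongr; exact min_le_right _ _
      _ = 1 / 4 := by field_simp
  linarith

open Metric in
/-- On a horizontal line at distance `d` from all zeros, `ζ'/ζ` is `O(d⁻² log A)`. -/
lemma exists_norm_logDeriv_riemannZeta_le (hRH : RiemannHypothesis) :
    ∃ C : ℝ, 0 < C ∧ ∀ A : ℝ, 3 ≤ A → ∀ d : ℝ, 0 < d → d ≤ 1 / 2 →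
      (∀ ρ : ℂ, riemannZeta ρ = 0 → d ≤ |ρ.im - A|) →
      ∀ σ ∈ Set.Icc (1 / 2 : ℝ) (3 / 2),
        ‖logDeriv riemannZeta (σ + A * Complex.I)‖ ≤ C * Real.log A / d ^ 2 := by
  obtain ⟨C, hC, hζ⟩ := exists_norm_riemannZeta_le
  obtain ⟨C', hC', hlog⟩ := exists_log_mul_add_le hC
  refine ⟨832 * C', by positivity, fun A hA d hd0 hd1 hfar σ hσ => ?_⟩
  set c : ℂ := 2 + A * Complex.I with hc
  have hcre : c.re = 2 := by simp [hc]
  have hcim : c.im = A := by simp [hc]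
  set K := Real.log (4 * (C * (A + 5))) with hK
  have hKle := hlog A hA
  have hK0 : 0 < K := Real.log_pos (by nlinarith)
  have hq : 1 / 4 ≤ ‖riemannZeta c‖ := quarter_le_norm_riemannZeta _
  have hbound : ∀ z : ℂ, 1 / 4 ≤ z.re → z.re ≤ 7 / 2 → |z.im - A| ≤ 3 / 2 →
      ‖riemannZeta z‖ ≤ ‖riemannZeta c‖ * Real.exp K := by
    intro z h1 h2 h3
    rw [abs_le] at h3
    have hz : ‖z‖ ≤ A + 5 := by
      refine (Complex.norm_le_abs_re_add_abs_im z).trans ?_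
      rw [abs_of_nonneg (by linarith), abs_of_nonneg (by linarith)]
      linarith
    rw [hK, Real.exp_log (by positivity)]
    have h4 : ‖riemannZeta z‖ ≤ C * (A + 5) := by
      refine (hζ z h1 (by linarith)).trans ?_
      gcongr
    have h5 : 0 ≤ C * (A + 5) := by positivity
    nlinarith
  have hin : ∀ (p : ℂ) (R : ℝ), p.im = A → ∀ z ∈ ball p R, |z.re - p.re| < R ∧ |z.im - A| < R := by
    intro p R hp z hz
    rw [mem_ball, dist_eq_norm] at hz
    refine ⟨?_, ?_⟩
    · rw [← Complex.sub_re]; exact (Complex.abs_re_le_norm _).trans_lt hz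
    · rw [← hp, ← Complex.sub_im]; exact (Complex.abs_im_le_norm _).trans_lt hz
  have hd : DifferentiableOn ℂ riemannZeta (ball c (3 / 2)) := fun z hz => by
    have := (abs_lt.mp (hin c _ hcim z hz).2).1
    exact (differentiableAt_riemannZeta_of_im_pos (by linarith)).differentiableWithinAt
  have hne : ∀ z ∈ ball c (3 / 2), riemannZeta z ≠ 0 := fun z hz => by
    have h1 := (abs_lt.mp (hin c _ hcim z hz).2).1
    have h2 := (abs_lt.mp (hin c _ hcim z hz).1).1
    exact hRH.riemannZeta_ne_zero (by linarith) (by linarith)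
  -- The disc of radius `3/2` about `2 + iA` touches the critical line and is free of zeros by RH
  -- alone. This settles `σ ≥ 1/2 + d/4` and gives a lower bound for `ζ` there.
  have hbig : ∀ z ∈ closedBall c (3 / 2 - d / 4),
      ‖riemannZeta c‖ * Real.exp (-(12 * K / d)) ≤ ‖riemannZeta z‖ ∧
      ‖logDeriv riemannZeta z‖ ≤ 192 * K / d ^ 2 := by
    intro z hz
    have := log_bounds_of_ne_zero (r := 3 / 2 - d / 4) (by linarith) (by linarith) hK0 hd hne
      (fun z hz => by
        have h1 := hin c _ hcim z hz
        have h2 := abs_lt.mp h1.1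
        exact hbound z (by linarith [h2.1]) (by linarith [h2.2]) h1.2.le) hz
    convert this using 2
    · congr 3
      field_simp
      ring
    · field_simp
      ring
  have hs : (σ + A * Complex.I : ℂ) - c = ((σ - 2 : ℝ) : ℂ) := by rw [hc]; push_cast; ring
  have hgoal : 192 * K / d ^ 2 ≤ 832 * C' * Real.log A / d ^ 2 := by
    rw [mul_assoc 832]
    exact div_le_div_of_nonneg_right (by linarith) (by positivity)
  rcases le_total (1 / 2 + d / 4) σ with hσd | hσd
  · refine (hbig _ ?_).2.trans hgoal
    rw [mem_closedBall, dist_eq_norm, hs, Complex.norm_real, Real.norm_eq_abs, abs_le]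
    constructor <;> linarith [hσ.2]
  -- Close to the line a second disc is used, of radius `d/2 < d` about `p`, free of zeros by the
  -- choice of height. The lower bound for `ζ(p)` from the first disc replaces the bound at `2 +
  -- iA`, at the price of enlarging `K` to `K + 12K/d`.
  · set p : ℂ := ((1 / 2 + d / 4 : ℝ) : ℂ) + A * Complex.I with hp
    have hpre : p.re = 1 / 2 + d / 4 := by simp [hp]
    have hpim : p.im = A := by simp [hp]
    have hpc := (hbig p (by
      rw [mem_closedBall, dist_eq_norm, hp, hc]
      rw [show ((1 / 2 + d / 4 : ℝ) : ℂ) + A * Complex.I - (2 + A * Complex.I) =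
        ((1 / 2 + d / 4 - 2 : ℝ) : ℂ) by push_cast; ring, Complex.norm_real, Real.norm_eq_abs,
        abs_le]
      constructor <;> linarith)).1
    have := log_bounds_of_ne_zero (f := riemannZeta) (c := p) (R := d / 2) (r := d / 4)
      (K := K + 12 * K / d) (z := σ + A * Complex.I) (by linarith) (by linarith) (by positivity)
      (fun z hz => by
        have := (abs_lt.mp (hin p _ hpim z hz).2).1
        exact (differentiableAt_riemannZeta_of_im_pos (by linarith)).differentiableWithinAt)
      (fun z hz h0 => by
        have h1 := (hin p _ hpim z hz).2
        have h2 := hfar z h0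
        linarith)
      (fun z hz => by
        have h1 := hin p _ hpim z hz
        have h2 := abs_lt.mp h1.1
        refine (hbound z (by linarith [h2.1]) (by linarith [h2.2]) (by linarith [h1.2])).trans ?_
        calc ‖riemannZeta c‖ * Real.exp K
            = ‖riemannZeta c‖ * Real.exp (-(12 * K / d)) * Real.exp (K + 12 * K / d) := by
              rw [mul_assoc, ← Real.exp_add]; congr 2; ring
          _ ≤ _ := by gcongr)
      (by
        rw [mem_closedBall, dist_eq_norm, hp]
        rw [show (σ + A * Complex.I : ℂ) - (((1 / 2 + d / 4 : ℝ) : ℂ) + A * Complex.I) =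
          ((σ - (1 / 2 + d / 4) : ℝ) : ℂ) by push_cast; ring, Complex.norm_real,
          Real.norm_eq_abs, abs_le]
        constructor <;> linarith [hσ.1])
    refine this.2.trans ?_
    have e : 8 * (K + 12 * K / d) * (d / 2) / (d / 2 - d / 4) ^ 2 = (64 * d + 768) * K / d ^ 2 := by
      field_simp
      ring
    rw [e, mul_assoc 832]
    refine div_le_div_of_nonneg_right ?_ (by positivity)
    nlinarith

/-! ### Splitting off zeros, and the functional equation on the critical line -/

section

/-- A holomorphic function is the product of the monomials `(z - ρ) ^ m ρ` attached to finitely many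
of its zeros and a holomorphic function which does not vanish at these zeros. -/
lemma DifferentiableOn.exists_eq_prod_mul {U : Set ℂ} (hU : IsOpen U) {f : ℂ → ℂ}
    (hf : DifferentiableOn ℂ f U) (m : ℂ → ℕ) (S : Finset ℂ)
    (hS : ∀ ρ ∈ S, ρ ∈ U ∧ analyticOrderAt f ρ = m ρ) :
    ∃ g : ℂ → ℂ, DifferentiableOn ℂ g U ∧ (∀ z ∈ U, f z = (∏ ρ ∈ S, (z - ρ) ^ m ρ) * g z) ∧
      ∀ ρ ∈ S, g ρ ≠ 0 := by
  classical
  induction S using Finset.induction_on with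
  | empty => exact ⟨f, hf, by simp, by simp⟩
  | insert p S hp ih =>
    obtain ⟨g, hg, hfg, hg0⟩ := ih fun ρ hρ => hS ρ (Finset.mem_insert_of_mem hρ)
    obtain ⟨hpU, hord⟩ := hS p (Finset.mem_insert_self p S)
    have hfan : AnalyticAt ℂ f p := hf.analyticAt (hU.mem_nhds hpU)
    obtain ⟨f₁, hf₁, hf₁0, hff₁⟩ := hfan.analyticOrderAt_eq_natCast.mp hord
    set P : ℂ → ℂ := fun z => ∏ ρ ∈ S, (z - ρ) ^ m ρ with hP
    have hPd : Differentiable ℂ P := by rw [hP]; fun_prop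
    have hPp : P p ≠ 0 := by
      rw [hP]
      refine Finset.prod_ne_zero_iff.mpr fun ρ hρ => pow_ne_zero _ (sub_ne_zero.mpr ?_)
      rintro rfl
      exact hp hρ
    set h : ℂ → ℂ := fun z => (P z)⁻¹ * f₁ z with hh
    have hhan : AnalyticAt ℂ h p := ((hPd.analyticAt p).inv hPp).mul hf₁
    have hhp : h p ≠ 0 := mul_ne_zero (inv_ne_zero hPp) hf₁0
    have hgh : ∀ᶠ z in 𝓝 p, g z = (z - p) ^ m p * h z := by
      filter_upwards [hff₁, hU.mem_nhds hpU, hPd.continuous.continuousAt.eventually_ne hPp]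
        with z h1 h2 h3
      have h4 := hfg z h2
      rw [h1, smul_eq_mul] at h4
      change _ = P z * g z at h4
      rw [hh]
      field_simp
      linear_combination -h4
    -- The quotient is completed at `p` by the value of its local holomorphic extension `h`.
    set g₁ : ℂ → ℂ := fun z => if z = p then h p else g z / (z - p) ^ m p with hg₁
    have hg₁h : ∀ᶠ z in 𝓝 p, g₁ z = h z := by
      filter_upwards [hgh] with z hz
      by_cases hzp : z = p
      · simp [hg₁, hzp]
      · have := sub_ne_zero.mpr hzp
        simp only [hg₁, if_neg hzp, hz]
        field_simp
    have hgg₁ : ∀ z ∈ U, g z = (z - p) ^ m p * g₁ z := by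
      intro z hz
      by_cases hzp : z = p
      · subst hzp
        simpa [hg₁] using hgh.self_of_nhds
      · have := sub_ne_zero.mpr hzp
        simp only [hg₁, if_neg hzp]
        field_simp
    refine ⟨g₁, fun z hz => ?_, fun z hz => ?_, fun ρ hρ => ?_⟩
    · by_cases hzp : z = p
      · subst hzp
        exact (hhan.differentiableAt.congr_of_eventuallyEq hg₁h).differentiableWithinAt
      · have h1 : DifferentiableAt ℂ (fun z => g z / (z - p) ^ m p) z := by
          refine (hg.differentiableAt (hU.mem_nhds hz)).div (by fun_prop) ?_
          exact pow_ne_zero _ (sub_ne_zero.mpr hzp)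
        refine (h1.congr_of_eventuallyEq ?_).differentiableWithinAt
        filter_upwards [isOpen_ne.mem_nhds hzp] with w hw
        simp [hg₁, show w ≠ p from hw]
    · rw [Finset.prod_insert hp, hfg z hz, hgg₁ z hz]
      ring
    · rcases Finset.mem_insert.mp hρ with rfl | hρS
      · simpa [hg₁] using hhp
      · have hρU := (hS ρ hρ).1
        have := hg0 ρ hρS
        rw [hgg₁ ρ hρU] at this
        exact right_ne_zero_of_mul this

/-- The derivative `θ'` of the Riemann–Siegel theta function. -/
noncomputable def thetaDeriv (y : ℝ) : ℝ :=
  (logDeriv Complex.Gammaℝ (1 / 2 + y * Complex.I)).re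

open Complex ComplexConjugate

lemma Gammaℝ_conj (s : ℂ) : Gammaℝ (conj s) = conj (Gammaℝ s) := by
  rw [Gammaℝ_def, Gammaℝ_def, map_mul, ← Gamma_conj]
  have h : conj s / 2 = conj (s / 2) := by rw [map_div₀, map_ofNat]
  have h' : -conj s / 2 = conj (-s / 2) := by rw [map_div₀, map_ofNat, map_neg]
  rw [h, h', cpow_conj _ _ (by rw [arg_ofReal_of_nonneg Real.pi_pos.le]; exact Real.pi_pos.ne)]
  simp

lemma completedRiemannZeta_eq_mul {s : ℂ} (hs : 0 < s.re) :
    completedRiemannZeta s = Gammaℝ s * riemannZeta s := by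
  rw [riemannZeta_def_of_ne_zero (by rintro rfl; simp at hs)]
  have := Gammaℝ_ne_zero_of_re_pos hs
  field_simp

/-- On the critical line `1 - s` is the conjugate of `s`, so the functional equation says that the
value equals its own conjugate. -/
lemma completedRiemannZeta_half_im (y : ℝ) : (completedRiemannZeta (1 / 2 + y * I)).im = 0 := by
  rw [← conj_eq_iff_im]
  have h1 : (1 : ℂ) - (1 / 2 + y * I) = conj (1 / 2 + y * I) := by
    simp only [map_add, map_mul, conj_ofReal, conj_I, map_div₀, map_one, map_ofNat]
    ring
  conv_rhs => rw [← completedRiemannZeta_one_sub, h1]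
  rw [completedRiemannZeta_eq_mul (by simp), completedRiemannZeta_eq_mul (by simp), map_mul,
    Gammaℝ_conj, riemannZeta_conj]

lemma differentiableAt_Gammaℝ {s : ℂ} (hs : 0 < s.re) : DifferentiableAt ℂ Gammaℝ s := by
  have h := (differentiable_Gammaℝ_inv s).inv (inv_ne_zero (Gammaℝ_ne_zero_of_re_pos hs))
  have e : (fun s => (Gammaℝ s)⁻¹)⁻¹ = Gammaℝ := by ext; simp
  rwa [e] at h

/-- On the critical line the real part of `ζ'/ζ` is `-θ'`. -/
lemma re_logDeriv_riemannZeta_half {y : ℝ} (hy : 0 < y) (h0 : riemannZeta (1 / 2 + y * I) ≠ 0) :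
    (logDeriv riemannZeta (1 / 2 + y * I)).re = -thetaDeriv y := by
  set s : ℂ := 1 / 2 + y * I with hs
  have hre : 0 < s.re := by simp [hs]
  have him : 0 < s.im := by simpa [hs] using hy
  have hΓ := Gammaℝ_ne_zero_of_re_pos hre
  have hev : completedRiemannZeta =ᶠ[𝓝 s] fun s => Gammaℝ s * riemannZeta s := by
    filter_upwards [(isOpen_lt continuous_const continuous_re).mem_nhds hre] with z hz
    exact completedRiemannZeta_eq_mul hz
  have h1 := (logDeriv_congr_nhds hev).self_of_nhds
  rw [logDeriv_mul s hΓ h0 (differentiableAt_Gammaℝ hre)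
    (differentiableAt_riemannZeta_of_im_pos him)] at h1
  -- The completed function is real along the line, so its derivative in the direction `i` is real
  -- and its complex derivative is purely imaginary.
  have h2 : (logDeriv completedRiemannZeta s).re = 0 := by
    have hd : DifferentiableAt ℂ completedRiemannZeta s :=
      differentiableAt_completedZeta (by rintro h; simp [h] at hre) (by rintro h; simp [h] at him)
    have hline : HasDerivAt (fun u : ℝ => (1 / 2 + u * I : ℂ)) I y := by
      have := ((hasDerivAt_id (y : ℂ)).mul_const I).const_add (1 / 2 : ℂ)
      simpa using this.comp_ofReal
    have h3 : HasDerivAt (fun u : ℝ => completedRiemannZeta (1 / 2 + u * I))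
        (deriv completedRiemannZeta s * I) y :=
      HasDerivAt.comp y hd.hasDerivAt hline
    have h4 := imCLM.hasFDerivAt.comp_hasDerivAt y h3
    have h5 : (imCLM ∘ fun u : ℝ => completedRiemannZeta (1 / 2 + u * I)) = fun _ => 0 := by
      ext u; simpa using completedRiemannZeta_half_im u
    rw [h5] at h4
    have h6 := h4.unique (hasDerivAt_const y (0 : ℝ))
    have h7 : (deriv completedRiemannZeta s).re = 0 := by simpa using h6
    rw [logDeriv_apply, div_re, h7, completedRiemannZeta_half_im]
    simp
  have h8 := congrArg re h1
  rw [h2, add_re] at h8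
  change 0 = thetaDeriv y + _ at h8
  linarith

/-! ### Contour integrals along three sides of a rectangle and the explicit formula -/

/-- The integral of `f` along the three sides `1/2 + ia → σ + ia → σ + ib → 1/2 + ib`. -/
noncomputable def sideIntegral (f : ℂ → ℂ) (σ a b : ℝ) : ℂ :=
  (∫ x in (1 / 2 : ℝ)..σ, f (x + a * I)) + I * (∫ y in a..b, f (σ + y * I)) -
    ∫ x in (1 / 2 : ℝ)..σ, f (x + b * I)

/-- The three sides of the rectangle used in `sideIntegral`. -/
def rectSides (σ a b : ℝ) : Set ℂ :=
  {s | s.re ∈ Set.Icc (1 / 2) σ ∧ (s.im = a ∨ s.im = b) ∨ s.re = σ ∧ s.im ∈ Set.Icc a b}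

section sideIntegral

variable {σ a b : ℝ}

lemma mem_rectSides_bottom {x : ℝ} (hx : x ∈ Set.Icc (1 / 2) σ) : (x + a * I : ℂ) ∈ rectSides σ a b :=
  Or.inl ⟨by simpa using hx, by simp⟩

lemma mem_rectSides_top {x : ℝ} (hx : x ∈ Set.Icc (1 / 2) σ) : (x + b * I : ℂ) ∈ rectSides σ a b :=
  Or.inl ⟨by simpa using hx, by simp⟩

lemma mem_rectSides_right {y : ℝ} (hy : y ∈ Set.Icc a b) : (σ + y * I : ℂ) ∈ rectSides σ a b :=
  Or.inr ⟨by simp, by simpa using hy⟩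

lemma continuousOn_sides {f : ℂ → ℂ} (hf : ContinuousOn f (rectSides σ a b)) :
    ContinuousOn (fun x : ℝ => f (x + a * I)) (Set.Icc (1 / 2) σ) ∧
    ContinuousOn (fun y : ℝ => f (σ + y * I)) (Set.Icc a b) ∧
    ContinuousOn (fun x : ℝ => f (x + b * I)) (Set.Icc (1 / 2) σ) :=
  ⟨hf.comp (by fun_prop) fun _ hx => mem_rectSides_bottom hx,
    hf.comp (by fun_prop) fun _ hx => mem_rectSides_right hx,
    hf.comp (by fun_prop) fun _ hx => mem_rectSides_top hx⟩

lemma intervalIntegrable_sides (hσ : 1 / 2 < σ) (hab : a < b) {f : ℂ → ℂ}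
    (hf : ContinuousOn f (rectSides σ a b)) :
    IntervalIntegrable (fun x : ℝ => f (x + a * I)) MeasureTheory.volume (1 / 2) σ ∧
    IntervalIntegrable (fun y : ℝ => f (σ + y * I)) MeasureTheory.volume a b ∧
    IntervalIntegrable (fun x : ℝ => f (x + b * I)) MeasureTheory.volume (1 / 2) σ := by
  obtain ⟨h1, h2, h3⟩ := continuousOn_sides hf
  exact ⟨h1.intervalIntegrable_of_Icc hσ.le, h2.intervalIntegrable_of_Icc hab.le,
    h3.intervalIntegrable_of_Icc hσ.le⟩

lemma sideIntegral_add (hσ : 1 / 2 < σ) (hab : a < b) {f g : ℂ → ℂ}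
    (hf : ContinuousOn f (rectSides σ a b)) (hg : ContinuousOn g (rectSides σ a b)) :
    sideIntegral (fun s => f s + g s) σ a b = sideIntegral f σ a b + sideIntegral g σ a b := by
  obtain ⟨f1, f2, f3⟩ := intervalIntegrable_sides hσ hab hf
  obtain ⟨g1, g2, g3⟩ := intervalIntegrable_sides hσ hab hg
  simp only [sideIntegral]
  rw [intervalIntegral.integral_add f1 g1, intervalIntegral.integral_add f2 g2,
    intervalIntegral.integral_add f3 g3]
  ring

lemma sideIntegral_const_mul (c : ℂ) (f : ℂ → ℂ) :
    sideIntegral (fun s => c * f s) σ a b = c * sideIntegral f σ a b := by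
  simp only [sideIntegral, intervalIntegral.integral_const_mul]
  ring

lemma sideIntegral_sum (hσ : 1 / 2 < σ) (hab : a < b) {ι : Type*} (S : Finset ι) {f : ι → ℂ → ℂ}
    (hf : ∀ i ∈ S, ContinuousOn (f i) (rectSides σ a b)) :
    sideIntegral (fun s => ∑ i ∈ S, f i s) σ a b = ∑ i ∈ S, sideIntegral (f i) σ a b := by
  classical
  induction S using Finset.induction_on with
  | empty => simp [sideIntegral]
  | insert i S hi ih =>
    simp only [Finset.sum_insert hi]
    rw [sideIntegral_add hσ hab (hf i (Finset.mem_insert_self i S))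
      (continuousOn_finsetSum S fun j hj => hf j (Finset.mem_insert_of_mem hj)),
      ih fun j hj => hf j (Finset.mem_insert_of_mem hj)]

lemma sideIntegral_congr (hσ : 1 / 2 < σ) (hab : a < b) {f g : ℂ → ℂ}
    (h : Set.EqOn f g (rectSides σ a b)) : sideIntegral f σ a b = sideIntegral g σ a b := by
  simp only [sideIntegral]
  congr 1
  · congr 1
    · refine intervalIntegral.integral_congr fun x hx => ?_
      rw [Set.uIcc_of_le hσ.le] at hx
      exact h (mem_rectSides_bottom hx)
    · congr 1
      refine intervalIntegral.integral_congr fun x hx => ?_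
      rw [Set.uIcc_of_le hab.le] at hx
      exact h (mem_rectSides_right hx)
  · refine intervalIntegral.integral_congr fun x hx => ?_
    rw [Set.uIcc_of_le hσ.le] at hx
    exact h (mem_rectSides_top hx)

/-- The fundamental theorem of calculus along three sides of a rectangle. -/
lemma sideIntegral_eq_sub (hσ : 1 / 2 < σ) (hab : a < b) {F f : ℂ → ℂ}
    (hF : ∀ s ∈ rectSides σ a b, HasDerivAt F (f s) s) (hf : ContinuousOn f (rectSides σ a b)) :
    sideIntegral f σ a b = F (1 / 2 + b * I) - F (1 / 2 + a * I) := by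
  obtain ⟨f1, f2, f3⟩ := intervalIntegrable_sides hσ hab hf
  have hh : ∀ (c : ℝ) (x : ℝ), HasDerivAt (fun x : ℝ => (x + c * I : ℂ)) 1 x := fun c x => by
    simpa using ((hasDerivAt_id (x : ℂ)).add_const (c * I)).comp_ofReal
  have hv : ∀ y : ℝ, HasDerivAt (fun y : ℝ => (σ + y * I : ℂ)) I y := fun y => by
    simpa using (((hasDerivAt_id (y : ℂ)).mul_const I).const_add (σ : ℂ)).comp_ofReal
  have e1 : (∫ x in (1 / 2 : ℝ)..σ, f (x + a * I)) = F (σ + a * I) - F (1 / 2 + a * I) := by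
    have := intervalIntegral.integral_eq_sub_of_hasDerivAt (f := fun x : ℝ => F (x + a * I))
      (fun x hx => by
        rw [Set.uIcc_of_le hσ.le] at hx
        have h := HasDerivAt.comp x (hF _ (mem_rectSides_bottom (a := a) (b := b) hx)) (hh a x)
        rw [mul_one] at h
        exact h) f1
    simpa using this
  have e3 : (∫ x in (1 / 2 : ℝ)..σ, f (x + b * I)) = F (σ + b * I) - F (1 / 2 + b * I) := by
    have := intervalIntegral.integral_eq_sub_of_hasDerivAt (f := fun x : ℝ => F (x + b * I))
      (fun x hx => by
        rw [Set.uIcc_of_le hσ.le] at hx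
        have h := HasDerivAt.comp x (hF _ (mem_rectSides_top (a := a) (b := b) hx)) (hh b x)
        rw [mul_one] at h
        exact h) f3
    simpa using this
  have e2 : (∫ y in a..b, f (σ + y * I) * I) = F (σ + b * I) - F (σ + a * I) := by
    have := intervalIntegral.integral_eq_sub_of_hasDerivAt (f := fun y : ℝ => F (σ + y * I))
      (fun y hy => by
        rw [Set.uIcc_of_le hab.le] at hy
        exact (hF _ (mem_rectSides_right (σ := σ) hy)).comp y (hv y)) (f2.mul_const I)
    simpa using this
  rw [intervalIntegral.integral_mul_const] at e2
  rw [sideIntegral, e1, e3]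
  linear_combination e2

/-- Seen from a point inside the left side, the other three sides never meet the negative real axis,
so the principal logarithm is a primitive of `1 / (s - p)` along them. -/
lemma rectSides_sub_mem_slitPlane (hσ : 1 / 2 < σ) {p : ℂ} (hp : p.re = 1 / 2) (hpa : a < p.im)
    (hpb : p.im < b) {s : ℂ} (hs : s ∈ rectSides σ a b) : s - p ∈ slitPlane := by
  rw [mem_slitPlane_iff, sub_re, sub_im, hp]
  rcases hs with ⟨_, h | h⟩ | ⟨h, _⟩
  · right; rw [h]; linarith
  · right; rw [h]; linarith
  · left; rw [h]; linarith

/-- The argument of `s - p` turns from `-π/2` to `π/2`: a pole on the omitted side counts for half a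
residue. -/
lemma im_sideIntegral_inv (hσ : 1 / 2 < σ) {p : ℂ} (hp : p.re = 1 / 2) (hpa : a < p.im)
    (hpb : p.im < b) : (sideIntegral (fun s => (s - p)⁻¹) σ a b).im = Real.pi := by
  have hmem := fun s (hs : s ∈ rectSides σ a b) => rectSides_sub_mem_slitPlane hσ hp hpa hpb hs
  rw [sideIntegral_eq_sub hσ (hpa.trans hpb) (F := fun s => log (s - p))]
  · have e1 : (1 / 2 + b * I : ℂ) - p = ((b - p.im : ℝ) : ℂ) * I := by
      apply Complex.ext <;> simp [hp]
    have e2 : (1 / 2 + a * I : ℂ) - p = ((p.im - a : ℝ) : ℂ) * (-I) := by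
      apply Complex.ext <;> simp [hp]
    rw [sub_im, e1, e2, log_im, log_im, arg_real_mul _ (by linarith), arg_real_mul _ (by linarith),
      arg_I, arg_neg_I]
    ring
  · intro s hs
    simpa using ((hasDerivAt_id s).sub_const p).clog (hmem s hs)
  · intro s hs
    refine ContinuousAt.continuousWithinAt ?_
    exact ContinuousAt.inv₀ (by fun_prop) (slitPlane_ne_zero (hmem s hs))

end sideIntegral

/-- The explicit formula on a rectangle whose left side is the critical line. -/
theorem im_sideIntegral_mul_logDeriv (hRH : RiemannHypothesis) {σ a b : ℝ} (hσ : 1 / 2 < σ)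
    (ha : 0 < a) (hab : a < b) (hna : ¬ IsZetaOrdinate a) (hnb : ¬ IsZetaOrdinate b)
    (S : Finset ℂ) (hS : ∀ ρ, ρ ∈ S ↔ riemannZeta ρ = 0 ∧ a < ρ.im ∧ ρ.im < b)
    {f : ℂ → ℂ} (hf : Differentiable ℂ f) (hreal : ∀ y : ℝ, (f (1 / 2 + y * I)).im = 0) :
    (sideIntegral (fun s => f s * logDeriv riemannZeta s) σ a b).im =
      Real.pi * ∑ ρ ∈ S, analyticOrderNatAt riemannZeta ρ * (f ρ).re -
        ∫ y in a..b, (f (1 / 2 + y * I)).re * thetaDeriv y := by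
  set m : ℂ → ℕ := analyticOrderNatAt riemannZeta with hm
  set U : Set ℂ := {s | 0 < s.im} with hU
  have hUo : IsOpen U := isOpen_lt continuous_const continuous_im
  have hζd : DifferentiableOn ℂ riemannZeta U := fun s hs =>
    (differentiableAt_riemannZeta_of_im_pos hs).differentiableWithinAt
  have hSU : ∀ ρ ∈ S, ρ ∈ U := fun ρ hρ => ha.trans ((hS ρ).mp hρ).2.1
  have hSre : ∀ ρ ∈ S, ρ.re = 1 / 2 := fun ρ hρ => hRH.re_eq_half ((hS ρ).mp hρ).1 (hSU ρ hρ)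
  obtain ⟨g, hg, hζg, hgS⟩ := hζd.exists_eq_prod_mul hUo m S fun ρ hρ => by
    refine ⟨hSU ρ hρ, ?_⟩
    rw [hm, Nat.cast_analyticOrderNatAt]
    intro htop
    have hconn := (hζd.analyticOnNhd hUo).eqOn_zero_of_preconnected_of_eventuallyEq_zero
      (convex_halfSpace_im_gt 0).isPreconnected (hSU ρ hρ) (analyticOrderAt_eq_top.mp htop)
    have h2 : (2 + (1 : ℝ) * I : ℂ) ∈ U := by simp [hU]
    have := quarter_le_norm_riemannZeta 1
    rw [hconn h2] at this
    norm_num at this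
  set R : Set ℂ := Set.uIcc (1 / 2) σ ×ℂ Set.uIcc a b with hR
  have hRU : ∀ s ∈ R, s ∈ U := by
    intro s hs
    have := hs.2
    rw [Set.mem_preimage, Set.uIcc_of_le hab.le] at this
    exact ha.trans_le this.1
  have hζR : ∀ s ∈ R, s ∉ S → riemannZeta s ≠ 0 := by
    intro s hs hsS h0
    have h2 := hs.2
    rw [Set.mem_preimage, Set.uIcc_of_le hab.le] at h2
    refine hsS ((hS s).mpr ⟨h0, lt_of_le_of_ne h2.1 ?_, lt_of_le_of_ne h2.2 ?_⟩)
    · exact fun h => hna ⟨s, h0, h.symm⟩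
    · exact fun h => hnb ⟨s, h0, h⟩
  have hgR : ∀ s ∈ R, g s ≠ 0 := by
    intro s hs
    by_cases hsS : s ∈ S
    · exact hgS s hsS
    · have := hζR s hs hsS
      rw [hζg s (hRU s hs)] at this
      exact right_ne_zero_of_mul this
  -- `H` is `f ζ'/ζ` with its polar parts removed. Writing `f(s) = f(ρ) + (f(s) - f(ρ))`, the
  -- difference quotients are entire and only constant multiples of `1 / (s - ρ)` remain outside
  -- `H`.
  set H : ℂ → ℂ := fun s => f s * logDeriv g s + ∑ ρ ∈ S, m ρ * dslope f ρ s with hH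
  have hHd : DifferentiableOn ℂ H R := by
    intro s hs
    refine DifferentiableAt.differentiableWithinAt ?_
    have hgs : AnalyticAt ℂ g s := hg.analyticAt (hUo.mem_nhds (hRU s hs))
    refine ((hf s).mul (hgs.deriv.differentiableAt.div hgs.differentiableAt (hgR s hs))).add ?_
    refine DifferentiableAt.fun_sum fun ρ _ => DifferentiableAt.const_mul ?_ _
    have := (differentiableOn_dslope (f := f) (s := Set.univ) (c := ρ) univ_mem).mpr
      hf.differentiableOn
    exact this.differentiableAt univ_mem
  have hsplit : ∀ s ∈ R, s ∉ S → f s * logDeriv riemannZeta s =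
      H s + ∑ ρ ∈ S, (m ρ * f ρ) * (s - ρ)⁻¹ := by
    intro s hs hsS
    have hne : ∀ ρ ∈ S, s - ρ ≠ 0 := fun ρ hρ => sub_ne_zero.mpr (by rintro rfl; exact hsS hρ)
    have hev : riemannZeta =ᶠ[𝓝 s] fun z => (∏ ρ ∈ S, (z - ρ) ^ m ρ) * g z := by
      filter_upwards [hUo.mem_nhds (hRU s hs)] with z hz using hζg z hz
    have h1 := (logDeriv_congr_nhds hev).self_of_nhds
    rw [logDeriv_mul s (Finset.prod_ne_zero_iff.mpr fun ρ hρ => pow_ne_zero _ (hne ρ hρ))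
      (hgR s hs) (by fun_prop) (hg.differentiableAt (hUo.mem_nhds (hRU s hs))),
      logDeriv_prod (f := fun ρ z => (z - ρ) ^ m ρ) (fun ρ hρ => pow_ne_zero _ (hne ρ hρ)) (by fun_prop)] at h1
    have h2 : ∀ ρ ∈ S, logDeriv (fun z => (z - ρ) ^ m ρ) s = m ρ * (s - ρ)⁻¹ := by
      intro ρ _
      rw [logDeriv_fun_pow (by fun_prop), logDeriv_apply]
      simp
    rw [h1, Finset.sum_congr rfl h2, hH, mul_add, Finset.mul_sum, add_assoc, ← Finset.sum_add_distrib,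
      add_comm]
    congr 1
    refine Finset.sum_congr rfl fun ρ hρ => ?_
    rw [dslope_of_ne _ (sub_ne_zero.mp (hne ρ hρ)), slope_def_field]
    have := hne ρ hρ
    field_simp
    ring
  have hsidesR : ∀ s ∈ rectSides σ a b, s ∈ R ∧ s ∉ S := by
    intro s hs
    refine ⟨?_, fun hsS => ?_⟩
    · rw [hR, Set.uIcc_of_le hσ.le, Set.uIcc_of_le hab.le]
      rcases hs with ⟨h, h' | h'⟩ | ⟨h, h'⟩
      · exact ⟨h, by rw [Set.mem_preimage, h']; exact ⟨le_rfl, hab.le⟩⟩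
      · exact ⟨h, by rw [Set.mem_preimage, h']; exact ⟨hab.le, le_rfl⟩⟩
      · exact ⟨by rw [Set.mem_preimage, h]; exact ⟨hσ.le, le_rfl⟩, h'⟩
    · have h1 := ((hS s).mp hsS).2
      have h2 := hSre s hsS
      rcases hs with ⟨h, h' | h'⟩ | ⟨h, h'⟩
      · linarith [h1.1]
      · linarith [h1.2]
      · linarith
  have hcauchy : sideIntegral H σ a b = I * ∫ y in a..b, H (1 / 2 + y * I) := by
    have := integral_boundary_rect_eq_zero_of_differentiableOn H (1 / 2 + a * I) (σ + b * I)
      (by simpa [hR] using hHd)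
    simp only [add_re, add_im, mul_re, mul_im, ofReal_re, ofReal_im, I_re, I_im, smul_eq_mul,
      mul_zero, mul_one, sub_self, add_zero, zero_add] at this
    norm_num at this
    rw [sideIntegral]
    simp only [one_div] at this ⊢
    linear_combination this
  have hHc : ContinuousOn H (rectSides σ a b) :=
    hHd.continuousOn.mono fun s hs => (hsidesR s hs).1
  have hinvc : ∀ ρ ∈ S, ContinuousOn (fun s => (m ρ * f ρ) * (s - ρ)⁻¹) (rectSides σ a b) := by
    intro ρ hρ s hs
    refine ContinuousAt.continuousWithinAt ?_
    refine continuousAt_const.mul (ContinuousAt.inv₀ (by fun_prop) (sub_ne_zero.mpr ?_))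
    rintro rfl
    exact (hsidesR s hs).2 hρ
  rw [sideIntegral_congr hσ hab fun s hs => hsplit s (hsidesR s hs).1 (hsidesR s hs).2,
    sideIntegral_add hσ hab hHc (continuousOn_finsetSum S hinvc),
    sideIntegral_sum hσ hab S hinvc, hcauchy, add_im, add_comm, sub_eq_add_neg]
  have hreal' : ∀ ρ ∈ S, (f ρ).im = 0 := by
    intro ρ hρ
    have e : ρ = 1 / 2 + (ρ.im : ℂ) * I := by
      apply Complex.ext <;> simp [hSre ρ hρ]
    rw [e]; exact hreal _
  congr 1
  · rw [im_sum, Finset.mul_sum]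
    refine Finset.sum_congr rfl fun ρ hρ => ?_
    rw [sideIntegral_const_mul, mul_im, im_sideIntegral_inv hσ (hSre ρ hρ) ((hS ρ).mp hρ).2.1
      ((hS ρ).mp hρ).2.2]
    simp [hreal' ρ hρ]
    ring
  -- On the critical line the removed polar terms are purely imaginary, since `f ρ` is real and `s -
  -- ρ` imaginary. Hence `Re H = f · Re ζ'/ζ = -f θ'` off the finitely many zeros.
  · rw [I_mul_im, ← intervalIntegral.integral_neg]
    have hleft : ContinuousOn (fun y : ℝ => H (1 / 2 + y * I)) (Set.uIcc a b) := by
      refine hHd.continuousOn.comp (by fun_prop) fun y hy => ?_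
      refine ⟨?_, ?_⟩
      · simp
      · simpa using hy
    have := reCLM.intervalIntegral_comp_comm (hleft.intervalIntegrable (μ := MeasureTheory.volume))
    simp only [reCLM_apply] at this
    rw [← this]
    refine intervalIntegral.integral_congr_ae ?_
    have hfin : (S.image im : Set ℝ).Countable := (S.image im).countable_toSet
    filter_upwards [hfin.ae_notMem MeasureTheory.volume] with y hy hyI
    rw [Set.uIoc_of_le hab.le] at hyI
    set s : ℂ := 1 / 2 + y * I with hs
    have hsre : s.re = 1 / 2 := by simp [hs]
    have hsim : s.im = y := by simp [hs]
    have hsS : s ∉ S := by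
      intro h
      exact hy (by simpa using ⟨s, h, hsim⟩)
    have hsR : s ∈ R := by
      rw [hR, Set.uIcc_of_le hσ.le, Set.uIcc_of_le hab.le]
      refine ⟨?_, ?_⟩
      · rw [Set.mem_preimage, hsre]; exact ⟨le_rfl, hσ.le⟩
      · rw [Set.mem_preimage, hsim]; exact ⟨hyI.1.le, hyI.2⟩
    have h1 := congrArg re (hsplit s hsR hsS)
    rw [mul_re, hreal y, re_logDeriv_riemannZeta_half (ha.trans hyI.1) (hζR s hsR hsS), add_re,
      re_sum, Finset.sum_eq_zero] at h1
    · linarith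
    · intro ρ hρ
      have : (s - ρ).re = 0 := by rw [sub_re, hsre, hSre ρ hρ, sub_self]
      simp only [mul_re, inv_re, inv_im, this, mul_im, hreal' ρ hρ]
      simp

/-! ### Digamma and the size of `θ'` -/

lemma differentiableAt_Gamma_of_re_pos {s : ℂ} (hs : 0 < s.re) : DifferentiableAt ℂ Gamma s :=
  differentiableAt_Gamma s fun m h => by
    rw [h, neg_re, natCast_re] at hs
    have : (0 : ℝ) ≤ m := Nat.cast_nonneg m
    linarith

/-- Each modulus `‖s + j‖` is at least `Re s + j`, which reduces the bound to the real point `Re s`.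
There the sequence lies below `Γ` by log-convexity, as in Bohr–Mollerup. -/
lemma norm_GammaSeq_le {s : ℂ} (hs : 0 < s.re) {n : ℕ} (hn : n ≠ 0) :
    ‖GammaSeq s n‖ ≤ Real.Gamma s.re := by
  have hn0 : (0 : ℝ) < n := by positivity
  have h1 := Real.BohrMollerup.ge_logGammaSeq Real.convexOn_log_Gamma
    (fun {y} hy => by
      rw [Function.comp_apply, Real.Gamma_add_one hy.ne', Real.log_mul hy.ne'
        (Real.Gamma_pos_of_pos hy).ne', add_comm, Function.comp_apply]) hs hn
  simp only [Function.comp_apply, Real.Gamma_one, Real.log_one, zero_add] at h1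
  rw [← Real.exp_log (Real.Gamma_pos_of_pos hs)]
  refine le_trans ?_ (Real.exp_le_exp.mpr h1)
  have hpos : ∀ m ∈ Finset.range (n + 1), (0 : ℝ) < s.re + m := fun m _ => by positivity
  rw [Real.BohrMollerup.logGammaSeq, Real.exp_sub, Real.exp_add, Real.exp_sum,
    Real.exp_log (by positivity), Finset.prod_congr rfl fun m hm => Real.exp_log (hpos m hm),
    GammaSeq, norm_div, norm_mul, norm_prod]
  have e : ((n : ℕ) : ℂ) = ((n : ℝ) : ℂ) := by simp
  rw [e, norm_cpow_eq_rpow_re_of_pos hn0, Real.rpow_def_of_pos hn0, mul_comm (Real.log n),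
    Complex.norm_natCast]
  refine div_le_div_of_nonneg_left (by positivity) (Finset.prod_pos hpos) ?_
  refine Finset.prod_le_prod (fun m hm => (hpos m hm).le) fun m _ => ?_
  have := re_le_norm (s + m)
  simpa using this

lemma logDeriv_GammaSeq {s : ℂ} (hs : 0 < s.re) {n : ℕ} (hn : n ≠ 0) :
    DifferentiableAt ℂ (fun w => GammaSeq w n) s ∧ GammaSeq s n ≠ 0 ∧
    logDeriv (fun w => GammaSeq w n) s = Real.log n - ∑ j ∈ Finset.range (n + 1), (s + j)⁻¹ := by
  have hn0 : (n : ℂ) ≠ 0 := Nat.cast_ne_zero.mpr hn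
  have hne : ∀ j ∈ Finset.range (n + 1), s + (j : ℂ) ≠ 0 := fun j _ h => by
    have := congrArg re h
    simp only [add_re, natCast_re, zero_re] at this
    have h2 : (0 : ℝ) ≤ j := Nat.cast_nonneg j
    linarith
  have hprod := Finset.prod_ne_zero_iff.mpr hne
  have hpow : HasDerivAt (fun w : ℂ => (n : ℂ) ^ w) ((n : ℂ) ^ s * log n) s := by
    simpa using (hasDerivAt_id s).const_cpow (Or.inl hn0)
  have hpow0 : (n : ℂ) ^ s ≠ 0 := by simp [cpow_eq_zero_iff, hn0]
  have hfac : (n.factorial : ℂ) ≠ 0 := Nat.cast_ne_zero.mpr n.factorial_ne_zero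
  have hnum : DifferentiableAt ℂ (fun w : ℂ => (n : ℂ) ^ w * n.factorial) s :=
    hpow.differentiableAt.mul_const _
  have hnum0 : (n : ℂ) ^ s * n.factorial ≠ 0 := mul_ne_zero hpow0 hfac
  refine ⟨?_, div_ne_zero hnum0 hprod, ?_⟩
  · exact hnum.fun_div (by fun_prop) hprod
  · change logDeriv (fun w : ℂ => (n : ℂ) ^ w * n.factorial / ∏ j ∈ Finset.range (n + 1), (w + j)) s = _
    rw [logDeriv_div s hnum0 hprod hnum (by fun_prop), logDeriv_mul_const _ _ hfac,
      logDeriv_prod (f := fun (j : ℕ) (w : ℂ) => w + j) hne (by fun_prop)]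
    congr 1
    · rw [logDeriv_apply, hpow.deriv, mul_div_cancel_left₀ _ hpow0, natCast_log]
    · refine Finset.sum_congr rfl fun j _ => ?_
      rw [logDeriv_apply]
      simp

/-- Cauchy's formula expresses the derivatives as circle integrals, to which dominated convergence
applies; the dominating constant is the maximum of `Γ(Re w)` on the circle. -/
lemma tendsto_deriv_GammaSeq {s : ℂ} (hs : 0 < s.re) :
    Tendsto (fun n : ℕ => deriv (fun w => GammaSeq w n) s) atTop (𝓝 (deriv Gamma s)) := by
  set U : Set ℂ := {w | 0 < w.re} with hU
  have hUo : IsOpen U := isOpen_lt continuous_const continuous_re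
  set r := s.re / 2 with hr
  have hr0 : 0 < r := by positivity
  have hball : Metric.closedBall s r ⊆ U := by
    intro w hw
    rw [Metric.mem_closedBall, dist_eq_norm] at hw
    have := (abs_le.mp ((abs_re_le_norm (w - s)).trans hw)).1
    rw [sub_re] at this
    change 0 < w.re
    linarith
  have hΓ : DifferentiableOn ℂ Gamma U := fun w hw =>
    (differentiableAt_Gamma_of_re_pos hw).differentiableWithinAt
  rw [← cderiv_eq_deriv hUo hΓ hr0 hball]
  have hev : ∀ᶠ n : ℕ in atTop, cderiv r (fun w => GammaSeq w n) s =
      deriv (fun w => GammaSeq w n) s := by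
    filter_upwards [eventually_ne_atTop 0] with n hn
    exact cderiv_eq_deriv hUo (fun w hw => (logDeriv_GammaSeq hw hn).1.differentiableWithinAt)
      hr0 hball
  refine Tendsto.congr' hev ?_
  simp only [cderiv]
  refine Tendsto.const_smul ?_ _
  simp only [circleIntegral]
  have hsph : ∀ θ : ℝ, circleMap s r θ ∈ Metric.sphere s r := fun θ => circleMap_mem_sphere s hr0.le θ
  have hcont : ContinuousOn (fun w : ℂ => Real.Gamma w.re) (Metric.sphere s r) := by
    intro w hw
    have hwU : 0 < w.re := hball (Metric.sphere_subset_closedBall hw)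
    refine ContinuousAt.continuousWithinAt ?_
    have h1 : ContinuousAt Real.Gamma w.re :=
      (Real.differentiableAt_Gamma fun m => by
        have : (0 : ℝ) ≤ m := Nat.cast_nonneg m
        linarith).continuousAt
    exact h1.comp continuous_re.continuousAt
  obtain ⟨M, hM⟩ := (isCompact_sphere s r).bddAbove_image hcont
  have hne : ∀ θ : ℝ, circleMap s r θ - s ≠ 0 := fun θ h => by
    rw [circleMap_sub_center] at h
    have := norm_circleMap_zero r θ
    rw [h, norm_zero, eq_comm, abs_eq_zero] at this
    exact hr0.ne' this
  refine intervalIntegral.tendsto_integral_filter_of_dominated_convergence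
    (fun _ => r * ((r ^ 2)⁻¹ * M)) ?_ ?_ intervalIntegrable_const ?_
  · filter_upwards [eventually_ne_atTop 0] with n hn
    refine Continuous.aestronglyMeasurable ?_
    have h1 : Continuous fun θ => GammaSeq (circleMap s r θ) n := by
      have h2 : ContinuousOn (fun w => GammaSeq w n) U := fun w hw =>
        (logDeriv_GammaSeq hw hn).1.continuousAt.continuousWithinAt
      exact h2.comp_continuous (continuous_circleMap s r) fun θ =>
        hball (Metric.sphere_subset_closedBall (hsph θ))
    have h3 : Continuous fun θ => deriv (circleMap s r) θ := by
      simp only [deriv_circleMap]; fun_prop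
    have h4 : Continuous fun θ => ((circleMap s r θ - s) ^ 2)⁻¹ :=
      Continuous.inv₀ (by fun_prop) fun θ => pow_ne_zero _ (hne θ)
    exact h3.smul (h4.smul h1)
  · filter_upwards [eventually_ne_atTop 0] with n hn
    refine Eventually.of_forall fun θ _ => ?_
    rw [norm_smul, norm_smul, norm_inv, norm_pow, circleMap_sub_center, deriv_circleMap,
      norm_mul, norm_I, mul_one, norm_circleMap_zero, abs_of_pos hr0]
    have hmem : 0 < (circleMap s r θ).re := hball (Metric.sphere_subset_closedBall (hsph θ))
    have := (norm_GammaSeq_le hmem hn).trans (hM ⟨_, hsph θ, rfl⟩)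
    gcongr
  · refine Eventually.of_forall fun θ _ => ?_
    exact ((GammaSeq_tendsto_Gamma _).const_smul _).const_smul _

lemma tendsto_digamma {s : ℂ} (hs : 0 < s.re) :
    Tendsto (fun n : ℕ => (Real.log n : ℂ) - ∑ j ∈ Finset.range (n + 1), (s + j)⁻¹) atTop
      (𝓝 (digamma s)) := by
  have h := (tendsto_deriv_GammaSeq hs).div (GammaSeq_tendsto_Gamma s) (Gamma_ne_zero_of_re_pos hs)
  rw [digamma_def, logDeriv_apply]
  refine Tendsto.congr' ?_ h
  filter_upwards [eventually_ne_atTop 0] with n hn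
  exact (logDeriv_GammaSeq hs hn).2.2

/-- In Gauss's limit each `Re 1/(s+j)` is replaced by `log ‖s+j+1‖ - log ‖s+j‖`, which telescopes.
The errors are at most `‖s+j‖⁻²`. Taking real parts throughout avoids arguments of logarithms. -/
lemma abs_re_digamma_sub_log_norm_le {s : ℂ} (hs : 0 < s.re) (him : 2 ≤ s.im) :
    |(digamma s).re - Real.log ‖s‖| ≤ 2 / (s.im - 1) := by
  set v := s.im with hv
  have him_le : ∀ j : ℕ, v ≤ ‖s + j‖ := fun j => by
    have := im_le_norm (s + j)
    simpa [← hv] using this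
  have hpos : ∀ j : ℕ, 0 < ‖s + j‖ := fun j => by linarith [him_le j]
  have hsq : ∀ j : ℕ, (j : ℝ) ^ 2 + v ^ 2 ≤ ‖s + j‖ ^ 2 := fun j => by
    rw [← normSq_eq_norm_sq, normSq_apply]
    simp only [add_re, natCast_re, add_im, natCast_im, add_zero, ← hv]
    have : (0 : ℝ) ≤ j := Nat.cast_nonneg j
    nlinarith
  -- The telescoping majorant works because `(v - 1 + j)(v + j) ≤ (v + j)² ≤ 2(v² + j²)`.
  have hterm : ∀ j : ℕ, |Real.log ‖s + (j + 1 : ℕ)‖ - Real.log ‖s + j‖ - ((s + j)⁻¹).re| ≤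
      2 * (1 / (v - 1 + j) - 1 / (v - 1 + (j + 1 : ℕ))) := by
    intro j
    have hj : (0 : ℝ) ≤ j := Nat.cast_nonneg j
    have hne : s + (j : ℂ) ≠ 0 := norm_pos_iff.mp (hpos j)
    set z := (s + (j : ℂ))⁻¹ with hz
    have hzn : ‖z‖ ≤ 1 / 2 := by
      rw [hz, norm_inv]
      calc ‖s + (j : ℂ)‖⁻¹ ≤ (2 : ℝ)⁻¹ := inv_anti₀ (by norm_num) (him.trans (him_le j))
        _ = 1 / 2 := by norm_num
    have e1 : Real.log ‖s + (j + 1 : ℕ)‖ - Real.log ‖s + j‖ = (log (1 + z)).re := by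
      rw [← Real.log_div (hpos _).ne' (hpos j).ne', ← norm_div, log_re]
      congr 2
      rw [hz]
      push_cast
      field_simp
      ring
    rw [e1, ← sub_re]
    refine (abs_re_le_norm _).trans ((norm_log_one_add_sub_self_le (by linarith)).trans ?_)
    have h1 : ‖z‖ ^ 2 * (1 - ‖z‖)⁻¹ / 2 ≤ ‖z‖ ^ 2 := by
      have : (1 - ‖z‖)⁻¹ ≤ 2 := by
        rw [inv_le_comm₀ (by linarith) (by norm_num)]
        linarith
      nlinarith [sq_nonneg ‖z‖]
    refine h1.trans ?_
    have h2 : ‖z‖ ^ 2 ≤ 1 / ((j : ℝ) ^ 2 + v ^ 2) := by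
      rw [hz, norm_inv, inv_pow, ← one_div]
      exact one_div_le_one_div_of_le (by positivity) (hsq j)
    refine h2.trans ?_
    push_cast
    have a1 : (0 : ℝ) < v - 1 + j := by linarith
    have a2 : (0 : ℝ) < v - 1 + (j + 1) := by linarith
    rw [div_sub_div _ _ a1.ne' a2.ne', ← mul_div_assoc, div_le_div_iff₀ (by positivity) (by positivity)]
    nlinarith [sq_nonneg (v - j)]
  have hsum : ∀ n : ℕ, |(Real.log ‖s + (n + 1 : ℕ)‖ - Real.log ‖s‖) -
      ∑ j ∈ Finset.range (n + 1), ((s + j)⁻¹).re| ≤ 2 / (v - 1) := by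
    intro n
    have h1 := Finset.sum_range_sub (fun j : ℕ => Real.log ‖s + j‖) (n + 1)
    simp only [Nat.cast_zero, add_zero] at h1
    rw [← h1, ← Finset.sum_sub_distrib]
    refine (Finset.abs_sum_le_sum_abs _ _).trans ((Finset.sum_le_sum fun j _ => hterm j).trans ?_)
    rw [← Finset.mul_sum, Finset.sum_range_sub' (fun j : ℕ => 1 / (v - 1 + (j : ℝ))) (n + 1)]
    have : (0 : ℝ) < v - 1 + (n + 1 : ℕ) := by
      have : (0 : ℝ) ≤ (n + 1 : ℕ) := Nat.cast_nonneg _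
      linarith
    have h2 : 0 < 1 / (v - 1 + ((n + 1 : ℕ) : ℝ)) := by positivity
    simp only [Nat.cast_zero, add_zero]
    rw [div_eq_mul_one_div 2 (v - 1)]
    linarith
  have hlim1 := (continuous_re.tendsto _).comp (tendsto_digamma hs)
  have hlim2 : Tendsto (fun n : ℕ => Real.log n - Real.log ‖s + (n + 1 : ℕ)‖) atTop (𝓝 0) := by
    have h3 : Tendsto (fun n : ℕ => ‖(s + (n + 1 : ℕ)) / n‖) atTop (𝓝 1) := by
      have h4 : Tendsto (fun n : ℕ => (s + 1) / (n : ℂ) + 1) atTop (𝓝 (0 + 1)) :=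
        (tendsto_const_div_atTop_nhds_zero_nat (s + 1)).add_const 1
      have h5 := h4.norm
      simp only [zero_add, norm_one] at h5
      refine h5.congr' ?_
      filter_upwards [eventually_ne_atTop 0] with n hn
      have : (n : ℂ) ≠ 0 := Nat.cast_ne_zero.mpr hn
      congr 1
      push_cast
      field_simp
      ring
    have h6 := (h3.log one_ne_zero).neg
    rw [Real.log_one, neg_zero] at h6
    refine h6.congr' ?_
    filter_upwards [eventually_ne_atTop 0] with n hn
    have hn' : (n : ℝ) ≠ 0 := Nat.cast_ne_zero.mpr hn
    rw [norm_div, Complex.norm_natCast, Real.log_div (hpos _).ne' hn']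
    ring
  have hlim := (hlim1.sub hlim2).sub_const (Real.log ‖s‖)
  rw [sub_zero] at hlim
  refine le_of_tendsto hlim.abs (Eventually.of_forall fun n => ?_)
  refine le_trans (le_of_eq ?_) (hsum n)
  congr 1
  simp only [Function.comp_apply, sub_re, ofReal_re, re_sum]
  ring

lemma logDeriv_Gammaℝ {s : ℂ} (hs : 0 < s.re) :
    logDeriv Gammaℝ s = -(Real.log Real.pi : ℂ) / 2 + digamma (s / 2) / 2 := by
  have hπ : (Real.pi : ℂ) ≠ 0 := ofReal_ne_zero.mpr Real.pi_ne_zero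
  have hs2 : 0 < (s / 2).re := by simpa using hs
  have h1 : HasDerivAt (fun s : ℂ => (Real.pi : ℂ) ^ (-s / 2))
      ((Real.pi : ℂ) ^ (-s / 2) * log Real.pi * (-1 / 2)) s :=
    (((hasDerivAt_id s).neg).div_const 2).const_cpow (Or.inl hπ)
  have h2 : HasDerivAt (fun s : ℂ => Gamma (s / 2)) (deriv Gamma (s / 2) * (1 / 2)) s :=
    (differentiableAt_Gamma_of_re_pos hs2).hasDerivAt.comp s ((hasDerivAt_id s).div_const 2)
  have hp0 : (Real.pi : ℂ) ^ (-s / 2) ≠ 0 := by simp [cpow_eq_zero_iff, hπ]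
  change logDeriv (fun s : ℂ => (Real.pi : ℂ) ^ (-s / 2) * Gamma (s / 2)) s = _
  rw [logDeriv_mul (f := fun s : ℂ => (Real.pi : ℂ) ^ (-s / 2)) (g := fun s : ℂ => Gamma (s / 2)) s hp0
    (Gamma_ne_zero_of_re_pos hs2) h1.differentiableAt h2.differentiableAt,
    logDeriv_apply, logDeriv_apply, h1.deriv, h2.deriv, digamma_def, logDeriv_apply,
    ofReal_log Real.pi_pos.le]
  have := Gamma_ne_zero_of_re_pos hs2
  field_simp

lemma abs_thetaDeriv_sub_log_le {y : ℝ} (hy : 4 ≤ y) :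
    |thetaDeriv y - 1 / 2 * Real.log (y / (2 * Real.pi))| ≤ 5 / y := by
  set s : ℂ := (1 / 2 + y * I) / 2 with hs
  have hsre : s.re = 1 / 4 := by simp [hs]; norm_num
  have hsim : s.im = y / 2 := by simp [hs]
  have h1 := abs_re_digamma_sub_log_norm_le (s := s) (by rw [hsre]; norm_num) (by rw [hsim]; linarith)
  rw [hsim] at h1
  have h2 : thetaDeriv y = -Real.log Real.pi / 2 + (digamma s).re / 2 := by
    rw [thetaDeriv, logDeriv_Gammaℝ (by simp)]
    have e : ∀ z : ℂ, (z / 2).re = z.re / 2 := fun z => by simp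
    rw [add_re, e, e, neg_re, ofReal_re]
  have hn2 : ‖s‖ ^ 2 = (y / 2) ^ 2 + 1 / 16 := by
    rw [← normSq_eq_norm_sq, normSq_apply, hsre, hsim]; ring
  have hnpos : 0 < ‖s‖ := norm_pos_iff.mpr fun h => by rw [h] at hsre; norm_num at hsre
  have h3 : 0 ≤ Real.log ‖s‖ - Real.log (y / 2) ∧ Real.log ‖s‖ - Real.log (y / 2) ≤ 1 / y := by
    have h4 : Real.log ‖s‖ - Real.log (y / 2) = 1 / 2 * Real.log (1 + 1 / (4 * y ^ 2)) := by
      have : Real.log (‖s‖ ^ 2) = Real.log ((y / 2) ^ 2 * (1 + 1 / (4 * y ^ 2))) := by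
        rw [hn2]; congr 1; field_simp; ring
      rw [Real.log_mul (by positivity) (by positivity), Real.log_pow, Real.log_pow] at this
      push_cast at this
      linarith
    rw [h4]
    have h5 : 0 ≤ Real.log (1 + 1 / (4 * y ^ 2)) := Real.log_nonneg (by
      have : 0 < 1 / (4 * y ^ 2) := by positivity
      linarith)
    have h6 := Real.log_le_sub_one_of_pos (show 0 < 1 + 1 / (4 * y ^ 2) by positivity)
    refine ⟨by positivity, ?_⟩
    have h7 : 1 / (4 * y ^ 2) ≤ 1 / y := one_div_le_one_div_of_le (by linarith) (by nlinarith)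
    linarith
  have h8 : 2 / (y / 2 - 1) ≤ 8 / y := by
    rw [div_le_div_iff₀ (by linarith) (by linarith)]; linarith
  have h9 : Real.log (y / (2 * Real.pi)) = Real.log (y / 2) - Real.log Real.pi := by
    rw [← Real.log_div (by positivity) (by positivity), div_div]
  have e1 : 5 / y = 5 * (1 / y) := by ring
  have e2 : 8 / y = 8 * (1 / y) := by ring
  rw [e1]
  rw [e2] at h8
  have hy0 : 0 < 1 / y := by positivity
  rw [abs_le] at h1 ⊢
  rw [h2, h9]
  constructor <;> linarith [h1.1, h1.2, h3.1, h3.2]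

lemma continuous_thetaDeriv : Continuous thetaDeriv := by
  have h1 : ContinuousOn (logDeriv Gammaℝ) {s | 0 < s.re} := by
    have hd : DifferentiableOn ℂ Gammaℝ {s | 0 < s.re} := fun s hs =>
      (differentiableAt_Gammaℝ hs).differentiableWithinAt
    exact (hd.deriv (isOpen_lt continuous_const continuous_re)).continuousOn.div hd.continuousOn
      fun s hs => Gammaℝ_ne_zero_of_re_pos hs
  exact continuous_re.comp (h1.comp_continuous (by fun_prop) fun y => by simp)

/-! ### The cardinal sine and its partition of unity -/

lemma Complex.norm_sin_le_exp_abs_im (z : ℂ) : ‖Complex.sin z‖ ≤ Real.exp |z.im| := by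
  have h1 : ‖Complex.exp (-z * I)‖ ≤ Real.exp |z.im| := by
    rw [Complex.norm_exp]
    exact Real.exp_le_exp.mpr (by simpa using le_abs_self z.im)
  have h2 : ‖Complex.exp (z * I)‖ ≤ Real.exp |z.im| := by
    rw [Complex.norm_exp]
    exact Real.exp_le_exp.mpr (by simpa using neg_le_abs z.im)
  rw [Complex.sin, norm_div, norm_mul, norm_I, mul_one, Complex.norm_ofNat]
  have := norm_sub_le (Complex.exp (-z * I)) (Complex.exp (z * I))
  linarith

/-- The entire function `sin (π z) / (π z)`. -/
noncomputable def cardSine (z : ℂ) : ℂ :=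
  dslope (fun w => Complex.sin (Real.pi * w) / Real.pi) 0 z

lemma differentiable_cardSine : Differentiable ℂ cardSine := by
  have h : DifferentiableOn ℂ (fun w => Complex.sin (Real.pi * w) / Real.pi) Set.univ := by
    fun_prop
  exact differentiableOn_univ.mp ((Complex.differentiableOn_dslope univ_mem).mpr h)

lemma mul_cardSine (z : ℂ) : z * cardSine z = Complex.sin (Real.pi * z) / Real.pi := by
  have h := sub_smul_dslope (fun w => Complex.sin (Real.pi * w) / Real.pi) 0 z
  simpa [cardSine] using h

lemma cardSine_zero : cardSine 0 = 1 := by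
  have h : HasDerivAt (fun w : ℂ => Complex.sin (Real.pi * w) / Real.pi) 1 0 := by
    have h1 := ((hasDerivAt_id (0 : ℂ)).const_mul (Real.pi : ℂ)).csin.div_const (Real.pi : ℂ)
    have hpi : (Real.pi : ℂ) ≠ 0 := ofReal_ne_zero.mpr Real.pi_ne_zero
    have h2 : Complex.cos (Real.pi * id 0) * (Real.pi * 1) / Real.pi = 1 := by
      simp [hpi]
    rwa [h2] at h1
  rw [cardSine, dslope_same, h.deriv]

lemma cardSine_ofReal (x : ℝ) : cardSine x = (Real.sinc (Real.pi * x) : ℝ) := by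
  rcases eq_or_ne x 0 with rfl | hx
  · simp [cardSine_zero]
  · have hx' : (x : ℂ) ≠ 0 := ofReal_ne_zero.mpr hx
    apply mul_left_cancel₀ hx'
    rw [mul_cardSine, Real.sinc_of_ne_zero (mul_ne_zero Real.pi_ne_zero hx)]
    push_cast
    have : (Real.pi : ℂ) ≠ 0 := ofReal_ne_zero.mpr Real.pi_ne_zero
    field_simp

lemma cardSine_neg (z : ℂ) : cardSine (-z) = cardSine z := by
  rcases eq_or_ne z 0 with rfl | hz
  · simp
  · apply mul_left_cancel₀ (neg_ne_zero.mpr hz)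
    rw [mul_cardSine, neg_mul, mul_cardSine, mul_neg, Complex.sin_neg, neg_div]

lemma exists_norm_cardSine_le :
    ∃ K, 0 < K ∧ ∀ w, (1 + ‖w‖) * ‖cardSine w‖ ≤ K * Real.exp (Real.pi * |w.im|) := by
  obtain ⟨K, hK⟩ := (isCompact_closedBall (0 : ℂ) 1).exists_bound_of_continuousOn
    differentiable_cardSine.continuous.continuousOn
  have hK0 : 0 ≤ K := (norm_nonneg _).trans (hK 0 (by simp))
  refine ⟨2 * K + 1, by positivity, fun w => ?_⟩
  have he : 1 ≤ Real.exp (Real.pi * |w.im|) := Real.one_le_exp (by positivity)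
  rcases le_total ‖w‖ 1 with h | h
  · have h1 := hK w (by simpa using h)
    calc (1 + ‖w‖) * ‖cardSine w‖ ≤ (1 + 1) * K := by gcongr
      _ ≤ (2 * K + 1) * 1 := by linarith
      _ ≤ _ := by gcongr
  · have h2 : ‖w‖ * ‖cardSine w‖ ≤ Real.exp (Real.pi * |w.im|) / Real.pi := by
      rw [← norm_mul, mul_cardSine, norm_div, norm_real, Real.norm_of_nonneg Real.pi_pos.le]
      gcongr
      have := Complex.norm_sin_le_exp_abs_im (Real.pi * w)
      simpa [abs_mul, abs_of_pos Real.pi_pos] using this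
    have h3 : Real.exp (Real.pi * |w.im|) / Real.pi ≤ Real.exp (Real.pi * |w.im|) / 2 := by
      gcongr
      exact Real.two_le_pi
    have h4 : (1 + ‖w‖) * ‖cardSine w‖ ≤ 2 * (‖w‖ * ‖cardSine w‖) := by
      nlinarith [norm_nonneg (cardSine w)]
    nlinarith

/-- The series `∑ (sin (π z) / (π (z + n + 1)))²`, an entire function. -/
noncomputable def cardSineTail (z : ℂ) : ℂ := ∑' n : ℕ, cardSine (z + (n + 1)) ^ 2

lemma exists_norm_cardSine_add_sq_le (R : ℝ) (hR : 0 ≤ R) :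
    ∃ C, ∀ (n : ℕ) (z : ℂ), ‖z‖ ≤ R → ‖cardSine (z + (n + 1)) ^ 2‖ ≤ C * ((n : ℝ) + 1) ^ (-2 : ℝ) := by
  obtain ⟨K, hK, h⟩ := exists_norm_cardSine_le
  refine ⟨(K * Real.exp (Real.pi * R) * (R + 1)) ^ 2, fun n z hz => ?_⟩
  have h1 := h (z + (n + 1))
  have h2 : (n : ℝ) + 1 ≤ R + ‖z + (n + 1)‖ := by
    have h3 : ‖((n : ℂ) + 1)‖ = n + 1 := by
      rw [← Nat.cast_succ, Complex.norm_natCast, Nat.cast_succ]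
    have h4 := norm_sub_le (z + ((n : ℂ) + 1)) z
    rw [add_sub_cancel_left, h3] at h4
    linarith
  have h5 : Real.exp (Real.pi * |(z + (n + 1)).im|) ≤ Real.exp (Real.pi * R) := by
    gcongr
    have : (z + ((n : ℂ) + 1)).im = z.im := by simp
    rw [this]
    exact (abs_im_le_norm z).trans hz
  set x := ‖z + ((n : ℂ) + 1)‖
  have hx : 0 ≤ x := norm_nonneg _
  have h6 : (n : ℝ) + 1 ≤ (R + 1) * (1 + x) := by nlinarith
  have h7 : ‖cardSine (z + (n + 1))‖ * ((n : ℝ) + 1) ≤ K * Real.exp (Real.pi * R) * (R + 1) := by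
    calc ‖cardSine (z + (n + 1))‖ * ((n : ℝ) + 1)
        ≤ ‖cardSine (z + (n + 1))‖ * ((R + 1) * (1 + x)) := by gcongr
      _ = (R + 1) * ((1 + x) * ‖cardSine (z + (n + 1))‖) := by ring
      _ ≤ (R + 1) * (K * Real.exp (Real.pi * R)) := by
          refine mul_le_mul_of_nonneg_left (h1.trans ?_) (by positivity)
          exact mul_le_mul_of_nonneg_left h5 hK.le
      _ = _ := by ring
  rw [norm_pow, Real.rpow_neg (by positivity), ← div_eq_mul_inv, Real.rpow_two,
    le_div_iff₀ (by positivity), ← mul_pow]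
  gcongr

lemma summable_cardSine_add_sq (z : ℂ) : Summable fun n : ℕ => cardSine (z + (n + 1)) ^ 2 := by
  obtain ⟨C, hC⟩ := exists_norm_cardSine_add_sq_le ‖z‖ (norm_nonneg z)
  exact Summable.of_norm_bounded ((summable_succ_rpow (by norm_num)).mul_left C)
    fun n => hC n z le_rfl

lemma differentiable_cardSineTail : Differentiable ℂ cardSineTail := by
  intro z
  obtain ⟨C, hC⟩ := exists_norm_cardSine_add_sq_le (‖z‖ + 1) (by positivity)
  have h := differentiableOn_tsum_of_summable_norm (U := Metric.ball 0 (‖z‖ + 1))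
    (F := fun (n : ℕ) w => cardSine (w + (n + 1)) ^ 2)
    ((summable_succ_rpow (p := -2) (by norm_num)).mul_left C)
    (fun n => ((differentiable_cardSine.comp (differentiable_id.add_const _)).pow 2).differentiableOn)
    Metric.isOpen_ball (fun n w hw => hC n w (by simpa using (mem_ball_zero_iff.mp hw).le))
  exact h.differentiableAt (Metric.isOpen_ball.mem_nhds (by simp))

/-- Prepares Parseval's identity on an interval of length one, which turns these coefficients into a
sum of squares equal to `1`. -/
lemma fourierCoeffOn_exp (x : ℝ) (n : ℤ) :
    fourierCoeffOn (a := -1 / 2) (b := 1 / 2) (by norm_num)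
      (fun t : ℝ => Complex.exp (2 * Real.pi * x * t * I)) n = cardSine (x - n) := by
  rw [fourierCoeffOn_eq_integral]
  have h1 : ∀ t : ℝ, fourier (-n) (t : AddCircle ((1 / 2 : ℝ) - -1 / 2)) •
      Complex.exp (2 * Real.pi * x * t * I) = Complex.exp (2 * Real.pi * (x - n) * I * t) := by
    intro t
    rw [fourier_coe_apply, smul_eq_mul, ← Complex.exp_add]
    congr 1
    push_cast
    norm_num
    ring
  simp only [h1]
  rcases eq_or_ne ((x : ℂ) - n) 0 with h | h
  · simp [h, cardSine_zero]
    norm_num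
  · have hpi : (Real.pi : ℂ) ≠ 0 := ofReal_ne_zero.mpr Real.pi_ne_zero
    rw [integral_exp_mul_complex (by simp [hpi, h])]
    apply mul_left_cancel₀ h
    rw [mul_cardSine, Complex.sin]
    have e1 : 2 * (Real.pi : ℂ) * (x - n) * I * ((1 / 2 : ℝ) : ℂ) = Real.pi * (x - n) * I := by
      push_cast; ring
    have e2 : 2 * (Real.pi : ℂ) * (x - n) * I * ((-1 / 2 : ℝ) : ℂ) = -(Real.pi * (x - n)) * I := by
      push_cast; ring
    rw [e1, e2]
    norm_num
    field_simp
    linear_combination (Complex.exp ((x - n) * Real.pi * I) -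
      Complex.exp (-((x - n) * Real.pi * I))) * I_sq

/-- Parseval for the unimodular function `e^{2πixu}` on `(-1/2, 1/2]`. -/
lemma hasSum_sinc_sq (x : ℝ) :
    HasSum (fun n : ℤ => Real.sinc (Real.pi * (x - n)) ^ 2) 1 := by
  have hL2 : MeasureTheory.MemLp (fun t : ℝ => Complex.exp (2 * Real.pi * x * t * I)) 2
      (MeasureTheory.volume.restrict (Set.Ioc (-1 / 2) (1 / 2))) := by
    refine MeasureTheory.MemLp.of_bound
      (Continuous.aestronglyMeasurable (by fun_prop)) 1 (Eventually.of_forall fun t => ?_)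
    simp [Complex.norm_exp]
  have h := hasSum_sq_fourierCoeffOn (a := -1 / 2) (b := 1 / 2) (by norm_num) hL2
  have h2 : ∀ t : ℝ, ‖Complex.exp (2 * Real.pi * x * t * I)‖ = 1 := fun t => by
    simp [Complex.norm_exp]
  simp only [fourierCoeffOn_exp, h2] at h
  convert h using 1
  · ext n
    have : (x : ℂ) - n = ((x - n : ℝ) : ℂ) := by push_cast; rfl
    rw [this, cardSine_ofReal, norm_real, Real.norm_eq_abs, sq_abs]
  · norm_num

lemma cardSineTail_ofReal (x : ℝ) :
    cardSineTail x = ((∑' n : ℕ, Real.sinc (Real.pi * (x + (n + 1))) ^ 2 : ℝ) : ℂ) := by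
  rw [cardSineTail, ofReal_tsum]
  congr 1
  ext n
  rw [show (x : ℂ) + (n + 1) = ((x + (n + 1) : ℝ) : ℂ) by push_cast; rfl, cardSine_ofReal]
  push_cast
  rfl

lemma summable_sinc_add_sq (x : ℝ) :
    Summable fun n : ℕ => Real.sinc (Real.pi * (x + (n + 1))) ^ 2 := by
  rw [← Complex.summable_ofReal]
  convert summable_cardSine_add_sq x using 1
  ext n
  rw [show (x : ℂ) + (n + 1) = ((x + (n + 1) : ℝ) : ℂ) by push_cast; rfl, cardSine_ofReal]
  push_cast
  rfl

lemma sinc_sq_add_tsum (x : ℝ) : Real.sinc (Real.pi * x) ^ 2 +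
    ∑' n : ℕ, Real.sinc (Real.pi * (x + (n + 1))) ^ 2 +
    ∑' n : ℕ, Real.sinc (Real.pi * (-x + (n + 1))) ^ 2 = 1 := by
  have h1 : ∀ n : ℕ, Real.sinc (Real.pi * (x - ((n + 1 : ℤ) : ℤ))) ^ 2 =
      Real.sinc (Real.pi * (-x + (n + 1))) ^ 2 := fun n => by
    rw [← Real.sinc_neg]
    push_cast
    ring_nf
  have h2 : ∀ n : ℕ, Real.sinc (Real.pi * (x - ((-(n + 1) : ℤ) : ℤ))) ^ 2 =
      Real.sinc (Real.pi * (x + (n + 1))) ^ 2 := fun n => by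
    push_cast
    ring_nf
  have h := tsum_of_add_one_of_neg_add_one
    (f := fun n : ℤ => Real.sinc (Real.pi * (x - n)) ^ 2)
    ((summable_sinc_add_sq (-x)).congr fun n => (h1 n).symm)
    ((summable_sinc_add_sq x).congr fun n => (h2 n).symm)
  rw [(hasSum_sinc_sq x).tsum_eq] at h
  simp only [h1, h2] at h
  simp only [Int.cast_zero, sub_zero] at h
  linarith

lemma Differentiable.eq_of_eq_ofReal {f g : ℂ → ℂ} (hf : Differentiable ℂ f)
    (hg : Differentiable ℂ g) (h : ∀ x : ℝ, f x = g x) : f = g := by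
  refine AnalyticOnNhd.eq_of_frequently_eq (z₀ := 0) (fun z _ => hf.analyticAt z)
    (fun z _ => hg.analyticAt z) ?_
  rw [frequently_iff]
  intro U hU
  rw [mem_nhdsWithin] at hU
  obtain ⟨V, hV, h0, hVU⟩ := hU
  obtain ⟨r, hr, hrV⟩ := Metric.isOpen_iff.mp hV 0 h0
  refine ⟨((r / 2 : ℝ) : ℂ), hVU ⟨hrV ?_, ?_⟩, h _⟩
  · rw [mem_ball_zero_iff, norm_real, Real.norm_of_nonneg (by positivity)]
    linarith
  · simpa using hr.ne'

lemma cardSine_sq_add_cardSineTail (z : ℂ) :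
    cardSine z ^ 2 + cardSineTail z + cardSineTail (-z) = 1 := by
  have h := Differentiable.eq_of_eq_ofReal
    (f := fun z => cardSine z ^ 2 + cardSineTail z + cardSineTail (-z)) (g := fun _ => 1)
    (((differentiable_cardSine.pow 2).add differentiable_cardSineTail).add
      (differentiable_cardSineTail.comp differentiable_neg)) (differentiable_const 1) fun x => by
      have := sinc_sq_add_tsum x
      rw [← ofReal_neg, cardSineTail_ofReal, cardSineTail_ofReal, cardSine_ofReal]
      exact_mod_cast congrArg (fun y : ℝ => (y : ℂ)) this
  exact congrFun h z

/-! ### Beurling's function: approximation to the sign, one-sided bounds, integral -/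

/-- Beurling's entire majorant of the sign function. -/
noncomputable def beurling (z : ℂ) : ℂ :=
  1 + 2 * (Complex.sin (Real.pi * z) / Real.pi * cardSine z - cardSineTail z)

lemma differentiable_beurling : Differentiable ℂ beurling := by
  have h1 := differentiable_cardSine
  have h2 := differentiable_cardSineTail
  unfold beurling
  fun_prop

/-- The terms with `sin (π z)` are odd and cancel, leaving the partition of unity. This identity
transports every estimate from the right half-plane to the left one and computes the excess over the
sign function. -/
lemma beurling_add_beurling_neg (z : ℂ) : beurling z + beurling (-z) = 2 * cardSine z ^ 2 := by
  have h := cardSine_sq_add_cardSineTail z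
  rw [beurling, beurling, cardSine_neg, mul_neg, Complex.sin_neg]
  linear_combination -2 * h

lemma sq_norm_add_natCast_ge {w : ℂ} (hw : 0 ≤ w.re) (x : ℝ) (hx : 0 ≤ x) :
    (‖w‖ + x) ^ 2 ≤ 2 * ‖w + x‖ ^ 2 := by
  have h1 : ‖w‖ ^ 2 + x ^ 2 ≤ ‖w + x‖ ^ 2 := by
    rw [Complex.sq_norm, Complex.sq_norm, normSq_apply, normSq_apply]
    simp
    nlinarith
  nlinarith [sq_nonneg (‖w‖ - x)]

lemma hasSum_telescope (f : ℕ → ℝ) (hf : Antitone f) (h0 : Tendsto f atTop (𝓝 0)) :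
    HasSum (fun n => f n - f (n + 1)) (f 0) := by
  rw [hasSum_iff_tendsto_nat_of_nonneg fun n => sub_nonneg.mpr (hf n.le_succ)]
  simp only [Finset.sum_range_sub']
  simpa using h0.const_sub (f 0)

lemma hasSum_inv_add_sub_inv_add_one {r : ℝ} (hr : 0 < r) :
    HasSum (fun n : ℕ => 1 / (r + n) - 1 / (r + n + 1)) (1 / r) := by
  have h := hasSum_telescope (fun n : ℕ => 1 / (r + n)) (fun m n hmn => by
    have : (m : ℝ) ≤ n := by exact_mod_cast hmn
    dsimp only
    gcongr) ?_
  · simpa [add_assoc] using h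
  · have := tendsto_atTop_add_const_left atTop r (tendsto_natCast_atTop_atTop (R := ℝ))
    simpa only [one_div] using! this.inv_tendsto_atTop

lemma add_natCast_ne_zero {w : ℂ} (hw : 0 ≤ w.re) (hw0 : w ≠ 0) (n : ℕ) : w + n ≠ 0 := by
  intro h
  rcases Nat.eq_zero_or_pos n with rfl | hn
  · simp at h; exact hw0 h
  · have := congrArg re h
    simp at this
    have : (0 : ℝ) < n := by exact_mod_cast hn
    linarith

/-- The terms are `1/(w+n) - 1/(w+n+1)`. Writing `1/w` in this way makes it comparable termwise with
`∑ 1/(w+n+1)²`. -/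
lemma hasSum_inv_mul_inv {w : ℂ} (hw : 0 ≤ w.re) (hw0 : w ≠ 0) :
    HasSum (fun n : ℕ => 1 / ((w + n) * (w + n + 1))) (1 / w) := by
  have hpos : 0 < ‖w‖ := norm_pos_iff.mpr hw0
  have hs : Summable fun n : ℕ => 1 / ((w + n) * (w + n + 1)) := by
    refine Summable.of_norm_bounded
      ((hasSum_inv_add_sub_inv_add_one hpos).summable.mul_left 2) fun n => ?_
    have h1 := sq_norm_add_natCast_ge hw n n.cast_nonneg
    have h2 := sq_norm_add_natCast_ge hw (n + 1 : ℝ) (by positivity)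
    push_cast at h1 h2
    rw [← add_assoc] at h2
    have h3 : 0 < ‖w‖ + n := by positivity
    rw [norm_div, norm_one, norm_mul, div_sub_div _ _ h3.ne' (by positivity), ← mul_div_assoc]
    have h4 : (‖w‖ + n) * (‖w‖ + (n + 1)) ≤ 2 * (‖w + n‖ * ‖w + n + 1‖) := by
      rw [← ofReal_natCast]
      refine abs_le_of_sq_le_sq' ?_ (by positivity) |>.2
      have := mul_le_mul h1 h2 (by positivity) (by positivity)
      rw [← add_assoc (w : ℂ)] at this
      push_cast at this ⊢
      nlinarith
    have h5 : 0 < ‖w + n‖ * ‖w + n + 1‖ := by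
      have : 0 < (‖w‖ + n) * (‖w‖ + (n + 1)) := by positivity
      linarith
    rw [div_le_div_iff₀ h5 (by positivity)]
    nlinarith
  have h1 := hs.hasSum.tendsto_sum_nat
  have h2 : ∀ N : ℕ, ∑ n ∈ Finset.range N, 1 / ((w + n) * (w + n + 1)) = 1 / w - 1 / (w + N) := by
    intro N
    have := Finset.sum_range_sub' (fun n : ℕ => 1 / (w + n)) N
    simp only [Nat.cast_zero, add_zero] at this
    rw [← this]
    refine Finset.sum_congr rfl fun n _ => ?_
    have a1 := add_natCast_ne_zero hw hw0 n
    have a2 := add_natCast_ne_zero hw hw0 (n + 1)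
    push_cast at a2 ⊢
    rw [← add_assoc] at a2 ⊢
    field_simp
    ring
  have h3 : Tendsto (fun N : ℕ => 1 / w - 1 / (w + N)) atTop (𝓝 (1 / w)) := by
    have : Tendsto (fun N : ℕ => 1 / (w + N)) atTop (𝓝 0) := by
      simp only [one_div]
      refine tendsto_inv₀_cobounded.comp ?_
      rw [← tendsto_norm_atTop_iff_cobounded]
      refine tendsto_atTop_mono (fun N => ?_)
        (tendsto_atTop_add_const_right atTop (-‖w‖) (tendsto_natCast_atTop_atTop (R := ℝ)))
      have := norm_sub_le (w + N) w
      rw [add_sub_cancel_left, Complex.norm_natCast] at this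
      linarith
    simpa using this.const_sub (1 / w)
  rw [← tendsto_nhds_unique (h1.congr h2) h3]
  exact hs.hasSum

lemma cardSine_add_natCast_sq {w : ℂ} (hw : 0 ≤ w.re) (hw0 : w ≠ 0) (n : ℕ) :
    cardSine (w + n) ^ 2 = (Complex.sin (Real.pi * w) / Real.pi) ^ 2 / (w + n) ^ 2 := by
  have h := mul_cardSine (w + n)
  have hn := add_natCast_ne_zero hw hw0 n
  have h2 : Complex.sin (Real.pi * (w + n)) ^ 2 = Complex.sin (Real.pi * w) ^ 2 := by
    rw [mul_add, mul_comm (Real.pi : ℂ) (n : ℂ), Complex.sin_antiperiodic.add_nat_mul_eq, mul_pow,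
      ← pow_mul, mul_comm n 2, pow_mul]
    simp
  rw [eq_div_iff (pow_ne_zero 2 hn), ← mul_pow, mul_comm, h, div_pow, div_pow, h2]

lemma hasSum_cardSineTail {w : ℂ} (hw : 0 ≤ w.re) (hw0 : w ≠ 0) :
    HasSum (fun n : ℕ => (Complex.sin (Real.pi * w) / Real.pi) ^ 2 * (1 / (w + n + 1) ^ 2))
      (cardSineTail w) := by
  refine (summable_cardSine_add_sq w).hasSum.congr_fun fun n => ?_
  have := cardSine_add_natCast_sq hw hw0 (n + 1)
  push_cast at this
  rw [this, ← add_assoc]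
  ring

lemma sin_mul_cardSine {w : ℂ} (hw0 : w ≠ 0) : Complex.sin (Real.pi * w) / Real.pi * cardSine w =
    (Complex.sin (Real.pi * w) / Real.pi) ^ 2 * (1 / w) := by
  rw [← mul_cardSine]
  field_simp

/-- Here `beurling w - 1` is `2 (sin (π w) / π)²` times `1/w - ∑ 1/(w+n+1)²`. Expanding `1/w` as a
telescoping series, the difference has terms `1/((w+n)(w+n+1)²)`, whose sum is `O(‖w‖⁻²)` because
`‖w+n+1‖` is comparable with `‖w‖+n+1` when `Re w ≥ 0`. -/
lemma norm_beurling_sub_one_le {w : ℂ} (hw : 0 ≤ w.re) (hw0 : w ≠ 0) :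
    ‖beurling w - 1‖ ≤ Real.exp (2 * Real.pi * |w.im|) / ‖w‖ ^ 2 := by
  have hpos : 0 < ‖w‖ := norm_pos_iff.mpr hw0
  set s := Complex.sin (Real.pi * w) / Real.pi with hs
  have h1 := ((hasSum_inv_mul_inv hw hw0).mul_left (s ^ 2)).sub (hasSum_cardSineTail hw hw0)
  rw [← sin_mul_cardSine hw0] at h1
  have h2 : ‖Complex.sin (Real.pi * w) / Real.pi * cardSine w - cardSineTail w‖ ≤
      ‖s‖ ^ 2 * (2 / ‖w‖ * (1 / ‖w‖)) := by
    refine h1.norm_le_of_bounded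
      (((hasSum_inv_add_sub_inv_add_one hpos).mul_left (2 / ‖w‖)).mul_left (‖s‖ ^ 2)) fun n => ?_
    have a1 := add_natCast_ne_zero hw hw0 n
    have a2 := add_natCast_ne_zero hw hw0 (n + 1)
    push_cast at a2
    rw [← add_assoc] at a2
    have e : s ^ 2 * (1 / ((w + n) * (w + n + 1))) - s ^ 2 * (1 / (w + n + 1) ^ 2) =
        s ^ 2 * (1 / ((w + n) * (w + n + 1) ^ 2)) := by
      field_simp
      ring
    rw [e, norm_mul (s ^ 2), norm_pow, one_div, norm_inv, norm_mul, norm_pow, ← one_div]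
    refine mul_le_mul_of_nonneg_left ?_ (by positivity)
    have h3 := sq_norm_add_natCast_ge hw (n + 1 : ℝ) (by positivity)
    push_cast at h3
    simp only [← add_assoc] at h3
    have h4 : ‖w‖ ≤ ‖w + n‖ := by
      rw [Complex.norm_def, Complex.norm_def]
      apply Real.sqrt_le_sqrt
      rw [normSq_apply, normSq_apply]
      simp
      nlinarith [(n.cast_nonneg : (0 : ℝ) ≤ n)]
    have h5 : 0 < ‖w‖ + n := by positivity
    rw [div_sub_div _ _ h5.ne' (by positivity), div_mul_div_comm,
      div_le_div_iff₀ (by positivity) (by positivity)]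
    have h6 : (‖w‖ + n) * (‖w‖ + n + 1) ≤ 2 * ‖w + n + 1‖ ^ 2 := by
      have : (0 : ℝ) ≤ n := n.cast_nonneg
      nlinarith
    calc 1 * (‖w‖ * ((‖w‖ + n) * (‖w‖ + n + 1))) ≤ 1 * (‖w + n‖ * (2 * ‖w + n + 1‖ ^ 2)) := by
          gcongr
      _ = _ := by ring
  have h7 : ‖s‖ ≤ Real.exp (Real.pi * |w.im|) / Real.pi := by
    rw [hs, norm_div, norm_real, Real.norm_of_nonneg Real.pi_pos.le]
    gcongr
    have := Complex.norm_sin_le_exp_abs_im (Real.pi * w)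
    simpa [abs_mul, abs_of_pos Real.pi_pos] using this
  have h8 : Real.exp (Real.pi * |w.im|) / Real.pi ≤ Real.exp (Real.pi * |w.im|) / 2 := by
    gcongr
    exact Real.two_le_pi
  have h9 : ‖s‖ ^ 2 ≤ Real.exp (2 * Real.pi * |w.im|) / 4 := by
    calc ‖s‖ ^ 2 ≤ (Real.exp (Real.pi * |w.im|) / 2) ^ 2 := by
          gcongr
          exact h7.trans h8
      _ = _ := by
          rw [div_pow, ← Real.exp_nat_mul]
          norm_num
          ring_nf
  rw [beurling, add_sub_cancel_left, norm_mul, Complex.norm_ofNat]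
  calc 2 * ‖Complex.sin (Real.pi * w) / Real.pi * cardSine w - cardSineTail w‖
      ≤ 2 * ((Real.exp (2 * Real.pi * |w.im|) / 4) * (2 / ‖w‖ * (1 / ‖w‖))) := by
        gcongr
        exact h2.trans (by gcongr)
    _ = _ := by field_simp; norm_num

lemma norm_two_mul_cardSine_sq_le {w : ℂ} (hw0 : w ≠ 0) :
    ‖2 * cardSine w ^ 2‖ ≤ Real.exp (2 * Real.pi * |w.im|) / ‖w‖ ^ 2 := by
  have hpos : 0 < ‖w‖ := norm_pos_iff.mpr hw0
  have h1 : ‖w‖ * ‖cardSine w‖ ≤ Real.exp (Real.pi * |w.im|) / 2 := by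
    rw [← norm_mul, mul_cardSine, norm_div, norm_real, Real.norm_of_nonneg Real.pi_pos.le]
    gcongr
    · have := Complex.norm_sin_le_exp_abs_im (Real.pi * w)
      simpa [abs_mul, abs_of_pos Real.pi_pos] using this
    · exact Real.two_le_pi
  rw [norm_mul, norm_pow, Complex.norm_ofNat, le_div_iff₀ (by positivity)]
  have h2 : (‖w‖ * ‖cardSine w‖) ^ 2 ≤ (Real.exp (Real.pi * |w.im|) / 2) ^ 2 := by gcongr
  have h3 : (Real.exp (Real.pi * |w.im|)) ^ 2 = Real.exp (2 * Real.pi * |w.im|) := by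
    rw [← Real.exp_nat_mul]
    push_cast
    ring_nf
  rw [div_pow, h3] at h2
  nlinarith [Real.exp_pos (2 * Real.pi * |w.im|)]

lemma norm_beurling_add_one_le {w : ℂ} (hw : w.re ≤ 0) (hw0 : w ≠ 0) :
    ‖beurling w + 1‖ ≤ 2 * Real.exp (2 * Real.pi * |w.im|) / ‖w‖ ^ 2 := by
  have h1 := beurling_add_beurling_neg w
  have h2 := norm_beurling_sub_one_le (w := -w) (by simpa using hw) (neg_ne_zero.mpr hw0)
  have h3 := norm_two_mul_cardSine_sq_le hw0
  rw [norm_neg, neg_im, abs_neg] at h2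
  have e : beurling w + 1 = 2 * cardSine w ^ 2 - (beurling (-w) - 1) := by
    linear_combination h1
  rw [e, mul_div_assoc, two_mul (Real.exp _ / _)]
  exact (norm_sub_le _ _).trans (add_le_add h3 h2)

/-- The restriction of Beurling's function to the real line. -/
noncomputable def beurlingReal (x : ℝ) : ℝ := (beurling x).re

lemma continuous_beurlingReal : Continuous beurlingReal :=
  continuous_re.comp (differentiable_beurling.continuous.comp continuous_ofReal)

lemma beurling_ofReal (x : ℝ) : beurling x = beurlingReal x := by
  have : beurling x = ((1 + 2 * (Real.sin (Real.pi * x) / Real.pi * Real.sinc (Real.pi * x) -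
      ∑' n : ℕ, Real.sinc (Real.pi * (x + (n + 1))) ^ 2) : ℝ) : ℂ) := by
    rw [beurling, cardSine_ofReal, cardSineTail_ofReal]
    push_cast
    rfl
  rw [beurlingReal, this, ofReal_re]

lemma beurlingReal_add_neg (x : ℝ) :
    beurlingReal x + beurlingReal (-x) = 2 * Real.sinc (Real.pi * x) ^ 2 := by
  have h := beurling_add_beurling_neg x
  rw [← ofReal_neg, beurling_ofReal, beurling_ofReal, cardSine_ofReal] at h
  exact_mod_cast h

/-- For `x > 0`, comparison with the telescoping series for `1/x` gives `∑_{n ≥ 1} (x+n)⁻² ≤ 1/x ≤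
∑_{n ≥ 0} (x+n)⁻²`; the two inequalities are the two bounds. -/
lemma one_le_beurlingReal {x : ℝ} (hx : 0 ≤ x) :
    1 ≤ beurlingReal x ∧ beurlingReal x ≤ 1 + 2 * Real.sinc (Real.pi * x) ^ 2 := by
  rcases hx.eq_or_lt with rfl | hx
  · have h : beurlingReal 0 = 1 := by
      have h1 := beurlingReal_add_neg 0
      simp at h1
      linarith
    simp [h]
  · have hx0 : (x : ℂ) ≠ 0 := ofReal_ne_zero.mpr hx.ne'
    have h1 := hasSum_cardSineTail (w := x) (by simpa using hx.le) hx0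
    have h2 := hasSum_inv_add_sub_inv_add_one hx
    set s := Real.sin (Real.pi * x) / Real.pi with hs
    have h3 : HasSum (fun n : ℕ => s ^ 2 * (1 / (x + n + 1) ^ 2)) (cardSineTail x).re := by
      have h4 := Complex.hasSum_re h1
      convert h4 using 1
      ext n
      rw [← ofReal_mul, ← ofReal_sin, ← ofReal_div, ← hs]
      norm_cast
    have hval : beurlingReal x = 1 + 2 * (s ^ 2 * (1 / x) - (cardSineTail x).re) := by
      rw [beurlingReal, beurling, sin_mul_cardSine hx0, ← ofReal_mul, ← ofReal_sin, ← ofReal_div,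
        ← hs]
      have : ((s : ℂ) ^ 2 * (1 / x)).re = s ^ 2 * (1 / x) := by norm_cast
      simp only [add_re, one_re, mul_re, re_ofNat, im_ofNat, zero_mul, sub_zero, sub_re] at this ⊢
      rw [this]
    have h5 := h2.mul_left (s ^ 2)
    have hsinc : Real.sinc (Real.pi * x) ^ 2 = s ^ 2 * (1 / x ^ 2) := by
      rw [Real.sinc_of_ne_zero (by positivity), hs]
      have := Real.pi_ne_zero
      field_simp
    have hlow : (cardSineTail x).re ≤ s ^ 2 * (1 / x) := by
      refine hasSum_le (fun n => ?_) h3 h5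
      refine mul_le_mul_of_nonneg_left ?_ (sq_nonneg s)
      have : 0 < x + n := by positivity
      rw [div_sub_div _ _ this.ne' (by positivity), div_le_div_iff₀ (by positivity) (by positivity)]
      nlinarith
    have hup : s ^ 2 * (1 / x) ≤ s ^ 2 * (1 / x ^ 2) + (cardSineTail x).re := by
      have h6 : HasSum (fun n : ℕ => s ^ 2 * (1 / (x + n) ^ 2))
          (s ^ 2 * (1 / x ^ 2) + (cardSineTail x).re) := by
        rw [← hasSum_nat_add_iff' 1]
        simpa [add_assoc] using h3
      refine hasSum_le (fun n => ?_) h5 h6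
      refine mul_le_mul_of_nonneg_left ?_ (sq_nonneg s)
      have : 0 < x + n := by positivity
      rw [div_sub_div _ _ this.ne' (by positivity), div_le_div_iff₀ (by positivity) (by positivity)]
      nlinarith
    constructor <;> linarith

lemma neg_one_le_beurlingReal {x : ℝ} (hx : x ≤ 0) :
    -1 ≤ beurlingReal x ∧ beurlingReal x ≤ -1 + 2 * Real.sinc (Real.pi * x) ^ 2 := by
  have h1 := beurlingReal_add_neg x
  have h2 := one_le_beurlingReal (x := -x) (by linarith)
  rw [mul_neg, Real.sinc_neg] at h2
  constructor <;> linarith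

/-- Twice the integral over `[0, N]` is folded onto the unit interval, one copy being reflected by
`x ↦ 1 - x`. The integrand becomes a partial sum of the partition of unity, hence at most `1`, and
no improper integral is needed. -/
lemma integral_sinc_sq_le {M : ℝ} (hM : 0 ≤ M) :
    ∫ x in (0 : ℝ)..M, 2 * Real.sinc (Real.pi * x) ^ 2 ≤ 1 := by
  set g : ℝ → ℝ := fun x => Real.sinc (Real.pi * x) ^ 2 with hg
  have hgc : Continuous g := by
    rw [hg]
    exact (Real.continuous_sinc.comp (continuous_const.mul continuous_id)).pow 2
  have hgi : ∀ a b : ℝ, IntervalIntegrable g MeasureTheory.volume a b :=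
    fun a b => hgc.intervalIntegrable a b
  have hgn : ∀ x, g (-x) = g x := fun x => by simp [hg, Real.sinc_neg]
  obtain ⟨N, hN⟩ := exists_nat_ge M
  have h1 : ∫ x in (0 : ℝ)..M, g x ≤ ∫ x in (0 : ℝ)..N, g x :=
    intervalIntegral.integral_mono_interval le_rfl hM hN
      (Eventually.of_forall fun x => sq_nonneg _) (hgi _ _)
  have h2 : ∫ x in (0 : ℝ)..N, g x = ∑ n ∈ Finset.range N, ∫ x in (0 : ℝ)..1, g (x + n) := by
    have := intervalIntegral.sum_integral_adjacent_intervals (f := g)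
      (μ := MeasureTheory.volume) (a := fun n : ℕ => (n : ℝ)) (n := N) fun k _ => hgi _ _
    rw [Nat.cast_zero] at this
    rw [← this]
    refine Finset.sum_congr rfl fun n _ => ?_
    rw [intervalIntegral.integral_comp_add_right]
    push_cast
    ring_nf
  have h3 : ∀ n : ℕ, ∫ x in (0 : ℝ)..1, g (x + n) = ∫ x in (0 : ℝ)..1, g (-x + (n + 1)) := by
    intro n
    have := intervalIntegral.integral_comp_sub_left (a := 0) (b := 1) (fun x => g (x + n)) 1
    rw [sub_self, sub_zero] at this
    rw [← this]
    congr 1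
    ext x
    ring_nf
  have hc1 : ∀ n : ℕ, Continuous fun x : ℝ => g (x + n) := fun n => by fun_prop
  have hc2 : ∀ n : ℕ, Continuous fun x : ℝ => g (-x + (n + 1)) := fun n => by fun_prop
  have h4 : 2 * ∫ x in (0 : ℝ)..N, g x =
      ∫ x in (0 : ℝ)..1, ∑ n ∈ Finset.range N, (g (x + n) + g (-x + (n + 1))) := by
    have hi : ∀ n ∈ Finset.range N, IntervalIntegrable
        (fun x : ℝ => g (x + n) + g (-x + (n + 1))) MeasureTheory.volume 0 1 :=
      fun n _ => ((hc1 n).add (hc2 n)).intervalIntegrable _ _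
    rw [intervalIntegral.integral_finsetSum hi, h2, Finset.mul_sum]
    refine Finset.sum_congr rfl fun n _ => ?_
    rw [intervalIntegral.integral_add ((hc1 n).intervalIntegrable _ _)
      ((hc2 n).intervalIntegrable _ _), ← h3 n]
    ring
  have h5 : ∫ x in (0 : ℝ)..1, ∑ n ∈ Finset.range N, (g (x + n) + g (-x + (n + 1))) ≤
      ∫ x in (0 : ℝ)..1, (1 : ℝ) := by
    refine intervalIntegral.integral_mono_on zero_le_one
      (Continuous.intervalIntegrable (continuous_finsetSum _ fun n _ => (hc1 n).add (hc2 n)) _ _)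
      (by simp) fun x _ => ?_
    rw [Finset.sum_add_distrib]
    have h6 := sinc_sq_add_tsum x
    have h7 : ∑ n ∈ Finset.range N, g (-x + (n + 1)) ≤
        ∑' n : ℕ, Real.sinc (Real.pi * (-x + (n + 1))) ^ 2 :=
      (summable_sinc_add_sq (-x)).sum_le_tsum _ fun n _ => sq_nonneg _
    have h8 : ∑ n ∈ Finset.range N, g (x + n) ≤
        g x + ∑' n : ℕ, Real.sinc (Real.pi * (x + (n + 1))) ^ 2 := by
      calc ∑ n ∈ Finset.range N, g (x + n) ≤ ∑ n ∈ Finset.range (N + 1), g (x + n) :=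
            Finset.sum_le_sum_of_subset_of_nonneg (Finset.range_mono N.le_succ)
              fun n _ _ => sq_nonneg _
        _ = g x + ∑ n ∈ Finset.range N, g (x + (n + 1)) := by
            rw [Finset.sum_range_succ', add_comm]
            simp
        _ ≤ _ := by
            gcongr
            exact (summable_sinc_add_sq x).sum_le_tsum _ fun n _ => sq_nonneg _
    have h9 : Real.sinc (Real.pi * x) ^ 2 = g x := rfl
    linarith
  rw [intervalIntegral.integral_const_mul]
  simp at h5
  linarith

/-- The excess over the sign function is nonnegative, and at `x` and `-x` together it equals `2
sinc² (πx)`. For the upper bound both ranges are enlarged to the longer one, so that the two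
excesses can be added. -/
lemma integral_beurlingReal_bounds {M₁ M₂ : ℝ} (h₁ : 0 ≤ M₁) (h₂ : 0 ≤ M₂) :
    M₂ - M₁ ≤ ∫ x in (-M₁)..M₂, beurlingReal x ∧
    ∫ x in (-M₁)..M₂, beurlingReal x ≤ M₂ - M₁ + 1 := by
  have hc := continuous_beurlingReal
  have hi : ∀ a b : ℝ, IntervalIntegrable beurlingReal MeasureTheory.volume a b :=
    fun a b => hc.intervalIntegrable a b
  have hcn : Continuous fun x => beurlingReal (-x) := by fun_prop
  have hsplit : ∫ x in (-M₁)..M₂, beurlingReal x =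
      (∫ x in (0 : ℝ)..M₂, (beurlingReal x - 1)) +
      (∫ x in (0 : ℝ)..M₁, (beurlingReal (-x) + 1)) + (M₂ - M₁) := by
    rw [intervalIntegral.integral_sub (hi _ _) (by simp),
      intervalIntegral.integral_add (hcn.intervalIntegrable _ _) (by simp),
      intervalIntegral.integral_comp_neg, ← intervalIntegral.integral_add_adjacent_intervals
        (hi (-M₁) 0) (hi 0 M₂)]
    simp
    ring
  have hp : ∀ x, 0 ≤ x → 0 ≤ beurlingReal x - 1 := fun x hx =>
    sub_nonneg.mpr (one_le_beurlingReal hx).1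
  have hn : ∀ x, 0 ≤ x → 0 ≤ beurlingReal (-x) + 1 := fun x hx => by
    have := (neg_one_le_beurlingReal (x := -x) (by linarith)).1
    linarith
  have hcp' : Continuous fun x => beurlingReal x - 1 := by fun_prop
  have hcn' : Continuous fun x => beurlingReal (-x) + 1 := by fun_prop
  constructor
  · have a1 : 0 ≤ ∫ x in (0 : ℝ)..M₂, (beurlingReal x - 1) :=
      intervalIntegral.integral_nonneg h₂ fun x hx => hp x hx.1
    have a2 : 0 ≤ ∫ x in (0 : ℝ)..M₁, (beurlingReal (-x) + 1) :=
      intervalIntegral.integral_nonneg h₁ fun x hx => hn x hx.1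
    linarith
  · set M := max M₁ M₂
    have hM : 0 ≤ M := h₁.trans (le_max_left _ _)
    have hae : ∀ f : ℝ → ℝ, (∀ x, 0 ≤ x → 0 ≤ f x) →
        0 ≤ᵐ[MeasureTheory.volume.restrict (Set.Ioc 0 M)] f := fun f hf => by
      filter_upwards [MeasureTheory.ae_restrict_mem measurableSet_Ioc] with x hx
      exact hf x hx.1.le
    have a1 := intervalIntegral.integral_mono_interval le_rfl h₂ (le_max_right M₁ M₂)
      (hae _ hp) (hcp'.intervalIntegrable 0 M)
    have a2 := intervalIntegral.integral_mono_interval le_rfl h₁ (le_max_left M₁ M₂)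
      (hae _ hn) (hcn'.intervalIntegrable 0 M)
    have a3 : (∫ x in (0 : ℝ)..M, (beurlingReal x - 1)) +
        (∫ x in (0 : ℝ)..M, (beurlingReal (-x) + 1)) =
        ∫ x in (0 : ℝ)..M, 2 * Real.sinc (Real.pi * x) ^ 2 := by
      rw [← intervalIntegral.integral_add (hcp'.intervalIntegrable 0 M)
        (hcn'.intervalIntegrable 0 M)]
      congr 1
      ext x
      rw [← beurlingReal_add_neg]
      ring
    have a4 := integral_sinc_sq_le hM
    linarith

/-! ### `ζ'/ζ` to the right of `Re s = 1` -/

lemma LSeries.abscissaOfAbsConv_vonMangoldt_div_log_le :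
    LSeries.abscissaOfAbsConv
      (fun n : ℕ => ((ArithmeticFunction.vonMangoldt n / Real.log n : ℝ) : ℂ)) ≤ 1 := by
  refine LSeries.abscissaOfAbsConv_le_of_le_const ⟨1, fun n _ => ?_⟩
  rw [norm_real, Real.norm_eq_abs, abs_of_nonneg
    (div_nonneg ArithmeticFunction.vonMangoldt_nonneg (Real.log_natCast_nonneg n))]
  exact div_le_one_of_le₀ ArithmeticFunction.vonMangoldt_le_log (Real.log_natCast_nonneg n)

lemma LSeries.norm_le_of_re_eq {f : ℕ → ℂ} {σ : ℝ} (h : LSeriesSummable f σ) {s : ℂ}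
    (hs : s.re = σ) : ‖LSeries f s‖ ≤ ∑' n, ‖LSeries.term f σ n‖ := by
  have h1 : ∀ n, ‖LSeries.term f s n‖ = ‖LSeries.term f σ n‖ := fun n => by
    rw [LSeries.norm_term_eq, LSeries.norm_term_eq, hs, ofReal_re]
  have h2 : Summable fun n => ‖LSeries.term f σ n‖ := h.norm
  exact tsum_of_norm_bounded h2.hasSum fun n => (h1 n).le

lemma logDeriv_riemannZeta_eq_neg_LSeries {s : ℂ} (hs : 1 < s.re) :
    logDeriv riemannZeta s = -LSeries (fun n => (ArithmeticFunction.vonMangoldt n : ℂ)) s := by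
  rw [ArithmeticFunction.LSeries_vonMangoldt_eq_deriv_riemannZeta_div hs, logDeriv_apply, neg_div,
    neg_neg]

lemma exists_norm_logDeriv_riemannZeta_right_le {σ : ℝ} (hσ : 1 < σ) :
    ∃ C, 0 < C ∧ ∀ y : ℝ, ‖logDeriv riemannZeta (σ + y * I)‖ ≤ C := by
  have h : LSeriesSummable (fun n => (ArithmeticFunction.vonMangoldt n : ℂ)) σ :=
    ArithmeticFunction.LSeriesSummable_vonMangoldt (by simpa using hσ)
  refine ⟨∑' n, ‖LSeries.term (fun n => (ArithmeticFunction.vonMangoldt n : ℂ)) σ n‖ + 1,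
    add_pos_of_nonneg_of_pos (tsum_nonneg fun n => norm_nonneg _) one_pos, fun y => ?_⟩
  rw [logDeriv_riemannZeta_eq_neg_LSeries (by simpa using hσ), norm_neg]
  have := LSeries.norm_le_of_re_eq h (s := σ + y * I) (by simp)
  linarith

lemma continuous_logDeriv_riemannZeta_right {σ : ℝ} (hσ : 1 < σ) :
    Continuous fun y : ℝ => logDeriv riemannZeta (σ + y * I) := by
  rw [continuous_iff_continuousAt]
  intro y
  have hre : 1 < ((σ : ℂ) + y * I).re := by simpa using hσ
  have h1 : AnalyticAt ℂ riemannZeta (σ + y * I) :=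
    analyticOn_riemannZeta _ (by rintro h; rw [h] at hre; simp at hre)
  have h2 : ContinuousAt (logDeriv riemannZeta) (σ + y * I) :=
    (h1.deriv.continuousAt.div h1.continuousAt (riemannZeta_ne_zero_of_one_lt_re hre))
  exact h2.comp (f := fun y : ℝ => (σ : ℂ) + y * I) (by fun_prop)

/-- A primitive is the Dirichlet series with coefficients `Λ(n) / log n`, that is `log ζ`, bounded
on the line by absolute convergence. The bound does not grow with the length of the interval, which
makes the final estimate uniform in `h`. -/
lemma exists_norm_integral_logDeriv_riemannZeta_le {σ : ℝ} (hσ : 1 < σ) :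
    ∃ C, 0 < C ∧ ∀ u v : ℝ, ‖∫ y in u..v, logDeriv riemannZeta (σ + y * I)‖ ≤ C := by
  set f : ℕ → ℂ := fun n : ℕ => ((ArithmeticFunction.vonMangoldt n / Real.log n : ℝ) : ℂ) with hf
  have hlog : LSeries.logMul f = fun n => (ArithmeticFunction.vonMangoldt n : ℂ) := by
    ext n
    rw [LSeries.logMul, hf]
    rcases Nat.lt_or_ge 1 n with hn | hn
    · have : Real.log n ≠ 0 := (Real.log_pos (by exact_mod_cast hn)).ne'
      rw [← ofReal_natCast, ← ofReal_log n.cast_nonneg, ← ofReal_mul, mul_div_cancel₀ _ this]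
    · interval_cases n <;> simp
  have habs : ∀ s : ℂ, 1 < s.re → LSeries.abscissaOfAbsConv f < s.re := fun s hs =>
    LSeries.abscissaOfAbsConv_vonMangoldt_div_log_le.trans_lt (by exact_mod_cast hs)
  have hsum : LSeriesSummable f σ :=
    LSeriesSummable_of_abscissaOfAbsConv_lt_re (habs σ (by simpa using hσ))
  set K := ∑' n, ‖LSeries.term f σ n‖ with hK
  have hK0 : 0 ≤ K := tsum_nonneg fun n => norm_nonneg _
  refine ⟨2 * K + 1, by positivity, fun u v => ?_⟩
  have hderiv : ∀ y : ℝ, HasDerivAt (fun y : ℝ => -I * LSeries f (σ + y * I))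
      (logDeriv riemannZeta (σ + y * I)) y := by
    intro y
    have hre : 1 < ((σ : ℂ) + y * I).re := by simpa using hσ
    have h1 := LSeries_hasDerivAt (habs _ hre)
    rw [hlog, ← logDeriv_riemannZeta_eq_neg_LSeries hre] at h1
    have h2 : HasDerivAt (fun y : ℝ => (σ : ℂ) + y * I) I y := by
      have := ((hasDerivAt_id y).ofReal_comp.mul_const I).const_add (σ : ℂ)
      simpa using this
    have h3 := (h1.comp y h2).const_mul (-I)
    have h4 : -I * (logDeriv riemannZeta (σ + y * I) * I) = logDeriv riemannZeta (σ + y * I) := by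
      linear_combination (-logDeriv riemannZeta (σ + y * I)) * I_sq
    rwa [h4] at h3
  rw [intervalIntegral.integral_eq_sub_of_hasDerivAt (fun y _ => hderiv y)
    ((continuous_logDeriv_riemannZeta_right hσ).intervalIntegrable u v)]
  have hb : ∀ y : ℝ, ‖-I * LSeries f (σ + y * I)‖ ≤ K := fun y => by
    rw [norm_mul, norm_neg, norm_I, one_mul]
    exact LSeries.norm_le_of_re_eq hsum (by simp)
  have := norm_sub_le (-I * LSeries f (σ + v * I)) (-I * LSeries f (σ + u * I))
  linarith [hb u, hb v]

/-! ### Zeros in a window, and heights suitable for horizontal sides -/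

lemma RiemannHypothesis.finite_zeros (hRH : RiemannHypothesis) (T : ℝ) :
    {ρ : ℂ | riemannZeta ρ = 0 ∧ 0 < ρ.im ∧ ρ.im ≤ T}.Finite := by
  have hcomp : IsCompact (Set.Icc (1 / 2 : ℝ) (1 / 2) ×ℂ Set.Icc 0 T) :=
    isCompact_Icc.reProdIm isCompact_Icc
  refine hcomp.inter_riemannZetaZeros_finite.subset fun ρ hρ => ⟨?_, hρ.1⟩
  have hre := hRH.re_eq_half hρ.1 hρ.2.1
  exact ⟨⟨hre.ge, hre.le⟩, hρ.2.1.le, hρ.2.2⟩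

lemma RiemannHypothesis.exists_finset_zeros (hRH : RiemannHypothesis) {a : ℝ} (ha : 0 < a)
    (b : ℝ) : ∃ S : Finset ℂ, ∀ ρ, ρ ∈ S ↔ riemannZeta ρ = 0 ∧ a < ρ.im ∧ ρ.im < b := by
  have hfin : {ρ : ℂ | riemannZeta ρ = 0 ∧ a < ρ.im ∧ ρ.im < b}.Finite :=
    (hRH.finite_zeros b).subset fun ρ hρ => ⟨hρ.1, ha.trans hρ.2.1, hρ.2.2.le⟩
  exact ⟨hfin.toFinset, fun ρ => hfin.mem_toFinset⟩

lemma zetaZeroCount_sub_eq_sum (hRH : RiemannHypothesis) {a b t t' : ℝ} (ha : 0 < a) (hat : a ≤ t)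
    (htt : t ≤ t') (htb : t' < b) (S : Finset ℂ)
    (hS : ∀ ρ, ρ ∈ S ↔ riemannZeta ρ = 0 ∧ a < ρ.im ∧ ρ.im < b) :
    (zetaZeroCount t' : ℝ) - zetaZeroCount t = ∑ ρ ∈ S, (analyticOrderNatAt riemannZeta ρ : ℝ) *
      (if t < ρ.im ∧ ρ.im ≤ t' then 1 else 0) := by
  classical
  have h1 : ∀ T, zetaZeroCount T =
      ∑ ρ ∈ (hRH.finite_zeros T).toFinset, analyticOrderNatAt riemannZeta ρ := fun T =>
    finsum_mem_eq_finite_toFinset_sum _ (hRH.finite_zeros T)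
  have hsub : (hRH.finite_zeros t).toFinset ⊆ (hRH.finite_zeros t').toFinset := by
    intro ρ hρ
    rw [Set.Finite.mem_toFinset] at hρ ⊢
    exact ⟨hρ.1, hρ.2.1, hρ.2.2.trans htt⟩
  have h2 : (hRH.finite_zeros t').toFinset \ (hRH.finite_zeros t).toFinset =
      S.filter fun ρ => t < ρ.im ∧ ρ.im ≤ t' := by
    ext ρ
    simp only [Finset.mem_sdiff, Set.Finite.mem_toFinset, Set.mem_ofPred_eq, Finset.mem_filter, hS]
    constructor
    · rintro ⟨⟨h0, hp, hle⟩, hn⟩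
      have : t < ρ.im := by
        by_contra hlt
        exact hn ⟨h0, hp, not_lt.mp hlt⟩
      exact ⟨⟨h0, hat.trans_lt this, hle.trans_lt htb⟩, this, hle⟩
    · rintro ⟨⟨h0, hp, hlt⟩, h3, h4⟩
      exact ⟨⟨h0, ha.trans hp, h4⟩, fun h => absurd h.2.2 (not_le.mpr h3)⟩
  have h3 := Finset.sum_sdiff (f := analyticOrderNatAt riemannZeta) hsub
  rw [h2, ← h1, ← h1] at h3
  rw [← h3]
  push_cast
  rw [add_sub_cancel_right, Finset.sum_filter]
  exact Finset.sum_congr rfl fun ρ _ => by simp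

lemma Real.log_pow_three_le {x : ℝ} (hx : 1 ≤ x) : Real.log x ^ 3 ≤ 27 * x := by
  have h1 := Real.log_le_rpow_div (x := x) (by linarith) (ε := 1 / 3) (by norm_num)
  have h2 : (x ^ (1 / 3 : ℝ)) ^ 3 = x := by
    rw [← Real.rpow_natCast, ← Real.rpow_mul (by linarith)]
    norm_num
  calc Real.log x ^ 3 ≤ (x ^ (1 / 3 : ℝ) / (1 / 3)) ^ 3 :=
        pow_le_pow_left₀ (Real.log_nonneg hx) h1 3
    _ = 27 * x := by rw [div_pow, h2]; norm_num; ring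

/-- A height at distance `c / log T` from all ordinates gives a bound of order `log³`. It is
weakened to a linear one, which the quadratic decay of the weights still absorbs. -/
lemma exists_height_norm_logDeriv_riemannZeta_le (hRH : RiemannHypothesis) :
    ∃ C, 0 < C ∧ ∀ T, 3 ≤ T → ∃ A ∈ Set.Icc T (T + 1), ¬IsZetaOrdinate A ∧
      ∀ σ ∈ Set.Icc (1 / 2 : ℝ) (3 / 2), ‖logDeriv riemannZeta (σ + A * I)‖ ≤ C * A := by
  obtain ⟨c, hc0, hc1, hc⟩ := exists_height_far_from_zeros hRH
  obtain ⟨C, hC0, hC⟩ := exists_norm_logDeriv_riemannZeta_le hRH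
  refine ⟨C * 27 / c ^ 2, by positivity, fun T hT => ?_⟩
  obtain ⟨A, hA, hfar⟩ := hc T hT
  have hlogT : 1 ≤ Real.log T := by
    rw [Real.le_log_iff_exp_le (by linarith)]
    linarith [Real.exp_one_lt_d9]
  have hlogA : Real.log T ≤ Real.log A := Real.log_le_log (by linarith) hA.1
  have hd0 : 0 < c / Real.log T := by positivity
  refine ⟨A, hA, ?_, fun σ hσ => ?_⟩
  · rintro ⟨ρ, h0, h1⟩
    have := hfar ρ h0
    rw [h1, sub_self, abs_zero] at this
    linarith
  · have h1 := hC A (hT.trans hA.1) (c / Real.log T) hd0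
      ((div_le_self hc0.le hlogT).trans (hc1.trans (by norm_num))) hfar σ hσ
    refine h1.trans ?_
    have h2 : C * Real.log A / (c / Real.log T) ^ 2 =
        C / c ^ 2 * (Real.log A * Real.log T ^ 2) := by
      field_simp
    have h3 : Real.log A * Real.log T ^ 2 ≤ 27 * A :=
      calc Real.log A * Real.log T ^ 2 ≤ Real.log A * Real.log A ^ 2 := by gcongr; linarith
        _ = Real.log A ^ 3 := by ring
        _ ≤ _ := Real.log_pow_three_le (by linarith [hA.1])
    rw [h2]
    calc C / c ^ 2 * (Real.log A * Real.log T ^ 2) ≤ C / c ^ 2 * (27 * A) := by gcongr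
      _ = _ := by ring

/-! ### Entire approximations of an interval and the integrals over the three sides -/

/-- `E` is an entire function, equal to `e` on the real line, which approximates the sign of the
real part and has exponential type `2π`. -/
structure IsSignApprox (E : ℂ → ℂ) (e : ℝ → ℝ) : Prop where
  differentiable : Differentiable ℂ E
  ofReal (x : ℝ) : E x = e x
  norm_sub_one_le (w : ℂ) (hw : 0 ≤ w.re) (hw0 : w ≠ 0) :
    ‖E w - 1‖ ≤ 2 * Real.exp (2 * Real.pi * |w.im|) / ‖w‖ ^ 2
  norm_add_one_le (w : ℂ) (hw : w.re ≤ 0) (hw0 : w ≠ 0) :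
    ‖E w + 1‖ ≤ 2 * Real.exp (2 * Real.pi * |w.im|) / ‖w‖ ^ 2
  abs_le (x : ℝ) : |e x| ≤ 3

lemma isSignApprox_beurling : IsSignApprox beurling beurlingReal where
  differentiable := differentiable_beurling
  ofReal := beurling_ofReal
  norm_sub_one_le w hw hw0 := (norm_beurling_sub_one_le hw hw0).trans (by
    rw [mul_div_assoc]
    have : 0 ≤ Real.exp (2 * Real.pi * |w.im|) / ‖w‖ ^ 2 := by positivity
    linarith)
  norm_add_one_le w hw hw0 := norm_beurling_add_one_le hw hw0
  abs_le x := by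
    have h1 : Real.sinc (Real.pi * x) ^ 2 ≤ 1 := (sq_le_one_iff_abs_le_one _).mpr
      (Real.abs_sinc_le_one _)
    rw [_root_.abs_le]
    rcases le_total 0 x with hx | hx
    · have := one_le_beurlingReal hx
      constructor <;> linarith
    · have := neg_one_le_beurlingReal hx
      constructor <;> linarith

/-- The reflection turns the majorant of the sign into a minorant, so both one-sided estimates
follow from the same analysis. -/
lemma IsSignApprox.neg {E : ℂ → ℂ} {e : ℝ → ℝ} (hE : IsSignApprox E e) :
    IsSignApprox (fun z => -E (-z)) (fun x => -e (-x)) where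
  differentiable := (hE.differentiable.comp differentiable_neg).neg
  ofReal x := by rw [← ofReal_neg, hE.ofReal, ofReal_neg]
  norm_sub_one_le w hw hw0 := by
    have := hE.norm_add_one_le (-w) (by simpa using hw) (neg_ne_zero.mpr hw0)
    rw [norm_neg, neg_im, abs_neg] at this
    rwa [← norm_neg, neg_sub, sub_neg_eq_add, add_comm]
  norm_add_one_le w hw hw0 := by
    have := hE.norm_sub_one_le (-w) (by simpa using hw) (neg_ne_zero.mpr hw0)
    rw [norm_neg, neg_im, abs_neg] at this
    rwa [← norm_neg, neg_add, neg_neg, ← sub_eq_add_neg]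
  abs_le x := by rw [abs_neg]; exact hE.abs_le _

/-- The entire approximation of the indicator function of `[t, t + h]` attached to an approximation
`E` of the sign function. -/
noncomputable def intervalApprox (E : ℂ → ℂ) (D t h : ℝ) (z : ℂ) : ℂ :=
  (E (D * (z - t)) + E (D * (t + h - z))) / 2

lemma IsSignApprox.differentiable_intervalApprox {E : ℂ → ℂ} {e : ℝ → ℝ} (hE : IsSignApprox E e)
    {D t h : ℝ} :
    Differentiable ℂ (intervalApprox E D t h) := by
  have := hE.differentiable
  unfold intervalApprox
  fun_prop

lemma IsSignApprox.continuous {E : ℂ → ℂ} {e : ℝ → ℝ} (hE : IsSignApprox E e) :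
    Continuous e := by
  have h1 : e = fun x : ℝ => (E x).re := by
    ext x
    rw [hE.ofReal, ofReal_re]
  rw [h1]
  exact continuous_re.comp (hE.differentiable.continuous.comp continuous_ofReal)

lemma IsSignApprox.intervalApprox_ofReal {E : ℂ → ℂ} {e : ℝ → ℝ} (hE : IsSignApprox E e)
    {D t h : ℝ} (y : ℝ) :
    intervalApprox E D t h y = ((e (D * (y - t)) + e (D * (t + h - y))) / 2 : ℝ) := by
  have h1 : (D : ℂ) * (y - t) = ((D * (y - t) : ℝ) : ℂ) := by push_cast; rfl
  have h2 : (D : ℂ) * (t + h - y) = ((D * (t + h - y) : ℝ) : ℂ) := by push_cast; rfl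
  rw [intervalApprox, h1, h2, hE.ofReal, hE.ofReal]
  push_cast
  rfl

lemma IsSignApprox.norm_mul_sub_one_le {E : ℂ → ℂ} {e : ℝ → ℝ} (hE : IsSignApprox E e)
    {D : ℝ} (hD : 1 ≤ D) {w : ℂ} (hw : 0 ≤ w.re) (hw0 : w ≠ 0) :
    ‖E (D * w) - 1‖ ≤ 2 * (Real.exp (2 * Real.pi * D * |w.im|) * (1 / ‖w‖ ^ 2)) := by
  have hD0 : 0 < D := by linarith
  have h1 := hE.norm_sub_one_le (D * w) (by simpa using mul_nonneg hD0.le hw)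
    (mul_ne_zero (ofReal_ne_zero.mpr hD0.ne') hw0)
  rw [im_ofReal_mul, abs_mul, abs_of_pos hD0, norm_mul, norm_real, Real.norm_of_nonneg hD0.le,
    ← mul_assoc (2 * Real.pi)] at h1
  refine h1.trans ?_
  have h2 : 0 < ‖w‖ := norm_pos_iff.mpr hw0
  rw [mul_div_assoc, mul_one_div]
  gcongr
  nlinarith

lemma IsSignApprox.norm_mul_add_one_le {E : ℂ → ℂ} {e : ℝ → ℝ} (hE : IsSignApprox E e)
    {D : ℝ} (hD : 1 ≤ D) {w : ℂ} (hw : w.re ≤ 0) (hw0 : w ≠ 0) :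
    ‖E (D * w) + 1‖ ≤ 2 * (Real.exp (2 * Real.pi * D * |w.im|) * (1 / ‖w‖ ^ 2)) := by
  have h1 := hE.neg.norm_mul_sub_one_le (w := -w) hD (by simpa using hw) (neg_ne_zero.mpr hw0)
  rw [mul_neg, neg_neg, norm_neg, neg_im, abs_neg] at h1
  rwa [← norm_neg, neg_add, ← sub_eq_add_neg]

/-- Outside the strip over the interval the two sign approximations are close to opposite values
`±1` and cancel; inside, both are close to `1`. -/
lemma IsSignApprox.norm_intervalApprox_le {E : ℂ → ℂ} {e : ℝ → ℝ} (hE : IsSignApprox E e)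
    {D t h : ℝ} (hD : 1 ≤ D) (hh : 0 ≤ h) {z : ℂ}
    (hz : z.re ≤ t ∨ t + h ≤ z.re) (h0 : z - t ≠ 0) (h1 : t + h - z ≠ 0) :
    ‖intervalApprox E D t h z‖ ≤ Real.exp (2 * Real.pi * D * |z.im|) *
      (1 / ‖z - t‖ ^ 2 + 1 / ‖t + h - z‖ ^ 2) := by
  have e1 : (z - t).im = z.im := by simp
  have e2 : |(t + h - z).im| = |z.im| := by simp
  rcases hz with hz | hz
  · have a1 := hE.norm_mul_add_one_le hD (w := z - t) (by simpa using hz) h0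
    have a2 := hE.norm_mul_sub_one_le hD (w := t + h - z) (by simp; linarith) h1
    rw [e1] at a1
    rw [e2] at a2
    have e3 : intervalApprox E D t h z =
        ((E (D * (z - t)) + 1) + (E (D * (t + h - z)) - 1)) / 2 := by
      rw [intervalApprox]; ring
    have := norm_add_le (E (D * (z - t)) + 1) (E (D * (t + h - z)) - 1)
    rw [e3, norm_div, Complex.norm_ofNat]
    linarith
  · have a1 := hE.norm_mul_sub_one_le hD (w := z - t) (by simp; linarith) h0
    have a2 := hE.norm_mul_add_one_le hD (w := t + h - z) (by simp; linarith) h1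
    rw [e1] at a1
    rw [e2] at a2
    have e3 : intervalApprox E D t h z =
        ((E (D * (z - t)) - 1) + (E (D * (t + h - z)) + 1)) / 2 := by
      rw [intervalApprox]; ring
    have := norm_add_le (E (D * (z - t)) - 1) (E (D * (t + h - z)) + 1)
    rw [e3, norm_div, Complex.norm_ofNat]
    linarith

lemma IsSignApprox.norm_intervalApprox_sub_one_le {E : ℂ → ℂ} {e : ℝ → ℝ} (hE : IsSignApprox E e)
    {D t h : ℝ} (hD : 1 ≤ D) {z : ℂ}
    (hz : t ≤ z.re) (hz' : z.re ≤ t + h) (h0 : z - t ≠ 0) (h1 : t + h - z ≠ 0) :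
    ‖intervalApprox E D t h z - 1‖ ≤ Real.exp (2 * Real.pi * D * |z.im|) *
      (1 / ‖z - t‖ ^ 2 + 1 / ‖t + h - z‖ ^ 2) := by
  have e1 : (z - t).im = z.im := by simp
  have e2 : |(t + h - z).im| = |z.im| := by simp
  have a1 := hE.norm_mul_sub_one_le hD (w := z - t) (by simpa using hz) h0
  have a2 := hE.norm_mul_sub_one_le hD (w := t + h - z) (by simpa using hz') h1
  rw [e1] at a1
  rw [e2] at a2
  have e3 : intervalApprox E D t h z - 1 =
      ((E (D * (z - t)) - 1) + (E (D * (t + h - z)) - 1)) / 2 := by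
    rw [intervalApprox]; ring
  have := norm_add_le (E (D * (z - t)) - 1) (E (D * (t + h - z)) - 1)
  rw [e3, norm_div, Complex.norm_ofNat]
  linarith

lemma integral_inv_one_add_sq_sub_le (c : ℝ) {a b : ℝ} :
    ∫ y in a..b, 1 / (1 + (y - c) ^ 2) ≤ Real.pi := by
  rw [intervalIntegral.integral_comp_sub_right (fun y => 1 / (1 + y ^ 2)),
    integral_one_div_one_add_sq]
  linarith [Real.arctan_lt_pi_div_two (b - c), Real.neg_pi_div_two_lt_arctan (a - c)]

lemma norm_ofReal_sub_mul_I_ge {a : ℝ} (ha : 1 / 2 ≤ a) (x : ℝ) :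
    1 / ‖(x : ℂ) - a * I‖ ^ 2 ≤ 4 * (1 / (1 + x ^ 2)) ∧ (x : ℂ) - a * I ≠ 0 := by
  have h1 : ‖(x : ℂ) - a * I‖ ^ 2 = x ^ 2 + a ^ 2 := by
    rw [Complex.sq_norm, normSq_apply]
    simp
    ring
  constructor
  · rw [h1, mul_one_div, div_le_div_iff₀ (by positivity) (by positivity)]
    nlinarith [sq_nonneg x]
  · intro h
    have := congrArg im h
    simp at this
    linarith

/-- On the line `Im z = -a` the approximation is the indicator of `[t, t+h]` plus `O(e^{2πDa})`
times an integrable kernel. The indicator part is controlled by the bounded integral of `ψ`, not by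
its size, so the length `h` does not enter. -/
lemma IsSignApprox.norm_integral_intervalApprox_mul_le {E : ℂ → ℂ} {e : ℝ → ℝ}
    (hE : IsSignApprox E e) {D t h a A B C₁ C₂ : ℝ} (hD : 1 ≤ D) (hh : 0 ≤ h) (ha : 1 / 2 ≤ a)
    (hA : A ≤ t) (hB : t + h ≤ B) {ψ : ℝ → ℂ} (hψ : Continuous ψ) (hψ₁ : ∀ y, ‖ψ y‖ ≤ C₁)
    (hψ₂ : ‖∫ y in t..(t + h), ψ y‖ ≤ C₂) :
    ‖∫ y in A..B, intervalApprox E D t h (y - a * I) * ψ y‖ ≤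
      C₁ * Real.exp (2 * Real.pi * D * a) * (8 * Real.pi) + C₂ := by
  set M := Real.exp (2 * Real.pi * D * a) with hM
  have hC₁ : 0 ≤ C₁ := (norm_nonneg _).trans (hψ₁ 0)
  set F : ℝ → ℂ := fun y => intervalApprox E D t h (y - a * I) with hF
  have hFc : Continuous F :=
    hE.differentiable_intervalApprox.continuous.comp (by fun_prop)
  set g : ℝ → ℝ := fun y => C₁ * M *
    (4 * (1 / (1 + (y - t) ^ 2)) + 4 * (1 / (1 + (y - (t + h)) ^ 2))) with hg
  have hgc' : ∀ c : ℝ, Continuous fun y : ℝ => 4 * (1 / (1 + (y - c) ^ 2)) := fun c =>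
    continuous_const.mul (continuous_const.div (by fun_prop) fun y => by positivity)
  have hgc : Continuous g := continuous_const.mul ((hgc' t).add (hgc' (t + h)))
  have hgi : ∀ u v, IntervalIntegrable g MeasureTheory.volume u v :=
    fun u v => hgc.intervalIntegrable u v
  have hi : ∀ u v, IntervalIntegrable (fun y => F y * ψ y) MeasureTheory.volume u v :=
    fun u v => (hFc.mul hψ).intervalIntegrable u v
  have haux : ∀ y : ℝ, Real.exp (2 * Real.pi * D * |((y : ℂ) - a * I).im|) *
      (1 / ‖(y : ℂ) - a * I - t‖ ^ 2 + 1 / ‖t + h - ((y : ℂ) - a * I)‖ ^ 2) ≤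
      M * (4 * (1 / (1 + (y - t) ^ 2)) + 4 * (1 / (1 + (y - (t + h)) ^ 2))) ∧
      (y : ℂ) - a * I - t ≠ 0 ∧ t + h - ((y : ℂ) - a * I) ≠ 0 := by
    intro y
    have h1 := norm_ofReal_sub_mul_I_ge ha (y - t)
    have h2 := norm_ofReal_sub_mul_I_ge ha (y - (t + h))
    have e1 : (y : ℂ) - a * I - t = ((y - t : ℝ) : ℂ) - a * I := by push_cast; ring
    have e2 : t + h - ((y : ℂ) - a * I) = -(((y - (t + h) : ℝ) : ℂ) - a * I) := by push_cast; ring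
    have e3 : |((y : ℂ) - a * I).im| = a := by
      simp
      linarith
    rw [e1, e2, e3, norm_neg]
    exact ⟨mul_le_mul_of_nonneg_left (add_le_add h1.1 h2.1) (Real.exp_pos _).le, h1.2,
      neg_ne_zero.mpr h2.2⟩
  have hout : ∀ y, y ≤ t ∨ t + h ≤ y → ‖F y * ψ y‖ ≤ g y := by
    intro y hy
    obtain ⟨h1, h2, h3⟩ := haux y
    have h4 := hE.norm_intervalApprox_le hD hh (z := y - a * I) (by simpa using hy) h2 h3
    rw [norm_mul, hg]
    calc ‖F y‖ * ‖ψ y‖ ≤ (M * (4 * (1 / (1 + (y - t) ^ 2)) + 4 * (1 / (1 + (y - (t + h)) ^ 2)))) *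
          C₁ := mul_le_mul (h4.trans h1) (hψ₁ y) (norm_nonneg _) (by positivity)
      _ = _ := by ring
  have hin : ∀ y, t ≤ y → y ≤ t + h → ‖F y * ψ y - ψ y‖ ≤ g y := by
    intro y hy hy'
    obtain ⟨h1, h2, h3⟩ := haux y
    have h4 := hE.norm_intervalApprox_sub_one_le hD (z := y - a * I) (by simpa using hy)
      (by simpa using hy') h2 h3
    rw [← sub_one_mul, norm_mul, hg]
    calc ‖F y - 1‖ * ‖ψ y‖ ≤
        (M * (4 * (1 / (1 + (y - t) ^ 2)) + 4 * (1 / (1 + (y - (t + h)) ^ 2)))) *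
          C₁ := mul_le_mul (h4.trans h1) (hψ₁ y) (norm_nonneg _) (by positivity)
      _ = _ := by ring
  have hsplit : ∫ y in A..B, F y * ψ y = (∫ y in A..t, F y * ψ y) +
      ((∫ y in t..(t + h), (F y * ψ y - ψ y)) + ∫ y in t..(t + h), ψ y) +
      ∫ y in (t + h)..B, F y * ψ y := by
    rw [intervalIntegral.integral_sub (hi _ _) (hψ.intervalIntegrable _ _), sub_add_cancel,
      intervalIntegral.integral_add_adjacent_intervals (hi _ _) (hi _ _),
      intervalIntegral.integral_add_adjacent_intervals (hi _ _) (hi _ _)]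
  have b1 : ‖∫ y in A..t, F y * ψ y‖ ≤ ∫ y in A..t, g y :=
    intervalIntegral.norm_integral_le_of_norm_le hA
      (Eventually.of_forall fun y hy => hout y (Or.inl hy.2)) (hgi _ _)
  have b2 : ‖∫ y in t..(t + h), (F y * ψ y - ψ y)‖ ≤ ∫ y in t..(t + h), g y :=
    intervalIntegral.norm_integral_le_of_norm_le (by linarith)
      (Eventually.of_forall fun y hy => hin y hy.1.le hy.2) (hgi _ _)
  have b3 : ‖∫ y in (t + h)..B, F y * ψ y‖ ≤ ∫ y in (t + h)..B, g y :=
    intervalIntegral.norm_integral_le_of_norm_le hB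
      (Eventually.of_forall fun y hy => hout y (Or.inr hy.1.le)) (hgi _ _)
  have b4 : (∫ y in A..t, g y) + (∫ y in t..(t + h), g y) + (∫ y in (t + h)..B, g y) =
      ∫ y in A..B, g y := by
    rw [intervalIntegral.integral_add_adjacent_intervals (hgi _ _) (hgi _ _),
      intervalIntegral.integral_add_adjacent_intervals (hgi _ _) (hgi _ _)]
  have b5 : ∫ y in A..B, g y ≤ C₁ * M * (8 * Real.pi) := by
    rw [hg, intervalIntegral.integral_const_mul, intervalIntegral.integral_add
      ((hgc' t).intervalIntegrable _ _) ((hgc' (t + h)).intervalIntegrable _ _),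
      intervalIntegral.integral_const_mul, intervalIntegral.integral_const_mul]
    have c1 := integral_inv_one_add_sq_sub_le t (a := A) (b := B)
    have c2 := integral_inv_one_add_sq_sub_le (t + h) (a := A) (b := B)
    refine mul_le_mul_of_nonneg_left ?_ (by positivity)
    linarith
  have b6 := norm_add₃_le (a := ∫ y in A..t, F y * ψ y)
    (b := (∫ y in t..(t + h), (F y * ψ y - ψ y)) + ∫ y in t..(t + h), ψ y)
    (c := ∫ y in (t + h)..B, F y * ψ y)
  have b7 := norm_add_le (∫ y in t..(t + h), (F y * ψ y - ψ y)) (∫ y in t..(t + h), ψ y)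
  rw [hsplit]
  linarith

/-- The function `z ↦ F (z)` in the variable `s = 1/2 + i z`. -/
noncomputable def onCriticalLine (F : ℂ → ℂ) (s : ℂ) : ℂ := F (-I * (s - 1 / 2))

lemma onCriticalLine_apply (F : ℂ → ℂ) (x y : ℝ) :
    onCriticalLine F (x + y * I) = F (y - ((x - 1 / 2 : ℝ) : ℂ) * I) := by
  rw [onCriticalLine]
  congr 1
  push_cast
  linear_combination -(y : ℂ) * I_sq

/-- At distance at least `r` from `[t, t+h]` the approximation has a factor `r⁻²`, which cancels the
permitted growth `r²` of `ψ`. -/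
lemma IsSignApprox.norm_integral_horizontal_le {E : ℂ → ℂ} {e : ℝ → ℝ}
    (hE : IsSignApprox E e) {D t h σ A r : ℝ} (hD : 1 ≤ D) (hh : 0 ≤ h) (hσ : 1 / 2 ≤ σ)
    (hσ' : σ ≤ 3 / 2) (hr : 0 < r) (hA : A + r ≤ t ∨ t + h + r ≤ A) {ψ : ℝ → ℂ}
    (hψ : ∀ x ∈ Set.Icc (1 / 2 : ℝ) (3 / 2), ‖ψ x‖ ≤ r ^ 2) :
    ‖∫ x in (1 / 2 : ℝ)..σ, onCriticalLine (intervalApprox E D t h) (x + A * I) * ψ x‖ ≤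
      2 * Real.exp (2 * Real.pi * D * (σ - 1 / 2)) := by
  have h1 : ∀ x ∈ Set.uIoc (1 / 2 : ℝ) σ,
      ‖onCriticalLine (intervalApprox E D t h) (x + A * I) * ψ x‖ ≤
        2 * Real.exp (2 * Real.pi * D * (σ - 1 / 2)) := by
    intro x hx
    rw [Set.uIoc_of_le hσ] at hx
    rw [onCriticalLine_apply, norm_mul]
    set z : ℂ := (A : ℂ) - ((x - 1 / 2 : ℝ) : ℂ) * I with hz
    have hre : z.re = A := by simp [hz]
    have him : |z.im| = x - 1 / 2 := by
      simp [hz]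
      rw [abs_of_nonpos (by linarith [hx.1])]
      ring
    have n1 : r ≤ ‖z - t‖ := by
      refine le_trans ?_ (abs_re_le_norm _)
      rw [sub_re, hre, ofReal_re]
      rcases hA with h | h
      · rw [abs_of_nonpos] <;> linarith
      · rw [abs_of_nonneg] <;> linarith
    have n2 : r ≤ ‖t + h - z‖ := by
      refine le_trans ?_ (abs_re_le_norm _)
      rw [sub_re, hre, add_re, ofReal_re, ofReal_re]
      rcases hA with h | h
      · rw [abs_of_nonneg] <;> linarith
      · rw [abs_of_nonpos] <;> linarith
    have h2 := hE.norm_intervalApprox_le hD hh (z := z)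
      (by rw [hre]; rcases hA with h | h
          · left; linarith
          · right; linarith)
      (norm_pos_iff.mp (hr.trans_le n1)) (norm_pos_iff.mp (hr.trans_le n2))
    have h3 : ‖intervalApprox E D t h z‖ ≤
        Real.exp (2 * Real.pi * D * (σ - 1 / 2)) * (1 / r ^ 2 + 1 / r ^ 2) := by
      refine h2.trans ?_
      rw [him]
      gcongr
      exact hx.2
    calc ‖intervalApprox E D t h z‖ * ‖ψ x‖ ≤
        (Real.exp (2 * Real.pi * D * (σ - 1 / 2)) * (1 / r ^ 2 + 1 / r ^ 2)) * r ^ 2 :=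
          mul_le_mul h3 (hψ x ⟨hx.1.le, hx.2.trans hσ'⟩) (norm_nonneg _) (by positivity)
      _ = _ := by field_simp; ring
  refine (intervalIntegral.norm_integral_le_of_norm_le_const h1).trans ?_
  rw [abs_of_nonneg (by linarith)]
  have : σ - 1 / 2 ≤ 1 := by linarith
  have h0 := Real.exp_pos (2 * Real.pi * D * (σ - 1 / 2))
  nlinarith

/-- The weighted count of zeros is determined by the archimedean term, up to an error bounded in
terms of the exponential type of the weight. -/
lemma exists_abs_sum_intervalApprox_sub_integral_le (hRH : RiemannHypothesis) {σ : ℝ} (hσ : 1 < σ)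
    (hσ' : σ ≤ 3 / 2) : ∃ C, 0 < C ∧ ∀ {E : ℂ → ℂ} {e : ℝ → ℝ}, IsSignApprox E e →
    ∀ {D t h A B r : ℝ}, 1 ≤ D → 0 ≤ h → 0 < r → 0 < A → A + r ≤ t → t + h + r ≤ B →
    ¬IsZetaOrdinate A → ¬IsZetaOrdinate B →
    (∀ x ∈ Set.Icc (1 / 2 : ℝ) (3 / 2), ‖logDeriv riemannZeta (x + A * I)‖ ≤ r ^ 2) →
    (∀ x ∈ Set.Icc (1 / 2 : ℝ) (3 / 2), ‖logDeriv riemannZeta (x + B * I)‖ ≤ r ^ 2) →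
    ∀ S : Finset ℂ, (∀ ρ, ρ ∈ S ↔ riemannZeta ρ = 0 ∧ A < ρ.im ∧ ρ.im < B) →
    |Real.pi * ∑ ρ ∈ S, (analyticOrderNatAt riemannZeta ρ : ℝ) *
        ((e (D * (ρ.im - t)) + e (D * (t + h - ρ.im))) / 2) -
      ∫ y in A..B, (e (D * (y - t)) + e (D * (t + h - y))) / 2 * thetaDeriv y| ≤
      C * Real.exp (2 * Real.pi * D * (σ - 1 / 2)) := by
  obtain ⟨C₁, hC₁, hb₁⟩ := exists_norm_logDeriv_riemannZeta_right_le hσ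
  obtain ⟨C₂, hC₂, hb₂⟩ := exists_norm_integral_logDeriv_riemannZeta_le hσ
  refine ⟨4 + C₁ * (8 * Real.pi) + C₂, by positivity, ?_⟩
  intro E e hE D t h A B r hD hh hr hA hAt hBt hnA hnB hA' hB' S hS
  set F := intervalApprox E D t h with hF
  have hfd : Differentiable ℂ (onCriticalLine F) :=
    hE.differentiable_intervalApprox.comp (by fun_prop)
  have hline : ∀ y : ℝ, onCriticalLine F (1 / 2 + y * I) =
      ((e (D * (y - t)) + e (D * (t + h - y))) / 2 : ℝ) := by
    intro y
    have := onCriticalLine_apply F (1 / 2) y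
    rw [sub_self, ofReal_zero, zero_mul, sub_zero, hF, hE.intervalApprox_ofReal] at this
    rw [← this, hF]
    norm_num
  have hmain := im_sideIntegral_mul_logDeriv hRH (σ := σ) (by linarith) hA (by linarith) hnA hnB S
    hS hfd fun y => by rw [hline, ofReal_im]
  have hsum : ∑ ρ ∈ S, (analyticOrderNatAt riemannZeta ρ : ℝ) * (onCriticalLine F ρ).re =
      ∑ ρ ∈ S, (analyticOrderNatAt riemannZeta ρ : ℝ) *
        ((e (D * (ρ.im - t)) + e (D * (t + h - ρ.im))) / 2) := by
    refine Finset.sum_congr rfl fun ρ hρ => ?_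
    have h1 := (hS ρ).mp hρ
    have h2 : ρ = 1 / 2 + ρ.im * I := by
      apply Complex.ext
      · rw [hRH.re_eq_half h1.1 (hA.trans h1.2.1)]
        simp
      · simp
    have h3 := hline ρ.im
    rw [← h2] at h3
    rw [h3, ofReal_re]
  have hint : ∫ y in A..B, (onCriticalLine F (1 / 2 + y * I)).re * thetaDeriv y =
      ∫ y in A..B, (e (D * (y - t)) + e (D * (t + h - y))) / 2 * thetaDeriv y := by
    congr 1
    ext y
    rw [hline, ofReal_re]
  rw [hsum, hint] at hmain
  rw [← hmain]
  refine (abs_im_le_norm _).trans ?_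
  set M := Real.exp (2 * Real.pi * D * (σ - 1 / 2)) with hM
  have hM1 : 1 ≤ M := Real.one_le_exp (by
    have : 0 ≤ σ - 1 / 2 := by linarith
    positivity)
  have b1 := hE.norm_integral_horizontal_le hD hh (σ := σ) (by linarith) hσ' hr (Or.inl hAt) hA'
  have b2 := hE.norm_integral_horizontal_le hD hh (σ := σ) (by linarith) hσ' hr (Or.inr hBt) hB'
  have b3 := hE.norm_integral_intervalApprox_mul_le hD hh (a := σ - 1 / 2) (by linarith)
    (A := A) (B := B) (by linarith) (by linarith) (continuous_logDeriv_riemannZeta_right hσ) hb₁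
    (hb₂ t (t + h))
  rw [sideIntegral]
  have e1 : ∫ y in A..B, onCriticalLine F (σ + y * I) * logDeriv riemannZeta (σ + y * I) =
      ∫ y in A..B, F (y - ((σ - 1 / 2 : ℝ) : ℂ) * I) * logDeriv riemannZeta (σ + y * I) := by
    congr 1
    ext y
    rw [onCriticalLine_apply]
  rw [← e1] at b3
  refine (norm_sub_le _ _).trans ?_
  refine (add_le_add (norm_add_le _ _) le_rfl).trans ?_
  rw [norm_mul, norm_I, one_mul]
  nlinarith

/-! ### The archimedean integral -/

lemma abs_log_sub_log_le {t y : ℝ} (ht : 0 < t) (hy : t / 2 ≤ y) :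
    |Real.log y - Real.log t| ≤ 2 * |y - t| / t := by
  have hy0 : 0 < y := by linarith
  have h1 := Real.log_le_sub_one_of_pos (div_pos hy0 ht)
  have h2 := Real.log_le_sub_one_of_pos (div_pos ht hy0)
  rw [Real.log_div hy0.ne' ht.ne'] at h1
  rw [Real.log_div ht.ne' hy0.ne'] at h2
  have h3 : y / t - 1 ≤ 2 * |y - t| / t := by
    rw [div_sub_one ht.ne']
    gcongr
    linarith [le_abs_self (y - t), abs_nonneg (y - t)]
  have h4 : t / y - 1 ≤ 2 * |y - t| / t := by
    rw [div_sub_one hy0.ne', div_le_div_iff₀ hy0 ht]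
    have h5 : t - y ≤ |y - t| := by linarith [neg_abs_le (y - t)]
    have := abs_nonneg (y - t)
    calc (t - y) * t ≤ |y - t| * t := by gcongr
      _ ≤ |y - t| * (2 * y) := by gcongr; linarith
      _ = _ := by ring
  rw [abs_le]
  constructor <;> linarith

lemma abs_thetaDeriv_sub_le {t y : ℝ} (ht : 8 ≤ t) (hy : t / 2 ≤ y) :
    |thetaDeriv y - 1 / 2 * Real.log (t / (2 * Real.pi))| ≤ (10 + |y - t|) / t := by
  have hpi := Real.two_pi_pos.ne'
  have h1 := abs_thetaDeriv_sub_log_le (y := y) (by linarith)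
  have h2 := abs_log_sub_log_le (by linarith : 0 < t) hy
  have h3 : 5 / y ≤ 10 / t := by
    rw [div_le_div_iff₀ (by linarith) (by linarith)]
    linarith
  rw [Real.log_div (by linarith) hpi] at h1 ⊢
  have h4 : thetaDeriv y - 1 / 2 * (Real.log t - Real.log (2 * Real.pi)) =
      (thetaDeriv y - 1 / 2 * (Real.log y - Real.log (2 * Real.pi))) +
        1 / 2 * (Real.log y - Real.log t) := by ring
  rw [h4]
  refine (abs_add_le _ _).trans ?_
  rw [abs_mul, abs_of_pos (by norm_num : (0 : ℝ) < 1 / 2)]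
  have h5 : (10 + |y - t|) / t = 10 / t + 1 / 2 * (2 * |y - t| / t) := by ring
  rw [h5]
  linarith

/-- Within `3√t` of `t` the weight is bounded and `θ'` differs from the constant by `O(1/√t)`.
Farther away the difference is only bounded, but the weight is `O(1/t)` on a range of length `O(t)`.
Each range contributes `O(1)`. -/
lemma IsSignApprox.abs_integral_mul_thetaDeriv_sub_le {E : ℂ → ℂ} {e : ℝ → ℝ}
    (hE : IsSignApprox E e) {D t h A B : ℝ} (hD : 1 ≤ D) (ht : 64 ≤ t) (hh : 0 ≤ h)
    (hht : h ≤ 2 * Real.sqrt t) (hA : A ∈ Set.Icc (t / 2) (t / 2 + 1))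
    (hB : B ∈ Set.Icc (3 * t) (3 * t + 1)) :
    |(∫ y in A..B, (e (D * (y - t)) + e (D * (t + h - y))) / 2 * thetaDeriv y) -
      1 / 2 * Real.log (t / (2 * Real.pi)) *
        ∫ y in A..B, (e (D * (y - t)) + e (D * (t + h - y))) / 2| ≤ 314 := by
  obtain ⟨hA₁, hA₂⟩ := hA
  obtain ⟨hB₁, hB₂⟩ := hB
  set L := 1 / 2 * Real.log (t / (2 * Real.pi)) with hL
  set φ : ℝ → ℝ := fun y => (e (D * (y - t)) + e (D * (t + h - y))) / 2 with hφ
  set r := Real.sqrt t with hr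
  have hr2 : r ^ 2 = t := Real.sq_sqrt (by linarith)
  have hr8 : 8 ≤ r := by
    rw [hr, Real.le_sqrt' (by norm_num)]
    linarith
  have hec := hE.continuous
  have hφc : Continuous φ := by rw [hφ]; fun_prop
  have hgc : Continuous fun y => φ y * (thetaDeriv y - L) :=
    hφc.mul (continuous_thetaDeriv.sub continuous_const)
  have hgi : ∀ u v, IntervalIntegrable (fun y => φ y * (thetaDeriv y - L))
      MeasureTheory.volume u v := fun u v => hgc.intervalIntegrable u v
  have e1 : (∫ y in A..B, φ y * thetaDeriv y) - L * ∫ y in A..B, φ y =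
      ∫ y in A..B, φ y * (thetaDeriv y - L) := by
    have i1 : Continuous fun y => φ y * thetaDeriv y := hφc.mul continuous_thetaDeriv
    have i2 : Continuous fun y => L * φ y := continuous_const.mul hφc
    rw [← intervalIntegral.integral_const_mul, ← intervalIntegral.integral_sub
      (i1.intervalIntegrable _ _) (i2.intervalIntegrable _ _)]
    congr 1
    ext y
    ring
  have hφ3 : ∀ y, |φ y| ≤ 3 := fun y => by
    have h1 := hE.abs_le (D * (y - t))
    have h2 := hE.abs_le (D * (t + h - y))
    have h3 := abs_add_le (e (D * (y - t))) (e (D * (t + h - y)))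
    rw [hφ]
    dsimp only
    rw [abs_div, abs_two]
    linarith
  -- Since `h ≤ 2√t`, the cut at `3√t` leaves distance at least `√t` from both endpoints `t` and `t
  -- + h`.
  have hfar : ∀ y, y ≤ t - 3 * r ∨ t + 3 * r ≤ y → |φ y| ≤ 2 / t := by
    intro y hy
    have hφE : ‖intervalApprox E D t h y‖ = |φ y| := by
      rw [hE.intervalApprox_ofReal, norm_real, Real.norm_eq_abs]
    have n1 : r ≤ ‖(y : ℂ) - t‖ := by
      rw [← ofReal_sub, norm_real, Real.norm_eq_abs]
      rcases hy with hy | hy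
      · rw [abs_of_nonpos] <;> linarith
      · rw [abs_of_nonneg] <;> linarith
    have n2 : r ≤ ‖t + h - (y : ℂ)‖ := by
      rw [← ofReal_add, ← ofReal_sub, norm_real, Real.norm_eq_abs]
      rcases hy with hy | hy
      · rw [abs_of_nonneg] <;> linarith
      · rw [abs_of_nonpos] <;> linarith
    have h1 := hE.norm_intervalApprox_le hD hh (t := t) (z := y) (by
      rw [ofReal_re]
      rcases hy with hy | hy
      · left; linarith
      · right; linarith) (norm_pos_iff.mp (by linarith)) (norm_pos_iff.mp (by linarith))
    rw [hφE, ofReal_im, abs_zero, mul_zero, Real.exp_zero, one_mul] at h1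
    refine h1.trans ?_
    have h2 : 1 / ‖(y : ℂ) - t‖ ^ 2 ≤ 1 / t := by
      refine one_div_le_one_div_of_le (by linarith) ?_
      exact hr2.symm.le.trans (pow_le_pow_left₀ (by linarith) n1 2)
    have h3 : 1 / ‖t + h - (y : ℂ)‖ ^ 2 ≤ 1 / t := by
      refine one_div_le_one_div_of_le (by linarith) ?_
      exact hr2.symm.le.trans (pow_le_pow_left₀ (by linarith) n2 2)
    have h4 : 2 / t = 1 / t + 1 / t := by ring
    linarith
  have hout : ∀ y, t / 2 ≤ y → y ≤ 4 * t → y ≤ t - 3 * r ∨ t + 3 * r ≤ y →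
      ‖φ y * (thetaDeriv y - L)‖ ≤ 10 / t := by
    intro y hy hy' hy3
    rw [Real.norm_eq_abs, abs_mul]
    have h1 := abs_thetaDeriv_sub_le (by linarith) hy
    have h2 : (10 + |y - t|) / t ≤ 5 := by
      rw [div_le_iff₀ (by linarith)]
      have : |y - t| ≤ 3 * t := by
        rw [_root_.abs_le]
        constructor <;> linarith
      linarith
    calc |φ y| * |thetaDeriv y - L| ≤ 2 / t * 5 :=
          mul_le_mul (hfar y hy3) (h1.trans h2) (abs_nonneg _) (by positivity)
      _ = 10 / t := by ring
  have hin : ∀ y, t - 3 * r ≤ y → y ≤ t + 3 * r → ‖φ y * (thetaDeriv y - L)‖ ≤ 39 / r := by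
    intro y hy hy'
    rw [Real.norm_eq_abs, abs_mul]
    have h1 := abs_thetaDeriv_sub_le (t := t) (y := y) (by linarith) (by nlinarith)
    have h2 : (10 + |y - t|) / t ≤ 13 / r := by
      have h3 : |y - t| ≤ 3 * r := by
        rw [_root_.abs_le]
        constructor <;> linarith
      rw [div_le_div_iff₀ (by linarith) (by linarith)]
      calc (10 + |y - t|) * r ≤ (13 * r) * r := by gcongr; linarith
        _ = 13 * t := by rw [← hr2]; ring
    calc |φ y| * |thetaDeriv y - L| ≤ 3 * (13 / r) :=
          mul_le_mul (hφ3 y) (h1.trans h2) (abs_nonneg _) (by positivity)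
      _ = 39 / r := by ring
  have hAr : A ≤ t - 3 * r := by nlinarith
  have hBr : t + 3 * r ≤ B := by nlinarith
  have b1 := intervalIntegral.norm_integral_le_of_norm_le_const (a := A) (b := t - 3 * r)
    (f := fun y => φ y * (thetaDeriv y - L)) (C := 10 / t) fun y hy => by
      rw [Set.uIoc_of_le hAr] at hy
      exact hout y (by linarith [hy.1]) (by linarith [hy.2]) (Or.inl hy.2)
  have b2 := intervalIntegral.norm_integral_le_of_norm_le_const (a := t - 3 * r) (b := t + 3 * r)
    (f := fun y => φ y * (thetaDeriv y - L)) (C := 39 / r) fun y hy => by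
      rw [Set.uIoc_of_le (by linarith)] at hy
      exact hin y hy.1.le hy.2
  have b3 := intervalIntegral.norm_integral_le_of_norm_le_const (a := t + 3 * r) (b := B)
    (f := fun y => φ y * (thetaDeriv y - L)) (C := 10 / t) fun y hy => by
      rw [Set.uIoc_of_le hBr] at hy
      exact hout y (by linarith [hy.1]) (by linarith [hy.2]) (Or.inr hy.1.le)
  rw [abs_of_nonneg (by linarith)] at b1 b2 b3
  have c1 : 10 / t * (t - 3 * r - A) ≤ 10 := by
    rw [div_mul_eq_mul_div, div_le_iff₀ (by linarith)]
    nlinarith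
  have c2 : 39 / r * (t + 3 * r - (t - 3 * r)) = 234 := by
    field_simp
    ring
  have c3 : 10 / t * (B - (t + 3 * r)) ≤ 40 := by
    rw [div_mul_eq_mul_div, div_le_iff₀ (by linarith)]
    nlinarith
  rw [e1, ← intervalIntegral.integral_add_adjacent_intervals (hgi A (t - 3 * r)) (hgi _ _),
    ← intervalIntegral.integral_add_adjacent_intervals (hgi (t - 3 * r) (t + 3 * r)) (hgi _ _),
    ← Real.norm_eq_abs]
  have d1 := norm_add_le (∫ y in A..(t - 3 * r), φ y * (thetaDeriv y - L))
    ((∫ y in (t - 3 * r)..(t + 3 * r), φ y * (thetaDeriv y - L)) +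
      ∫ y in (t + 3 * r)..B, φ y * (thetaDeriv y - L))
  have d2 := norm_add_le (∫ y in (t - 3 * r)..(t + 3 * r), φ y * (thetaDeriv y - L))
    (∫ y in (t + 3 * r)..B, φ y * (thetaDeriv y - L))
  linarith

/-! ### Majorant and minorant of the interval, and the count of zeros -/

lemma integral_intervalApprox_eq {e : ℝ → ℝ} (he : Continuous e) {D t h A B : ℝ} (hD : D ≠ 0) :
    ∫ y in A..B, (e (D * (y - t)) + e (D * (t + h - y))) / 2 =
      D⁻¹ / 2 * ((∫ x in (-(D * (t - A)))..(D * (B - t)), e x) +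
        ∫ x in (-(D * (B - (t + h))))..(D * (t + h - A)), e x) := by
  rw [intervalIntegral.integral_div, intervalIntegral.integral_add
    (Continuous.intervalIntegrable (by fun_prop) _ _)
    (Continuous.intervalIntegrable (by fun_prop) _ _)]
  have h1 := intervalIntegral.integral_comp_mul_sub (a := A) (b := B) e hD (D * t)
  have h2 := intervalIntegral.integral_comp_sub_mul (a := A) (b := B) e hD (D * (t + h))
  simp only [← mul_sub] at h1 h2
  rw [h1, h2, ← neg_sub t A, ← neg_sub B (t + h), mul_neg, mul_neg, smul_eq_mul, smul_eq_mul]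
  ring

/-- The main terms from the truncation at `A` and `B` cancel between the two half-sums, leaving `h`.
Each excess is at most `1` before rescaling, which accounts for `1 / D`. -/
lemma integral_majorant_le {D t h A B : ℝ} (hD : 0 < D) (hh : 0 ≤ h) (hA : A ≤ t)
    (hB : t + h ≤ B) :
    ∫ y in A..B, (beurlingReal (D * (y - t)) + beurlingReal (D * (t + h - y))) / 2 ≤ h + 1 / D := by
  rw [integral_intervalApprox_eq continuous_beurlingReal hD.ne']
  have h1 := (integral_beurlingReal_bounds (M₁ := D * (t - A)) (M₂ := D * (B - t))
    (mul_nonneg hD.le (by linarith)) (mul_nonneg hD.le (by linarith))).2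
  have h2 := (integral_beurlingReal_bounds (M₁ := D * (B - (t + h))) (M₂ := D * (t + h - A))
    (mul_nonneg hD.le (by linarith)) (mul_nonneg hD.le (by linarith))).2
  calc _ ≤ D⁻¹ / 2 * ((D * (B - t) - D * (t - A) + 1) +
        (D * (t + h - A) - D * (B - (t + h)) + 1)) := by gcongr
    _ = h + 1 / D := by
        field_simp
        ring

lemma le_integral_minorant {D t h A B : ℝ} (hD : 0 < D) (hh : 0 ≤ h) (hA : A ≤ t)
    (hB : t + h ≤ B) :
    h - 1 / D ≤
      ∫ y in A..B, (-beurlingReal (-(D * (y - t))) + -beurlingReal (-(D * (t + h - y)))) / 2 := by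
  have hc : Continuous fun x => -beurlingReal (-x) := by
    have := continuous_beurlingReal
    fun_prop
  rw [integral_intervalApprox_eq hc hD.ne']
  simp only [intervalIntegral.integral_neg, intervalIntegral.integral_comp_neg, neg_neg]
  have h1 := (integral_beurlingReal_bounds (M₂ := D * (t - A)) (M₁ := D * (B - t))
    (mul_nonneg hD.le (by linarith)) (mul_nonneg hD.le (by linarith))).2
  have h2 := (integral_beurlingReal_bounds (M₂ := D * (B - (t + h))) (M₁ := D * (t + h - A))
    (mul_nonneg hD.le (by linarith)) (mul_nonneg hD.le (by linarith))).2
  calc h - 1 / D = D⁻¹ / 2 * (-(D * (t - A) - D * (B - t) + 1) +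
        -(D * (B - (t + h)) - D * (t + h - A) + 1)) := by
        field_simp
        ring
    _ ≤ _ := by gcongr

lemma indicator_le_majorant {D t h y : ℝ} (hD : 0 < D) (hh : 0 ≤ h) :
    (if t < y ∧ y ≤ t + h then 1 else 0) ≤
      (beurlingReal (D * (y - t)) + beurlingReal (D * (t + h - y))) / 2 := by
  have hp : ∀ x, 0 ≤ x → 1 ≤ beurlingReal (D * x) := fun x hx =>
    (one_le_beurlingReal (mul_nonneg hD.le hx)).1
  have hn : ∀ x, x ≤ 0 → -1 ≤ beurlingReal (D * x) := fun x hx =>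
    (neg_one_le_beurlingReal (mul_nonpos_of_nonneg_of_nonpos hD.le hx)).1
  split_ifs with h1
  · linarith [hp (y - t) (by linarith [h1.1]), hp (t + h - y) (by linarith [h1.2])]
  · rcases le_total y t with h2 | h2
    · linarith [hn (y - t) (by linarith), hp (t + h - y) (by linarith)]
    -- At the excluded endpoint `y = t` the indicator is `0`, while both arguments of the majorant
    -- are nonnegative.
    · rcases h2.eq_or_lt with rfl | h2
      · linarith [hp (t - t) (by linarith), hp (t + h - t) (by linarith)]
      · have : t + h < y := by
          by_contra hc
          exact h1 ⟨h2, not_lt.mp hc⟩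
        linarith [hp (y - t) (by linarith), hn (t + h - y) (by linarith)]

/-- The reflected function is at most `-1` on `(-∞, 0]`, including `0`, so the half-sum is already
nonpositive at the excluded endpoint `y = t`. -/
lemma minorant_le_indicator {D t h y : ℝ} (hD : 0 < D) (hh : 0 ≤ h) :
    (-beurlingReal (-(D * (y - t))) + -beurlingReal (-(D * (t + h - y)))) / 2 ≤
      (if t < y ∧ y ≤ t + h then 1 else 0) := by
  have hn : ∀ x, 0 ≤ x → -1 ≤ beurlingReal (-(D * x)) := fun x hx =>
    (neg_one_le_beurlingReal (neg_nonpos.mpr (mul_nonneg hD.le hx))).1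
  have hp : ∀ x, x ≤ 0 → 1 ≤ beurlingReal (-(D * x)) := fun x hx =>
    (one_le_beurlingReal (neg_nonneg.mpr (mul_nonpos_of_nonneg_of_nonpos hD.le hx))).1
  split_ifs with h1
  · linarith [hn (y - t) (by linarith [h1.1]), hn (t + h - y) (by linarith [h1.2])]
  · rcases le_or_gt y t with h2 | h2
    · linarith [hp (y - t) (by linarith), hn (t + h - y) (by linarith)]
    · have : t + h < y := by
        by_contra hc
        exact h1 ⟨h2, not_lt.mp hc⟩
      linarith [hn (y - t) (by linarith), hp (t + h - y) (by linarith)]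

/-- The weights have nonnegative multiplicities, so majorant and minorant bound the count from both
sides. The contour estimate and the archimedean integral evaluate these bounds; `D` is left free for
optimization. -/
lemma exists_abs_zetaZeroCount_sub_le (hRH : RiemannHypothesis) {σ : ℝ} (hσ : 1 < σ)
    (hσ' : σ ≤ 3 / 2) : ∃ C T₀ : ℝ, 0 < C ∧ 64 ≤ T₀ ∧ ∀ t, T₀ ≤ t → ∀ D, 1 ≤ D → ∀ h, 0 ≤ h →
      h ≤ 2 * Real.sqrt t →
      |(zetaZeroCount (t + h) : ℝ) - (zetaZeroCount t : ℝ)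
          - h / (2 * Real.pi) * Real.log (t / (2 * Real.pi))| ≤
        Real.log t / (2 * Real.pi * D) + C * Real.exp (2 * Real.pi * D * (σ - 1 / 2)) := by
  obtain ⟨C, hC, hmain⟩ := exists_abs_sum_intervalApprox_sub_integral_le hRH hσ hσ'
  obtain ⟨K, hK, hheight⟩ := exists_height_norm_logDeriv_riemannZeta_le hRH
  -- The threshold `64K` makes `K y ≤ (t/4)²` for `y ≤ 4t`, as required on the horizontal sides with
  -- `r = t/4`. The constant `314` is the archimedean error, absorbed because the exponential is at
  -- least `1`.
  refine ⟨C + 314, max 64 (64 * K), by positivity, le_max_left _ _,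
    fun t ht D hD h hh hht => ?_⟩
  have ht64 : 64 ≤ t := (le_max_left _ _).trans ht
  have htK : 64 * K ≤ t := (le_max_right _ _).trans ht
  have hsq : Real.sqrt t ^ 2 = t := Real.sq_sqrt (by linarith)
  have hs8 : 8 ≤ Real.sqrt t := by
    rw [Real.le_sqrt' (by norm_num)]
    linarith
  have hht4 : h ≤ t / 4 := by nlinarith
  obtain ⟨A, hA, hnA, hA'⟩ := hheight (t / 2) (by linarith)
  obtain ⟨B, hB, hnB, hB'⟩ := hheight (3 * t) (by linarith)
  have hD0 : 0 < D := by linarith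
  have hA0 : 0 < A := by linarith [hA.1]
  obtain ⟨S, hS⟩ := hRH.exists_finset_zeros hA0 B
  have hKt : ∀ y, y ≤ 4 * t → K * y ≤ (t / 4) ^ 2 := fun y hy => by nlinarith
  have hcount := zetaZeroCount_sub_eq_sum hRH hA0 (t := t) (t' := t + h) (by linarith [hA.2])
    (by linarith) (by linarith [hB.1]) S hS
  have hgen : ∀ {E : ℂ → ℂ} {e : ℝ → ℝ}, IsSignApprox E e →
      |Real.pi * ∑ ρ ∈ S, (analyticOrderNatAt riemannZeta ρ : ℝ) *
        ((e (D * (ρ.im - t)) + e (D * (t + h - ρ.im))) / 2) -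
      1 / 2 * Real.log (t / (2 * Real.pi)) *
        ∫ y in A..B, (e (D * (y - t)) + e (D * (t + h - y))) / 2| ≤
      C * Real.exp (2 * Real.pi * D * (σ - 1 / 2)) + 314 := by
    intro E e hE
    have h1 := hmain hE (t := t) (h := h) (A := A) (B := B) (r := t / 4) hD hh (by linarith) hA0
      (by linarith [hA.2]) (by linarith [hB.1]) hnA hnB
      (fun x hx => (hA' x hx).trans (hKt A (by linarith [hA.2])))
      (fun x hx => (hB' x hx).trans (hKt B (by linarith [hB.2]))) S hS
    have h2 := hE.abs_integral_mul_thetaDeriv_sub_le hD ht64 hh hht hA hB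
    have h3 := abs_add_le _ _ |>.trans (add_le_add h1 h2)
    rwa [sub_add_sub_cancel] at h3
  set M := Real.exp (2 * Real.pi * D * (σ - 1 / 2)) with hM
  have hM1 : 1 ≤ M := Real.one_le_exp (by
    have : 0 ≤ σ - 1 / 2 := by linarith
    positivity)
  set L := 1 / 2 * Real.log (t / (2 * Real.pi)) with hL
  have hL0 : 0 ≤ L := by
    have : 1 ≤ t / (2 * Real.pi) := by
      rw [le_div_iff₀ Real.two_pi_pos]
      linarith [Real.pi_lt_four]
    have := Real.log_nonneg this
    positivity
  have hLt : L ≤ 1 / 2 * Real.log t := by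
    rw [hL]
    have : t / (2 * Real.pi) ≤ t := div_le_self (by linarith) (by linarith [Real.pi_gt_three])
    gcongr
  have hup := hgen isSignApprox_beurling
  have hlow := hgen isSignApprox_beurling.neg
  rw [abs_le] at hup hlow
  have hiu := integral_majorant_le hD0 hh (t := t) (A := A) (B := B) (by linarith [hA.2])
    (by linarith [hB.1])
  have hil := le_integral_minorant hD0 hh (t := t) (A := A) (B := B) (by linarith [hA.2])
    (by linarith [hB.1])
  have hsu : (zetaZeroCount (t + h) : ℝ) - (zetaZeroCount t : ℝ) ≤
      ∑ ρ ∈ S, (analyticOrderNatAt riemannZeta ρ : ℝ) *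
        ((beurlingReal (D * (ρ.im - t)) + beurlingReal (D * (t + h - ρ.im))) / 2) := by
    rw [hcount]
    exact Finset.sum_le_sum fun ρ _ =>
      mul_le_mul_of_nonneg_left (indicator_le_majorant hD0 hh) (Nat.cast_nonneg _)
  have hsl : ∑ ρ ∈ S, (analyticOrderNatAt riemannZeta ρ : ℝ) *
        ((-beurlingReal (-(D * (ρ.im - t))) + -beurlingReal (-(D * (t + h - ρ.im)))) / 2) ≤
      (zetaZeroCount (t + h) : ℝ) - (zetaZeroCount t : ℝ) := by
    rw [hcount]
    exact Finset.sum_le_sum fun ρ _ =>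
      mul_le_mul_of_nonneg_left (minorant_le_indicator hD0 hh) (Nat.cast_nonneg _)
  have hu2 := mul_le_mul_of_nonneg_left hsu Real.pi_pos.le
  have hl2 := mul_le_mul_of_nonneg_left hsl Real.pi_pos.le
  have hu3 := mul_le_mul_of_nonneg_left hiu hL0
  have hl3 := mul_le_mul_of_nonneg_left hil hL0
  set X := (zetaZeroCount (t + h) : ℝ) - (zetaZeroCount t : ℝ) with hX
  have hkey : |Real.pi * X - L * h| ≤ L * (1 / D) + (C + 314) * M := by
    rw [abs_le]
    constructor <;> nlinarith [hup.1, hup.2, hlow.1, hlow.2]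
  have he : X - h / (2 * Real.pi) * Real.log (t / (2 * Real.pi)) =
      (Real.pi * X - L * h) / Real.pi := by
    rw [hL]
    have := Real.pi_ne_zero
    field_simp
  rw [he, abs_div, abs_of_pos Real.pi_pos, div_le_iff₀ Real.pi_pos]
  have h5 : L * (1 / D) ≤ 1 / 2 * Real.log t * (1 / D) := by gcongr
  have h6 : Real.log t / (2 * Real.pi * D) * Real.pi = 1 / 2 * Real.log t * (1 / D) := by
    have := Real.pi_ne_zero
    field_simp
  have h7 : (C + 314) * M ≤ (C + 314) * M * Real.pi :=
    le_mul_of_one_le_right (by positivity) (by linarith [Real.pi_gt_three])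
  rw [add_mul, h6]
  linarith

/-- The number of zeros in `(t, t + h]`, uniformly for `0 ≤ h ≤ 2√t`. -/
theorem eventually_abs_zetaZeroCount_sub_le (hRH : RiemannHypothesis) {ε : ℝ} (hε : 0 < ε) :
    ∀ᶠ t : ℝ in atTop, ∀ h : ℝ, 0 ≤ h → h ≤ 2 * Real.sqrt t →
      |(zetaZeroCount (t + h) : ℝ) - (zetaZeroCount t : ℝ)
          - h / (2 * Real.pi) * Real.log (t / (2 * Real.pi))| ≤
        (1 / 2 + ε) * (Real.log t / Real.log (Real.log t)) := by
  set δ := min ε 1 with hδ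
  have hδ0 : 0 < δ := lt_min hε one_pos
  have hδ1 : δ ≤ 1 := min_le_right _ _
  have hδε : δ ≤ ε := min_le_left _ _
  -- With `δ ≤ 1` this gives `(1/2 + κ)/(1 - κ) ≤ 1/2 + δ/2` and keeps `σ = 1 + κ` below `3/2`.
  set κ := δ / 4 with hκ
  have hκ0 : 0 < κ := by positivity
  obtain ⟨C, T₀, hC, hT₀, hmain⟩ := exists_abs_zetaZeroCount_sub_le hRH (σ := 1 + κ)
    (by linarith) (by linarith)
  have hlog2 : Tendsto (fun t => Real.log (Real.log t)) atTop atTop :=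
    Real.tendsto_log_atTop.comp Real.tendsto_log_atTop
  have hlittle := (isLittleO_log_rpow_atTop hκ0).bound (c := δ / (2 * C)) (by positivity)
  have hlittle' := Real.tendsto_log_atTop.eventually hlittle
  -- Taking `D = c log log t` makes the exponent `2πD(σ - 1/2)` equal to `(1 - κ) log log t`, so the
  -- contour error is `O((log t)^{1-κ})`, which is negligible.
  set c := (1 - κ) / (2 * Real.pi * (1 / 2 + κ)) with hc
  have hc0 : 0 < c := by
    have : 0 < 1 - κ := by linarith
    positivity
  filter_upwards [eventually_ge_atTop T₀, hlittle', hlog2.eventually_ge_atTop (1 / c),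
    hlog2.eventually_gt_atTop 0, Real.tendsto_log_atTop.eventually_gt_atTop 1]
    with t ht h1 h2 h3 h4 h hh hht
  set Y := Real.log (Real.log t) with hY
  set X := Real.log t with hX
  have hX0 : 0 < X := by linarith
  have hD1 : 1 ≤ c * Y := by
    rw [div_le_iff₀ hc0] at h2
    linarith
  refine (hmain t ht (c * Y) hD1 h hh hht).trans ?_
  have e1 : 2 * Real.pi * (c * Y) * (1 + κ - 1 / 2) = Y * (1 - κ) := by
    rw [hc]
    have := Real.pi_ne_zero
    field_simp
    ring
  have e2 : Real.exp (Y * (1 - κ)) = X ^ (1 - κ) := by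
    rw [Real.rpow_def_of_pos hX0]
  rw [e1, e2]
  have b1 : X / (2 * Real.pi * (c * Y)) ≤ (1 / 2 + δ / 2) * (X / Y) := by
    have e3 : X / (2 * Real.pi * (c * Y)) = (1 / 2 + κ) / (1 - κ) * (X / Y) := by
      rw [hc]
      have := Real.pi_ne_zero
      have : 1 - κ ≠ 0 := by linarith
      field_simp
    rw [e3]
    have : 0 < 1 - κ := by linarith
    gcongr
    rw [div_le_iff₀ this]
    nlinarith
  have b2 : C * X ^ (1 - κ) ≤ δ / 2 * (X / Y) := by
    rw [Real.norm_of_nonneg h3.le, Real.norm_of_nonneg (by positivity)] at h1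
    have h5 : X ^ κ * X ^ (1 - κ) = X := by
      rw [← Real.rpow_add hX0]
      simp
    rw [mul_div_assoc', le_div_iff₀ h3]
    calc C * X ^ (1 - κ) * Y ≤ C * X ^ (1 - κ) * (δ / (2 * C) * X ^ κ) := by gcongr
      _ = δ / 2 * (X ^ κ * X ^ (1 - κ)) := by field_simp
      _ = δ / 2 * X := by rw [h5]
  have b3 : (1 / 2 + δ) * (X / Y) ≤ (1 / 2 + ε) * (X / Y) := by gcongr
  linarith

/-! ### Continuous arguments and the function `S` -/

section ContinuousArgument

variable {c ψ : ℝ → ℂ}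

lemma eq_mul_exp_integral_of_hasDerivAt (hψ : Continuous ψ)
    (hc : ∀ x, HasDerivAt c (ψ x * c x) x) (x₀ x : ℝ) :
    c x = c x₀ * Complex.exp (∫ u in x₀..x, ψ u) := by
  have hΦ : ∀ x, HasDerivAt (fun x => ∫ u in x₀..x, ψ u) (ψ x) x := fun x =>
    intervalIntegral.integral_hasDerivAt_right (hψ.intervalIntegrable _ _)
      (hψ.stronglyMeasurableAtFilter _ _) hψ.continuousAt
  have hd : ∀ x, HasDerivAt (fun x => c x * Complex.exp (-∫ u in x₀..x, ψ u)) 0 x := by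
    intro x
    have h := (hc x).mul ((hΦ x).neg.cexp)
    have e : ψ x * c x * Complex.exp (-∫ u in x₀..x, ψ u) +
        c x * (Complex.exp (-∫ u in x₀..x, ψ u) * -ψ x) = 0 := by ring
    rwa [← e]
  have h1 := is_const_of_deriv_eq_zero (fun x => (hd x).differentiableAt) (fun x => (hd x).deriv)
    x x₀
  simp only [intervalIntegral.integral_same, neg_zero, Complex.exp_zero, mul_one] at h1
  rw [← h1, mul_assoc, ← Complex.exp_add, neg_add_cancel, Complex.exp_zero, mul_one]

lemma eq_norm_mul_exp_add_integral (hψ : Continuous ψ) (hc : ∀ x, HasDerivAt c (ψ x * c x) x)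
    {x₀ θ₀ : ℝ} (h₀ : c x₀ = ‖c x₀‖ * Complex.exp (θ₀ * I)) (x : ℝ) :
    c x = ‖c x‖ * Complex.exp ((θ₀ + (∫ u in x₀..x, ψ u).im : ℝ) * I) := by
  have h1 := eq_mul_exp_integral_of_hasDerivAt hψ hc x₀ x
  set w := ∫ u in x₀..x, ψ u with hw
  have h2 : (‖c x‖ : ℂ) = ‖c x₀‖ * Complex.exp (w.re : ℂ) := by
    rw [h1, norm_mul, Complex.norm_exp]
    push_cast
    rfl
  have h3 : Complex.exp w = Complex.exp (w.re : ℂ) * Complex.exp (w.im * I) := by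
    rw [← Complex.exp_add, re_add_im]
  have h4 : Complex.exp ((θ₀ + w.im : ℝ) * I) =
      Complex.exp (θ₀ * I) * Complex.exp (w.im * I) := by
    rw [← Complex.exp_add]
    push_cast
    ring_nf
  rw [h2, h4, h1, h3]
  nth_rewrite 1 [h₀]
  ring

/-- Any continuous argument differs from the one given by the integral by a continuous function with
values in `2πℤ`, which is constant on an interval. -/
lemma continuousArg_sub_eq_im_integral (hψ : Continuous ψ)
    (hc : ∀ x, HasDerivAt c (ψ x * c x) x) (hne : ∀ x, c x ≠ 0) {a b : ℝ} (hab : a ≤ b)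
    {β : ℝ → ℝ} (hβ : ContinuousOn β (Set.Icc a b))
    (hcβ : ∀ x ∈ Set.Icc a b, c x = ‖c x‖ * Complex.exp (β x * I)) :
    β b - β a = (∫ u in a..b, ψ u).im := by
  have ha : a ∈ Set.Icc a b := ⟨le_rfl, hab⟩
  have hb : b ∈ Set.Icc a b := ⟨hab, le_rfl⟩
  set g : ℝ → ℝ := fun x => (β x - (β a + (∫ u in a..x, ψ u).im)) / (2 * Real.pi) with hg
  have hgc : ContinuousOn g (Set.Icc a b) := by
    have h1 : Continuous fun x => ∫ u in a..x, ψ u :=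
      intervalIntegral.continuous_primitive (fun u v => hψ.intervalIntegrable u v) a
    have h2 : Continuous fun x => β a + (∫ u in a..x, ψ u).im :=
      continuous_const.add (continuous_im.comp h1)
    exact (hβ.sub h2.continuousOn).div_const _
  have hgint : Set.MapsTo g (Set.Icc a b) (Set.range ((↑) : ℤ → ℝ)) := by
    intro x hx
    have h1 := hcβ x hx
    have h2 := eq_norm_mul_exp_add_integral hψ hc (hcβ a ha) x
    rw [h1] at h2
    have h3 : (‖c x‖ : ℂ) ≠ 0 := ofReal_ne_zero.mpr (norm_ne_zero_iff.mpr (hne x))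
    rw [← h1] at h2
    nth_rewrite 1 [h1] at h2
    obtain ⟨n, hn⟩ := Complex.exp_eq_exp_iff_exists_int.mp (mul_left_cancel₀ h3 h2)
    refine ⟨n, ?_⟩
    have h4 := congrArg im hn
    simp at h4
    rw [hg]
    dsimp only
    rw [eq_div_iff Real.two_pi_pos.ne', h4]
    ring
  have hdisc : DiscreteTopology (Set.range ((↑) : ℤ → ℝ)) :=
    Int.isClosedEmbedding_coe_real.isEmbedding.toHomeomorph.symm.isEmbedding.discreteTopology
  have h := isPreconnected_Icc.constant_of_mapsTo ⟨hdisc⟩ hgc hgint hb ha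
  rw [hg] at h
  simp only [intervalIntegral.integral_same, zero_im, add_zero, sub_self, zero_div] at h
  rw [div_eq_zero_iff] at h
  rcases h with h | h
  · linarith
  · exact absurd h Real.two_pi_pos.ne'

end ContinuousArgument

lemma hasDerivAt_riemannZeta_two_add (y : ℝ) :
    HasDerivAt (fun y : ℝ => riemannZeta (2 + y * I))
      (I * logDeriv riemannZeta (2 + y * I) * riemannZeta (2 + y * I)) y := by
  have hre : (1 : ℝ) < ((2 : ℂ) + y * I).re := by simp
  have h0 := riemannZeta_ne_zero_of_one_lt_re hre
  have h1 := (differentiableAt_riemannZeta (s := 2 + y * I)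
    (by rintro h; rw [h] at hre; simp at hre)).hasDerivAt
  have h2 : HasDerivAt (fun y : ℝ => (2 : ℂ) + y * I) I y := by
    simpa using ((hasDerivAt_id y).ofReal_comp.mul_const I).const_add (2 : ℂ)
  have h3 := h1.comp y h2
  have e : I * logDeriv riemannZeta (2 + y * I) * riemannZeta (2 + y * I) =
      deriv riemannZeta (2 + y * I) * I := by
    rw [logDeriv_apply, mul_assoc, div_mul_cancel₀ _ h0, mul_comm]
  rw [e]
  exact h3

lemma riemannZeta_horizontal_ne_zero {t : ℝ} (hn : ¬IsZetaOrdinate t) (x : ℝ) :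
    riemannZeta (x + t * I) ≠ 0 := fun h => hn ⟨_, h, by simp⟩

lemma hasDerivAt_riemannZeta_horizontal {t : ℝ} (ht : 0 < t) (hn : ¬IsZetaOrdinate t) (x : ℝ) :
    HasDerivAt (fun x : ℝ => riemannZeta (x + t * I))
      (logDeriv riemannZeta (x + t * I) * riemannZeta (x + t * I)) x := by
  have h0 := riemannZeta_horizontal_ne_zero hn x
  have h1 := (differentiableAt_riemannZeta_of_im_pos (s := x + t * I) (by simpa)).hasDerivAt
  have h2 : HasDerivAt (fun x : ℝ => (x : ℂ) + t * I) 1 x := by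
    simpa using (hasDerivAt_id x).ofReal_comp.add_const (t * I)
  have h3 := h1.comp x h2
  have e : logDeriv riemannZeta (x + t * I) * riemannZeta (x + t * I) =
      deriv riemannZeta (x + t * I) * 1 := by
    rw [logDeriv_apply, div_mul_cancel₀ _ h0, mul_one]
  rw [e]
  exact h3

lemma continuous_logDeriv_riemannZeta_horizontal {t : ℝ} (ht : 0 < t) (hn : ¬IsZetaOrdinate t) :
    Continuous fun x : ℝ => logDeriv riemannZeta (x + t * I) := by
  rw [continuous_iff_continuousAt]
  intro x
  have h1 := analyticAt_riemannZeta_of_im_pos (s := x + t * I) (by simpa)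
  have h2 : ContinuousAt (logDeriv riemannZeta) (x + t * I) :=
    h1.deriv.continuousAt.div h1.continuousAt (riemannZeta_horizontal_ne_zero hn x)
  exact h2.comp (f := fun x : ℝ => (x : ℂ) + t * I) (by fun_prop)

lemma continuous_logDeriv_riemannZeta_two_add :
    Continuous fun y : ℝ => logDeriv riemannZeta (2 + y * I) := by
  have := continuous_logDeriv_riemannZeta_right (σ := 2) (by norm_num)
  simpa using this

/-- The argument of `ζ` obtained by continuous variation, as an integral of `ζ'/ζ`. -/
lemma zetaArg_eq_integral {t : ℝ} (ht : 0 < t) (hn : ¬IsZetaOrdinate t) :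
    zetaArg t = (∫ y in (0 : ℝ)..t, I * logDeriv riemannZeta (2 + y * I)).im -
      (∫ x in (1 / 2 : ℝ)..2, logDeriv riemannZeta (x + t * I)).im := by
  set ψ₁ : ℝ → ℂ := fun y => I * logDeriv riemannZeta (2 + y * I) with hψ₁
  set ψ₂ : ℝ → ℂ := fun x => logDeriv riemannZeta (x + t * I) with hψ₂
  have hc₁ : Continuous ψ₁ := continuous_const.mul continuous_logDeriv_riemannZeta_two_add
  have hc₂ : Continuous ψ₂ := continuous_logDeriv_riemannZeta_horizontal ht hn
  have hd₂ := hasDerivAt_riemannZeta_horizontal ht hn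
  have hne₁ : ∀ y : ℝ, riemannZeta (2 + y * I) ≠ 0 := fun y =>
    riemannZeta_ne_zero_of_one_lt_re (by simp)
  -- `ζ(2) = π²/6` is positive, so the argument `0` is a legitimate starting value.
  have h₀ : riemannZeta (2 + (0 : ℝ) * I) =
      ‖riemannZeta (2 + (0 : ℝ) * I)‖ * Complex.exp ((0 : ℝ) * I) := by
    have : (Real.pi : ℂ) ^ 2 / 6 = ((Real.pi ^ 2 / 6 : ℝ) : ℂ) := by push_cast; rfl
    rw [ofReal_zero, zero_mul, add_zero, Complex.exp_zero, mul_one, riemannZeta_two, this,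
      norm_real, Real.norm_of_nonneg (by positivity)]
  have hex : ∃ a, IsZetaArg t a := by
    have hα := eq_norm_mul_exp_add_integral hc₁ hasDerivAt_riemannZeta_two_add h₀
    have h2 : riemannZeta ((2 : ℝ) + t * I) = ‖riemannZeta ((2 : ℝ) + t * I)‖ *
        Complex.exp ((0 + (∫ u in (0 : ℝ)..t, ψ₁ u).im : ℝ) * I) := by
      simpa using hα t
    have hβ := eq_norm_mul_exp_add_integral hc₂ hd₂ h2
    refine ⟨_, fun y => 0 + (∫ u in (0 : ℝ)..y, ψ₁ u).im,
      fun x => 0 + (∫ u in (0 : ℝ)..t, ψ₁ u).im + (∫ u in (2 : ℝ)..x, ψ₂ u).im,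
      ?_, fun y _ => hα y, ?_, fun x _ => hβ x, by simp, by simp, rfl⟩
    · have : Continuous fun y => ∫ u in (0 : ℝ)..y, ψ₁ u :=
        intervalIntegral.continuous_primitive (fun u v => hc₁.intervalIntegrable u v) 0
      exact (continuous_const.add (continuous_im.comp this)).continuousOn
    · have : Continuous fun y => ∫ u in (2 : ℝ)..y, ψ₂ u :=
        intervalIntegral.continuous_primitive (fun u v => hc₂.intervalIntegrable u v) 2
      exact (continuous_const.add (continuous_im.comp this)).continuousOn
  -- The chosen value comes with unspecified argument functions, but continuity and the starting
  -- value force their variation along both segments.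
  rw [zetaArg, dif_pos hex]
  obtain ⟨α, β, hα, hα', hβ, hβ', h1, h2, h3⟩ := hex.choose_spec
  have e1 := continuousArg_sub_eq_im_integral hc₁ hasDerivAt_riemannZeta_two_add hne₁ ht.le hα hα'
  have e2 := continuousArg_sub_eq_im_integral hc₂ hd₂ (riemannZeta_horizontal_ne_zero hn)
    (by norm_num) hβ hβ'
  rw [h1] at e1
  rw [h2, h3] at e2
  linarith

/-- The paths defining the two arguments differ by the three sides of a rectangle with right side
`Re s = 2`, so this is the rectangle identity with weight `1`. -/
lemma zetaArg_sub_zetaArg (hRH : RiemannHypothesis) {a b : ℝ} (ha : 0 < a) (hab : a < b)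
    (hna : ¬IsZetaOrdinate a) (hnb : ¬IsZetaOrdinate b) :
    zetaArg b - zetaArg a = Real.pi * ((zetaZeroCount b : ℝ) - zetaZeroCount a) -
      ∫ y in a..b, thetaDeriv y := by
  -- The counting identity needs a window extending strictly beyond `b`, whereas the contour needs
  -- the zeros strictly below `b`; the set is filtered afterwards.
  obtain ⟨S, hS⟩ := hRH.exists_finset_zeros ha (b + 1)
  have hcount := zetaZeroCount_sub_eq_sum hRH ha le_rfl hab.le (by linarith) S hS
  have hS' : ∀ ρ, ρ ∈ S.filter (fun ρ => ρ.im < b) ↔ riemannZeta ρ = 0 ∧ a < ρ.im ∧ ρ.im < b := by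
    intro ρ
    rw [Finset.mem_filter, hS]
    constructor
    · rintro ⟨⟨h1, h2, -⟩, h3⟩
      exact ⟨h1, h2, h3⟩
    · rintro ⟨h1, h2, h3⟩
      exact ⟨⟨h1, h2, by linarith⟩, h3⟩
  have h1 := im_sideIntegral_mul_logDeriv hRH (σ := 2) (by norm_num) ha hab hna hnb _ hS'
    (f := fun _ => 1) (differentiable_const 1) (by simp)
  simp only [one_mul, one_re, mul_one] at h1
  have h2 : ∑ ρ ∈ S.filter (fun ρ => ρ.im < b), (analyticOrderNatAt riemannZeta ρ : ℝ) =
      (zetaZeroCount b : ℝ) - zetaZeroCount a := by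
    rw [hcount, Finset.sum_filter]
    refine Finset.sum_congr rfl fun ρ hρ => ?_
    have h3 := (hS ρ).mp hρ
    have h4 : ρ.im ≠ b := fun h => hnb ⟨ρ, h3.1, h⟩
    have h5 : (a < ρ.im ∧ ρ.im ≤ b) ↔ ρ.im < b :=
      ⟨fun h => lt_of_le_of_ne h.2 h4, fun h => ⟨h3.2.1, h.le⟩⟩
    simp only [h5]
    simp
  rw [h2] at h1
  rw [← h1, zetaArg_eq_integral (ha.trans hab) hnb, zetaArg_eq_integral ha hna, sideIntegral]
  have hc : Continuous fun y : ℝ => I * logDeriv riemannZeta (2 + y * I) :=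
    continuous_const.mul continuous_logDeriv_riemannZeta_two_add
  have h6 := intervalIntegral.integral_add_adjacent_intervals
    (hc.intervalIntegrable (μ := MeasureTheory.volume) 0 a) (hc.intervalIntegrable a b)
  rw [← h6, intervalIntegral.integral_const_mul (a := a) (b := b)]
  simp only [add_im, sub_im, ofReal_ofNat]
  ring

lemma zetaZeroCount_congr {s s' : ℝ}
    (h : ∀ ρ, riemannZeta ρ = 0 → (ρ.im ≤ s ↔ ρ.im ≤ s')) : zetaZeroCount s = zetaZeroCount s' := by
  have : {ρ : ℂ | riemannZeta ρ = 0 ∧ 0 < ρ.im ∧ ρ.im ≤ s} =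
      {ρ : ℂ | riemannZeta ρ = 0 ∧ 0 < ρ.im ∧ ρ.im ≤ s'} := by
    ext ρ
    exact and_congr_right fun h0 => and_congr_right fun _ => h ρ h0
  rw [zetaZeroCount, this, zetaZeroCount]

/-- The ordinates of zeros are isolated. -/
lemma exists_forall_zeros_im_eq_or_le (hRH : RiemannHypothesis) {t : ℝ} (ht : 0 < t) :
    ∃ δ, 0 < δ ∧ δ < t ∧ ∀ ρ, riemannZeta ρ = 0 → ρ.im = t ∨ δ ≤ |ρ.im - t| := by
  have h1 : ∀ᶠ δ in 𝓝[>] (0 : ℝ), ∀ ρ ∈ (hRH.finite_zeros (t + 1)).toFinset, ρ.im ≠ t →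
      δ < |ρ.im - t| := by
    rw [eventually_all_finset]
    intro ρ _
    by_cases h : ρ.im = t
    · exact Eventually.of_forall fun δ hδ => absurd h hδ
    · filter_upwards [nhdsWithin_le_nhds (gt_mem_nhds (abs_pos.mpr (sub_ne_zero.mpr h)))]
        with δ hδ _ using hδ
  have h2 : ∀ᶠ δ in 𝓝[>] (0 : ℝ), δ < min t 1 :=
    nhdsWithin_le_nhds (gt_mem_nhds (lt_min ht one_pos))
  obtain ⟨δ, ⟨hδ1, hδ2⟩, hδ0⟩ := (h1.and (h2)).and (self_mem_nhdsWithin) |>.exists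
  have hδt : δ < t := hδ2.trans_le (min_le_left _ _)
  have hδ1' : δ < 1 := hδ2.trans_le (min_le_right _ _)
  refine ⟨δ, hδ0, hδt, fun ρ hρ => ?_⟩
  by_cases h : ρ.im = t
  · exact Or.inl h
  · right
    by_contra! hlt
    rw [abs_lt] at hlt
    have hmem : ρ ∈ (hRH.finite_zeros (t + 1)).toFinset := by
      rw [Set.Finite.mem_toFinset]
      exact ⟨hρ, by linarith, by linarith⟩
    have := hδ1 ρ hmem h
    rw [lt_abs] at this
    rcases this with h3 | h3 <;> linarith

lemma continuous_integral_thetaDeriv (A : ℝ) : Continuous fun s => ∫ y in A..s, thetaDeriv y :=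
  intervalIntegral.continuous_primitive
    (fun u v => continuous_thetaDeriv.intervalIntegrable u v) A

/-- The Riemann–von Mangoldt formula for `S(t)`, also at ordinates of zeros. -/
lemma exists_zetaS_eq (hRH : RiemannHypothesis) : ∃ A c : ℝ, ∀ t, 0 < t → ∀ᶠ ε in 𝓝[>] (0 : ℝ),
    zetaS t = c + ((zetaZeroCount t : ℝ) + zetaZeroCount (t - ε)) / 2 -
      (∫ y in A..t, thetaDeriv y) / Real.pi := by
  obtain ⟨_, _, hheight⟩ := exists_height_norm_logDeriv_riemannZeta_le hRH
  obtain ⟨A, hA, hnA, -⟩ := hheight 3 le_rfl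
  have hA0 : 0 < A := by linarith [hA.1]
  have hpi := Real.pi_ne_zero
  set c := zetaArg A / Real.pi - zetaZeroCount A with hc
  have hformula : ∀ s, 0 < s → ¬IsZetaOrdinate s → zetaArg s / Real.pi =
      c + zetaZeroCount s - (∫ y in A..s, thetaDeriv y) / Real.pi := by
    intro s hs hns
    rcases lt_trichotomy A s with h | h | h
    · have h1 := zetaArg_sub_zetaArg hRH hA0 h hnA hns
      rw [hc]
      field_simp
      linarith
    · subst h
      simp [hc]
    · have h1 := zetaArg_sub_zetaArg hRH hs h hns hnA
      rw [intervalIntegral.integral_symm] at h1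
      rw [hc]
      field_simp
      linarith
  refine ⟨A, c, fun t ht => ?_⟩
  obtain ⟨δ, hδ0, hδt, hδ⟩ := exists_forall_zeros_im_eq_or_le hRH ht
  -- Ordinates being isolated, the count is constant just to the left of `t`, and just to the right
  -- it equals its value at `t`. The symmetric limit defining `S` at an ordinate is then the mean of
  -- the two values.
  have hlow : ∀ ε, 0 < ε → ε < δ → zetaZeroCount (t - ε) = zetaZeroCount (t - δ / 2) := by
    intro ε h0 h1
    refine zetaZeroCount_congr fun ρ hρ => ?_
    rcases hδ ρ hρ with h | h
    · constructor <;> intro h2 <;> linarith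
    · rw [le_abs] at h
      constructor <;> intro h2 <;> rcases h with h | h <;> linarith
  have hhigh : ∀ ε, 0 < ε → ε < δ → zetaZeroCount (t + ε) = zetaZeroCount t := by
    intro ε h0 h1
    refine zetaZeroCount_congr fun ρ hρ => ?_
    rcases hδ ρ hρ with h | h
    · constructor <;> intro h2 <;> linarith
    · rw [le_abs] at h
      constructor <;> intro h2 <;> rcases h with h | h <;> linarith
  have hsmall : ∀ᶠ ε in 𝓝[>] (0 : ℝ), 0 < ε ∧ ε < δ := by
    filter_upwards [self_mem_nhdsWithin, nhdsWithin_le_nhds (gt_mem_nhds hδ0)] with ε h1 h2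
    exact ⟨h1, h2⟩
  by_cases hord : IsZetaOrdinate t
  · have hnord : ∀ ε, 0 < ε → ε < δ → ¬IsZetaOrdinate (t + ε) ∧ ¬IsZetaOrdinate (t - ε) := by
      intro ε h0 h1
      constructor
      · rintro ⟨ρ, hρ, him⟩
        rcases hδ ρ hρ with h | h
        · linarith
        · rw [him, add_sub_cancel_left, abs_of_pos h0] at h
          linarith
      · rintro ⟨ρ, hρ, him⟩
        rcases hδ ρ hρ with h | h
        · linarith
        · rw [him, sub_sub_cancel_left, abs_neg, abs_of_pos h0] at h
          linarith
    have hΘ := continuous_integral_thetaDeriv A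
    have hlim : Tendsto (fun ε : ℝ => zetaArg (t + ε) / Real.pi + zetaArg (t - ε) / Real.pi)
        (𝓝[>] 0) (𝓝 (2 * c + zetaZeroCount t + zetaZeroCount (t - δ / 2) -
          (∫ y in A..t, thetaDeriv y) / Real.pi - (∫ y in A..t, thetaDeriv y) / Real.pi)) := by
      have h1 : Tendsto (fun ε : ℝ => 2 * c + zetaZeroCount t + zetaZeroCount (t - δ / 2) -
          (∫ y in A..(t + ε), thetaDeriv y) / Real.pi -
          (∫ y in A..(t - ε), thetaDeriv y) / Real.pi) (𝓝[>] 0)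
          (𝓝 (2 * c + zetaZeroCount t + zetaZeroCount (t - δ / 2) -
          (∫ y in A..(t + 0), thetaDeriv y) / Real.pi -
          (∫ y in A..(t - 0), thetaDeriv y) / Real.pi)) := by
        refine Tendsto.mono_left (Continuous.tendsto ?_ 0) nhdsWithin_le_nhds
        have h2 : Continuous fun ε : ℝ => ∫ y in A..(t + ε), thetaDeriv y :=
          hΘ.comp (continuous_const.add continuous_id)
        have h3 : Continuous fun ε : ℝ => ∫ y in A..(t - ε), thetaDeriv y :=
          hΘ.comp (continuous_const.sub continuous_id)
        fun_prop
      rw [add_zero, sub_zero] at h1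
      refine h1.congr' ?_
      filter_upwards [hsmall] with ε hε
      obtain ⟨n1, n2⟩ := hnord ε hε.1 hε.2
      rw [hformula (t + ε) (by linarith) n1, hformula (t - ε) (by linarith [hε.2]) n2,
        hlow ε hε.1 hε.2, hhigh ε hε.1 hε.2]
      ring
    filter_upwards [hsmall] with ε hε
    rw [zetaS, if_pos hord, hlim.limUnder_eq, hlow ε hε.1 hε.2]
    ring
  · filter_upwards [hsmall] with ε hε
    have h1 : zetaZeroCount (t - ε) = zetaZeroCount t := by
      refine zetaZeroCount_congr fun ρ hρ => ?_
      rcases hδ ρ hρ with h | h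
      · exact absurd ⟨ρ, hρ, h⟩ hord
      · rw [le_abs] at h
        constructor <;> intro h2 <;> rcases h with h | h <;> linarith [hε.1, hε.2]
    rw [zetaS, if_neg hord, hformula t ht hord, h1]
    ring

lemma abs_integral_thetaDeriv_sub_le {t h : ℝ} (ht : 8 ≤ t) (hh : 0 ≤ h)
    (hht : h ≤ Real.sqrt t) :
    |(∫ y in t..(t + h), thetaDeriv y) - 1 / 2 * Real.log (t / (2 * Real.pi)) * h| ≤ 11 := by
  have hsq : Real.sqrt t ^ 2 = t := Real.sq_sqrt (by linarith)
  have hs1 : 1 ≤ Real.sqrt t := by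
    rw [Real.le_sqrt' (by norm_num)]
    linarith
  have e : (∫ y in t..(t + h), thetaDeriv y) - 1 / 2 * Real.log (t / (2 * Real.pi)) * h =
      ∫ y in t..(t + h), (thetaDeriv y - 1 / 2 * Real.log (t / (2 * Real.pi))) := by
    rw [intervalIntegral.integral_sub (continuous_thetaDeriv.intervalIntegrable _ _) (by simp)]
    simp
    ring
  have h1 := intervalIntegral.norm_integral_le_of_norm_le_const (a := t) (b := t + h)
    (f := fun y => thetaDeriv y - 1 / 2 * Real.log (t / (2 * Real.pi))) (C := (10 + h) / t)
    fun y hy => by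
      rw [Set.uIoc_of_le (by linarith)] at hy
      refine (abs_thetaDeriv_sub_le ht (by linarith [hy.1])).trans ?_
      rw [abs_of_pos (by linarith [hy.1])]
      have : 0 < t := by linarith
      gcongr
      linarith [hy.2]
  rw [add_sub_cancel_left, abs_of_nonneg hh] at h1
  rw [e, ← Real.norm_eq_abs]
  refine h1.trans ?_
  rw [div_mul_eq_mul_div, div_le_iff₀ (by linarith)]
  nlinarith

/-- Up to the integral of `θ'`, the increment of `S` is the mean of the increments of `N` over `(t,
t+h]` and `(t-δ, t+h-δ]` for small `δ > 0`. Both are covered by the bound for `N`; its range `h ≤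
2√t` leaves room to move from `t` to `t - δ`. The remaining bounded error is absorbed by `ε`. -/
theorem eventually_abs_zetaS_sub_le (hRH : RiemannHypothesis) {ε : ℝ} (hε : 0 < ε) :
    ∀ᶠ t : ℝ in atTop, ∀ h : ℝ, 0 ≤ h → h ≤ Real.sqrt t →
      |zetaS (t + h) - zetaS t| ≤ (1 / 2 + ε) * (Real.log t / Real.log (Real.log t)) := by
  have hmain := eventually_abs_zetaZeroCount_sub_le hRH (ε := ε / 2) (by positivity)
  rw [eventually_atTop] at hmain
  obtain ⟨T, hT⟩ := hmain
  obtain ⟨A, c, hS⟩ := exists_zetaS_eq hRH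
  set R : ℝ → ℝ := fun t => Real.log t / Real.log (Real.log t) with hR
  have hRtop : Tendsto R atTop atTop := by
    have h1 : Tendsto (fun x : ℝ => x / Real.log x) atTop atTop := by
      have h2 := Real.isLittleO_log_id_atTop.tendsto_div_nhds_zero
      have h3 : ∀ᶠ x : ℝ in atTop, 0 < Real.log x / id x := by
        filter_upwards [eventually_gt_atTop 1] with x hx
        have := Real.log_pos hx
        have : 0 < id x := by simp only [id]; linarith
        positivity
      have h4 := (tendsto_nhdsWithin_iff.mpr ⟨h2, h3⟩).inv_tendsto_nhdsGT_zero
      refine h4.congr fun x => ?_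
      simp
    exact h1.comp Real.tendsto_log_atTop
  have hRc : ∀ᶠ t in atTop, ContinuousAt R t := by
    filter_upwards [eventually_gt_atTop 1, Real.tendsto_log_atTop.eventually_gt_atTop 1]
      with t h1 h2
    have h3 : ContinuousAt Real.log t := Real.continuousAt_log (by linarith)
    have h4 : ContinuousAt (fun t => Real.log (Real.log t)) t :=
      h3.log (by linarith)
    exact h3.div h4 (Real.log_pos h2).ne'
  filter_upwards [eventually_gt_atTop (max T 8), hRtop.eventually_ge_atTop (11 / (ε / 2)), hRc]
    with t ht hRt hct h hh hht
  have htT : T < t := (le_max_left _ _).trans_lt ht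
  have ht8 : 8 < t := (le_max_right _ _).trans_lt ht
  have ht0 : 0 < t := by linarith
  have hs0 : 0 < Real.sqrt t := Real.sqrt_pos.mpr ht0
  have b1 := hT t htT.le h hh (by linarith)
  obtain ⟨x, hx⟩ : ∃ x : ℝ, x = zetaZeroCount (t + h) - zetaZeroCount t := ⟨_, rfl⟩
  have hsub : Tendsto (fun δ : ℝ => t - δ) (𝓝[>] 0) (𝓝 t) := by
    have : Tendsto (fun δ : ℝ => t - δ) (𝓝 0) (𝓝 (t - 0)) :=
      (continuous_const.sub continuous_id).tendsto 0
    rw [sub_zero] at this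
    exact this.mono_left nhdsWithin_le_nhds
  have hsqrt : Tendsto (fun δ : ℝ => 2 * Real.sqrt (t - δ)) (𝓝[>] 0) (𝓝 (2 * Real.sqrt t)) :=
    ((Real.continuous_sqrt.tendsto t).comp hsub).const_mul 2
  -- `V` does not involve `δ`, yet equals `N(t-δ+h) - N(t-δ)` for all small `δ > 0`. Letting `δ → 0`
  -- in the bound at `t - δ` gives a bound with `t` itself.
  set V := 2 * (zetaS (t + h) - zetaS t) + 2 * ((∫ y in t..(t + h), thetaDeriv y) / Real.pi) -
    ((zetaZeroCount (t + h) : ℝ) - zetaZeroCount t) with hV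
  have hev : ∀ᶠ δ in 𝓝[>] (0 : ℝ), |V - h / (2 * Real.pi) * Real.log ((t - δ) / (2 * Real.pi))| ≤
      (1 / 2 + ε / 2) * R (t - δ) := by
    filter_upwards [hS t ht0, hS (t + h) (by linarith), hsub.eventually (lt_mem_nhds htT),
      hsqrt.eventually (lt_mem_nhds (by linarith : h < 2 * Real.sqrt t))] with δ h1 h2 h3 h4
    have h5 := hT (t - δ) h3.le h hh h4.le
    have h6 : V = (zetaZeroCount (t - δ + h) : ℝ) - zetaZeroCount (t - δ) := by
      have h7 := intervalIntegral.integral_add_adjacent_intervals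
        (continuous_thetaDeriv.intervalIntegrable (μ := MeasureTheory.volume) A t)
        (continuous_thetaDeriv.intervalIntegrable t (t + h))
      rw [hV, h1, h2, ← h7, sub_add_eq_add_sub t δ h]
      ring
    rw [h6]
    exact h5
  have b2 : |V - h / (2 * Real.pi) * Real.log (t / (2 * Real.pi))| ≤ (1 / 2 + ε / 2) * R t := by
    refine le_of_tendsto_of_tendsto ?_ ((hct.tendsto.comp hsub).const_mul _) hev
    have h1 : ContinuousAt (fun s : ℝ =>
        |V - h / (2 * Real.pi) * Real.log (s / (2 * Real.pi))|) t := by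
      have h2 : ContinuousAt (fun s : ℝ => Real.log (s / (2 * Real.pi))) t :=
        (continuousAt_id.div_const _).log (div_pos ht0 Real.two_pi_pos).ne'
      exact (continuousAt_const.sub (continuousAt_const.mul h2)).abs
    exact h1.tendsto.comp hsub
  have b3 := abs_integral_thetaDeriv_sub_le ht8.le hh hht
  have b4 : |(∫ y in t..(t + h), thetaDeriv y) / Real.pi -
      h / (2 * Real.pi) * Real.log (t / (2 * Real.pi))| ≤ 11 := by
    have e : (∫ y in t..(t + h), thetaDeriv y) / Real.pi -
        h / (2 * Real.pi) * Real.log (t / (2 * Real.pi)) =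
        ((∫ y in t..(t + h), thetaDeriv y) - 1 / 2 * Real.log (t / (2 * Real.pi)) * h) /
          Real.pi := by
      have := Real.pi_ne_zero
      field_simp
    rw [e, abs_div, abs_of_pos Real.pi_pos, div_le_iff₀ Real.pi_pos]
    linarith [Real.pi_gt_three]
  have b5 : 11 ≤ ε / 2 * R t := by
    rw [div_le_iff₀ (by positivity)] at hRt
    linarith
  change _ ≤ (1 / 2 + ε) * R t
  change _ ≤ (1 / 2 + ε / 2) * R t at b1
  rw [abs_le] at b1 b2 b4 ⊢
  constructor <;> linarith [b1.1, b1.2, b2.1, b2.2, b4.1, b4.2]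

end

/-! ### From every `ε` to a single `o(1)` -/

/-- At each `t` the infimum of the admissible positive `ε` is taken. The infimum need not be
admissible, so `1/t` is added before monotonicity is used. -/
lemma exists_tendsto_zero_of_forall_eventually {P : ℝ → ℝ → Prop}
    (hP : ∀ ε > 0, ∀ᶠ t in atTop, P ε t)
    (hmono : ∀ᶠ t in atTop, ∀ ε ε', ε ≤ ε' → P ε t → P ε' t) :
    ∃ η : ℝ → ℝ, Tendsto η atTop (𝓝 0) ∧ ∀ᶠ t in atTop, P (η t) t := by
  set s : ℝ → Set ℝ := fun t => {ε | 0 < ε ∧ P ε t} with hs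
  have hbdd : ∀ t, BddBelow (s t) := fun t => ⟨0, fun ε hε => hε.1.le⟩
  refine ⟨fun t => sInf (s t) + 1 / t, ?_, ?_⟩
  · have h1 : Tendsto (fun t => sInf (s t)) atTop (𝓝 0) := by
      rw [Metric.tendsto_nhds]
      intro ε hε
      filter_upwards [hP (ε / 2) (by positivity)] with t ht
      have h2 : sInf (s t) ≤ ε / 2 := csInf_le (hbdd t) ⟨by positivity, ht⟩
      have h3 : 0 ≤ sInf (s t) := Real.sInf_nonneg fun x hx => hx.1.le
      rw [dist_zero_right, Real.norm_of_nonneg h3]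
      linarith
    have h2 : Tendsto (fun t : ℝ => 1 / t) atTop (𝓝 0) := by
      simpa using tendsto_inv_atTop_zero (𝕜 := ℝ)
    simpa using h1.add h2
  · filter_upwards [hP 1 one_pos, hmono, eventually_gt_atTop 0] with t h1 h2 h3
    obtain ⟨ε, hε, hlt⟩ := exists_lt_of_csInf_lt (s := s t) ⟨1, one_pos, h1⟩
      (lt_add_of_pos_right (sInf (s t)) (one_div_pos.mpr h3))
    exact h2 ε _ hlt.le hε.2

lemma eventually_log_div_log_log_nonneg :
    ∀ᶠ t : ℝ in atTop, 0 ≤ Real.log t / Real.log (Real.log t) := by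
  filter_upwards [Real.tendsto_log_atTop.eventually_ge_atTop 1] with t ht
  exact div_nonneg (by linarith) (Real.log_nonneg ht)

theorem theorem1 (hRH : RiemannHypothesis) :
    (∃ η : ℝ → ℝ, Tendsto η atTop (𝓝 0) ∧
      ∀ᶠ t : ℝ in atTop, ∀ h : ℝ, 0 < h → h ≤ Real.sqrt t →
        |(zetaZeroCount (t + h) : ℝ) - (zetaZeroCount t : ℝ)
            - h / (2 * Real.pi) * Real.log (t / (2 * Real.pi))|
          ≤ (1 / 2 + η t) * (Real.log t / Real.log (Real.log t))) ∧
    (∃ η : ℝ → ℝ, Tendsto η atTop (𝓝 0) ∧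
      ∀ᶠ t : ℝ in atTop, ∀ h : ℝ, 0 < h → h ≤ Real.sqrt t →
        |zetaS (t + h) - zetaS t|
          ≤ (1 / 2 + η t) * (Real.log t / Real.log (Real.log t))) := by
  constructor
  · refine exists_tendsto_zero_of_forall_eventually (P := fun ε t => ∀ h : ℝ, 0 < h →
      h ≤ Real.sqrt t → |(zetaZeroCount (t + h) : ℝ) - (zetaZeroCount t : ℝ)
            - h / (2 * Real.pi) * Real.log (t / (2 * Real.pi))|
          ≤ (1 / 2 + ε) * (Real.log t / Real.log (Real.log t))) (fun ε hε => ?_) ?_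
    · filter_upwards [eventually_abs_zetaZeroCount_sub_le hRH hε] with t ht h hh hht
      exact ht h hh.le (by linarith [Real.sqrt_nonneg t])
    · filter_upwards [eventually_log_div_log_log_nonneg] with t ht ε ε' hε hP h hh hht
      exact (hP h hh hht).trans (by gcongr)
  · refine exists_tendsto_zero_of_forall_eventually (P := fun ε t => ∀ h : ℝ, 0 < h →
      h ≤ Real.sqrt t → |zetaS (t + h) - zetaS t|
          ≤ (1 / 2 + ε) * (Real.log t / Real.log (Real.log t))) (fun ε hε => ?_) ?_
    · filter_upwards [eventually_abs_zetaS_sub_le hRH hε] with t ht h hh hht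
      exact ht h hh.le hht
    · filter_upwards [eventually_log_div_log_log_nonneg] with t ht ε ε' hε hP h hh hht
      exact (hP h hh hht).trans (by gcongr)
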